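/- Let $M$ be a smooth (Hausdorff) four-manifold with a smooth Riemannian metric $g$, let $p\in M$, and let $(x^i)$ be geodesic (normal) coordinates centred at $p$ on a normal neighbourhood $V$ of $p$. Covariant derivatives (denoted by $;$), $\nabla$, $\mathrm{div}$, $\Delta$, norms, the volume element $dv$, the surface element $d\sigma$, the Ricci tensor $Ric$ and the scalar curvature $R$ are those of $g$; $|x|$ is the Euclidean norm of the coordinates. For $\gamma_2,\gamma_3\in\mathbb R$ let $$\mathcal N_g(u)=\tfrac{\gamma_2}{2}P_gu+6\gamma_3\Delta(\Delta u+|\nabla u|^2)-12\gamma_3\,\mathrm{div}\big[(\Delta u+|\nabla u|^2)\nabla u\big]+2\gamma_3\,\mathrm{div}(R\nabla u),$$ $$P_gu=\Delta^2u-\mathrm{div}\big(\tfrac23R\nabla u-2Ric(\cdot,\nabla u)\big).$$ Let $K\subset V$ be compact and $\Lambda\in\mathbb R$. There is a constant $C\ge 0$, depending only on $g,p,(x^i),K,\gamma_2,\gamma_3,\Lambda$, such that the following holds. Let $\Omega\subset K$ be open with $C^1$ boundary (lying locally on one side of it) and outer unit normal $\nu$, let $\mu\in\mathbb R$, let $\tilde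 U$ be a function with $|\tilde U|\le\Lambda$ in $\Omega$, and let $u$ be of class $C^4$ in a neighbourhood of $\overline\Omega$ and solve $$\mathcal N_g(u)+\tilde U=\mu e^{4u}\quad\text{in }\Omega .$$ Put $$\begin{aligned}\mathcal B_g(p,\Omega,u)={}&\Big(\frac{\gamma_2}2+6\gamma_3\Big)\oint_{\partial\Omega}\Big(x^iu_{;i}\frac{\partial\Delta u}{\partial\nu}-\Delta u\frac{\partial(x^iu_{;i})}{\partial\nu}+\frac12(\Delta u)^2x^j\nu_j\Big)d\sigma\\&-12\gamma_3\oint_{\partial\Omega}\Big(|\nabla u|^2u_{;k}\nu^kx^ju_{;j}-\frac14|\nabla u|^4x^j\nu_j\Big)d\sigma\\&+6\gamma_3\oint_{\partial\Omega}\Big[x^iu_{;i}\Big(\frac{\partial}{\partial\nu}|\nabla u|^2-2\Delta u\frac{\partial u}{\partial\nu}\Big)+|\nabla u|^2\Big(x^i\nu_i\Delta u-\frac{\partial u}{\partial\nu}-\nabla^2u[x,\nu]\Big)\Big]d\sigma\end{aligned}$$ and, for a vector field $a=a^i\partial/\partial x^i$ with constant components $(a^i)\in\mathbb R^4$ and $|a|$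 the Euclidean norm of $(a^i)$, $$\begin{aligned}\mathcal B_g(p,\Omega,a,u)={}&\Big(\frac{\gamma_2}2+6\gamma_3\Big)\oint_{\partial\Omega}\Big(a^iu_{;i}\frac{\partial\Delta u}{\partial\nu}-\Delta u\frac{\partial(a^iu_{;i})}{\partial\nu}+\frac12(\Delta u)^2a^j\nu_j\Big)d\sigma\\&-12\gamma_3\oint_{\partial\Omega}\Big(|\nabla u|^2u_{;k}\nu^ka^ju_{;j}-\frac14|\nabla u|^4a^j\nu_j\Big)d\sigma\\&+6\gamma_3\oint_{\partial\Omega}\Big[a^iu_{;i}\Big(\frac{\partial}{\partial\nu}|\nabla u|^2-2\Delta u\frac{\partial u}{\partial\nu}\Big)+|\nabla u|^2\Big(a^i\nu_i\Delta u-\nabla^2u[a,\nu]\Big)\Big]d\sigma .\end{aligned}$$ Then $$\begin{aligned}\Big|\mathcal B_g(p,\Omega,u)&+\mu\int_\Omega e^{4u}dv-\frac\mu4\oint_{\partial\Omega}e^{4u}x^i\nu_i\,d\sigma\Big|\le C\Big(|\mu|\int_\Omega e^{4u}|x|^2dv+\int_\Omega|\nabla u|(|x|+|\nabla u|)dv\\&+\int_\Omega|x|(|\nabla^2u||\nabla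 u|+|\nabla u|^3)dv+\int_\Omega|x|^2(|\nabla^2u|^2+|\nabla u|^4)dv\Big),\end{aligned}$$ and, for every such $a$, $$\begin{aligned}\Big|\mathcal B_g(p,\Omega,a,u)&-\frac\mu4\oint_{\partial\Omega}e^{4u}a^i\nu_i\,d\sigma\Big|\le C\Big(|\mu|\int_\Omega e^{4u}|x||a|dv+\int_\Omega|a||\nabla u|(1+|x||\nabla u|)dv\\&+\int_\Omega|a|(|\nabla^2u||\nabla u|+|\nabla u|^3)dv+\int_\Omega|x||a|(|\nabla^2u|^2+|\nabla u|^4)dv\Big).\end{aligned}$$ -/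

import Mathlib

open MeasureTheory Set Filter Topology
open scoped Manifold ContDiff Bundle

noncomputable section

namespace LogDet

/-- The coordinate space `ℝ⁴` with its Euclidean norm. -/
abbrev E4 : Type := EuclideanSpace ℝ (Fin 4)

/-- The parameter space `ℝ³` of the hypersurface patches. -/
abbrev E3 : Type := EuclideanSpace ℝ (Fin 3)

/-- Coordinate partial derivative `∂ᵢ f (x)`. -/
def pd (i : Fin 4) (f : E4 → ℝ) (x : E4) : ℝ :=
  fderiv ℝ f x (EuclideanSpace.single i 1)

/-! ### Riemannian calculus in coordinates

A metric is represented in coordinates by its matrix `G x = (g_{ij}(x))`; vector fields are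
represented by their contravariant components. -/

/-- A metric in coordinates. -/
abbrev CoordMetric : Type := E4 → Matrix (Fin 4) (Fin 4) ℝ

/-- Christoffel symbols `Γ^k_{ij}` of the Levi-Civita connection. -/
def christoffel (G : CoordMetric) (k i j : Fin 4) (x : E4) : ℝ :=
  (1 / 2) * ∑ l, (G x)⁻¹ k l *
    (pd i (fun y => G y j l) x + pd j (fun y => G y i l) x - pd l (fun y => G y i j) x)

/-- Ricci tensor
`R_{ij} = ∂_k Γ^k_{ij} - ∂_j Γ^k_{ik} + Γ^k_{kl} Γ^l_{ij} - Γ^k_{jl} Γ^l_{ik}`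
(positive on round spheres). -/
def ricci (G : CoordMetric) (i j : Fin 4) (x : E4) : ℝ :=
  ∑ k, (pd k (christoffel G k i j) x - pd j (christoffel G k i k) x
    + ∑ l, (christoffel G k k l x * christoffel G l i j x
      - christoffel G k j l x * christoffel G l i k x))

/-- Scalar curvature `R = g^{ij} R_{ij}`. -/
def scalarCurv (G : CoordMetric) (x : E4) : ℝ :=
  ∑ i, ∑ j, (G x)⁻¹ i j * ricci G i j x

/-- The scalar product `g(v, w) = g_{ij} vⁱ wʲ` at `x`. -/
def ginner (G : CoordMetric) (x v w : E4) : ℝ :=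
  ∑ i, ∑ j, G x i j * v i * w j

/-- The gradient `(∇u)ⁱ = g^{ij} ∂_j u`. -/
def grad (G : CoordMetric) (u : E4 → ℝ) (x : E4) : E4 :=
  WithLp.toLp 2 fun i => ∑ j, (G x)⁻¹ i j * pd j u x

/-- The divergence `X^i_{;i} = ∂_i Xⁱ + Γ^i_{ij} Xʲ`. -/
def divg (G : CoordMetric) (X : E4 → E4) (x : E4) : ℝ :=
  ∑ i, (pd i (fun y => X y i) x + ∑ j, christoffel G i i j x * X x j)

/-- The Laplace-Beltrami operator `Δu = div ∇u`. -/
def lap (G : CoordMetric) (u : E4 → ℝ) : E4 → ℝ :=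
  divg G (grad G u)

/-- The covariant Hessian `u_{;ij} = ∂_i ∂_j u - Γ^k_{ij} ∂_k u`. -/
def hess (G : CoordMetric) (u : E4 → ℝ) (i j : Fin 4) (x : E4) : ℝ :=
  pd i (pd j u) x - ∑ k, christoffel G k i j x * pd k u x

/-- `∇²u[v, w] = u_{;ij} vⁱ wʲ`. -/
def hessForm (G : CoordMetric) (u : E4 → ℝ) (x v w : E4) : ℝ :=
  ∑ i, ∑ j, hess G u i j x * v i * w j

/-- `|∇u|`, the norm of the gradient with respect to the metric. -/
def gradNorm (G : CoordMetric) (u : E4 → ℝ) (x : E4) : ℝ :=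
  Real.sqrt (ginner G x (grad G u x) (grad G u x))

/-- `|∇²u|`, the norm of the Hessian with respect to the metric. -/
def hessNorm (G : CoordMetric) (u : E4 → ℝ) (x : E4) : ℝ :=
  Real.sqrt (∑ i, ∑ j, ∑ k, ∑ l,
    (G x)⁻¹ i k * (G x)⁻¹ j l * hess G u i j x * hess G u k l x)

/-- The vector field `Ric(·, ∇u)`, with index raised: `g^{ij} R_{jk} (∇u)^k`. -/
def ricGrad (G : CoordMetric) (u : E4 → ℝ) (x : E4) : E4 :=
  WithLp.toLp 2 fun i => ∑ j, ∑ k, (G x)⁻¹ i j * ricci G j k x * grad G u x k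

/-- The Paneitz operator `P u = Δ²u - div ((2/3) R ∇u - 2 Ric(·, ∇u))`. -/
def paneitz (G : CoordMetric) (u : E4 → ℝ) (x : E4) : ℝ :=
  lap G (lap G u) x
    - divg G (fun y => ((2 / 3 : ℝ) * scalarCurv G y) • grad G u y - (2 : ℝ) • ricGrad G u y) x

/-- The quasilinear operator
`N(u) = (γ₂/2) P u + 6 γ₃ Δ(Δu + |∇u|²) - 12 γ₃ div((Δu + |∇u|²) ∇u) + 2 γ₃ div(R ∇u)`. -/
def logDetOp (G : CoordMetric) (γ₂ γ₃ : ℝ) (u : E4 → ℝ) (x : E4) : ℝ :=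
  γ₂ / 2 * paneitz G u x
    + 6 * γ₃ * lap G (fun y => lap G u y + gradNorm G u y ^ 2) x
    - 12 * γ₃ * divg G (fun y => (lap G u y + gradNorm G u y ^ 2) • grad G u y) x
    + 2 * γ₃ * divg G (fun y => scalarCurv G y • grad G u y) x

/-- `∫_D f dv`, with the Riemannian volume element `dv = √(det g) dx`. -/
def volInt (G : CoordMetric) (D : Set E4) (f : E4 → ℝ) : ℝ :=
  ∫ x in D, f x * Real.sqrt (G x).det

/-! ### Domains with `C¹` boundary, unit normal and surface measure -/

/-- Near its boundary point `x` the set `D` is `{ρ < 0}`, where `ρ` is of class `C¹` near `x`,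
`ρ(x) = 0` and `dρ(x) ≠ 0`. -/
def IsDefiningFunctionAt (D : Set E4) (x : E4) (ρ : E4 → ℝ) : Prop :=
  ContDiffAt ℝ 1 ρ x ∧ ρ x = 0 ∧ fderiv ℝ ρ x ≠ 0 ∧ ∀ᶠ y in 𝓝 x, (y ∈ D ↔ ρ y < 0)

/-- `D` has `C¹` boundary and lies locally on one side of it. -/
def HasC1Boundary (D : Set E4) : Prop :=
  ∀ x ∈ frontier D, ∃ ρ, IsDefiningFunctionAt D x ρ

open Classical in
/-- The outer unit normal `ν = ∇ρ / |∇ρ|` for the metric at a boundary point of `D`; it does not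
depend on the local defining function `ρ`. -/
def outerNormal (G : CoordMetric) (D : Set E4) (x : E4) : E4 :=
  if h : ∃ ρ, IsDefiningFunctionAt D x ρ then
    (gradNorm G h.choose x)⁻¹ • grad G h.choose x
  else 0

/-- `ψ : U → ∂D` is a regular injective `C¹` parametrization of a part of `∂D`, where `U` is an
open subset of `ℝ³`. -/
structure IsBoundaryPatch (D : Set E4) (U : Set E3) (ψ : E3 → E4) : Prop where
  isOpen : IsOpen U
  contDiffOn : ContDiffOn ℝ 1 ψ U
  injOn : InjOn ψ U
  mapsTo : MapsTo ψ U (frontier D)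
  immersion : ∀ y ∈ U, Function.Injective (fderiv ℝ ψ y)

/-- The matrix `h_{αβ} = g(∂_α ψ, ∂_β ψ)` of the metric induced on a parametrized hypersurface. -/
def inducedMetric (G : CoordMetric) (ψ : E3 → E4) (y : E3) : Matrix (Fin 3) (Fin 3) ℝ :=
  Matrix.of fun α β => ginner G (ψ y)
    (fderiv ℝ ψ y (EuclideanSpace.single α 1)) (fderiv ℝ ψ y (EuclideanSpace.single β 1))

/-- The area measure `√(det h) dy` of a patch, carried to its image. -/
def patchMeasure (G : CoordMetric) (U : Set E3) (ψ : E3 → E4) : Measure E4 :=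
  ((volume.restrict U).withDensity
    fun y => ENNReal.ofReal (Real.sqrt (inducedMetric G ψ y).det)).map ψ

/-- The Riemannian surface measure `dσ` of `∂D`. The area measures of any two patches agree on the
overlap of their images, and `dσ` is the measure obtained by gluing them: the smallest
measure that dominates the area measure of every patch. -/
def surfaceMeasure (G : CoordMetric) (D : Set E4) : Measure E4 :=
  sSup {m | ∃ U ψ, IsBoundaryPatch D U ψ ∧ m = patchMeasure G U ψ}

/-- `∮_{∂D} f dσ`. -/
def bdryInt (G : CoordMetric) (D : Set E4) (f : E4 → ℝ) : ℝ :=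
  ∫ x, f x ∂(surfaceMeasure G D)

/-! ### The boundary functionals

`fderiv ℝ f x (ν x)` is the normal derivative `∂f/∂ν`, `fderiv ℝ u x x` is `xⁱ u_{;i}` and
`fderiv ℝ u x a` is `aⁱ u_{;i}`. -/

/-- The boundary functional obtained from the radial field `xⁱ ∂_i`. -/
def bdryRadial (G : CoordMetric) (γ₂ γ₃ : ℝ) (D : Set E4) (u : E4 → ℝ) : ℝ :=
  let ν := outerNormal G D
  (γ₂ / 2 + 6 * γ₃) * bdryInt G D (fun x =>
      fderiv ℝ u x x * fderiv ℝ (lap G u) x (ν x)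
      - lap G u x * fderiv ℝ (fun y => fderiv ℝ u y y) x (ν x)
      + 1 / 2 * lap G u x ^ 2 * ginner G x x (ν x))
  - 12 * γ₃ * bdryInt G D (fun x =>
      gradNorm G u x ^ 2 * fderiv ℝ u x (ν x) * fderiv ℝ u x x
      - 1 / 4 * gradNorm G u x ^ 4 * ginner G x x (ν x))
  + 6 * γ₃ * bdryInt G D (fun x =>
      fderiv ℝ u x x * (fderiv ℝ (fun y => gradNorm G u y ^ 2) x (ν x)
        - 2 * lap G u x * fderiv ℝ u x (ν x))
      + gradNorm G u x ^ 2 * (ginner G x x (ν x) * lap G u x - fderiv ℝ u x (ν x)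
        - hessForm G u x x (ν x)))

/-- The boundary functional obtained from the field `aⁱ ∂_i` with constant components. -/
def bdryConst (G : CoordMetric) (γ₂ γ₃ : ℝ) (D : Set E4) (a : E4) (u : E4 → ℝ) : ℝ :=
  let ν := outerNormal G D
  (γ₂ / 2 + 6 * γ₃) * bdryInt G D (fun x =>
      fderiv ℝ u x a * fderiv ℝ (lap G u) x (ν x)
      - lap G u x * fderiv ℝ (fun y => fderiv ℝ u y a) x (ν x)
      + 1 / 2 * lap G u x ^ 2 * ginner G x a (ν x))
  - 12 * γ₃ * bdryInt G D (fun x =>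
      gradNorm G u x ^ 2 * fderiv ℝ u x (ν x) * fderiv ℝ u x a
      - 1 / 4 * gradNorm G u x ^ 4 * ginner G x a (ν x))
  + 6 * γ₃ * bdryInt G D (fun x =>
      fderiv ℝ u x a * (fderiv ℝ (fun y => gradNorm G u y ^ 2) x (ν x)
        - 2 * lap G u x * fderiv ℝ u x (ν x))
      + gradNorm G u x ^ 2 * (ginner G x a (ν x) * lap G u x - hessForm G u x a (ν x)))

/-! ### Geodesic coordinates on a Riemannian manifold -/

section Manifold

variable {M : Type*} [TopologicalSpace M] [ChartedSpace E4 M] [IsManifold 𝓘(ℝ, E4) ∞ M]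

/-- A smooth Riemannian metric on the four-manifold `M`. -/
abbrev SmoothMetric (M : Type*) [TopologicalSpace M] [ChartedSpace E4 M]
    [IsManifold 𝓘(ℝ, E4) ∞ M] :=
  Bundle.ContMDiffRiemannianMetric 𝓘(ℝ, E4) ∞ E4 (fun q : M => TangentSpace 𝓘(ℝ, E4) q)

/-- The `i`-th coordinate vector `∂/∂xⁱ` of the chart `φ`, at the point with coordinates `x`. -/
def coordVec (φ : OpenPartialHomeomorph M E4) (x : E4) (i : Fin 4) :
    TangentSpace 𝓘(ℝ, E4) (φ.symm x) :=
  mfderiv 𝓘(ℝ, E4) 𝓘(ℝ, E4) φ.symm x (EuclideanSpace.single i (1 : ℝ) : E4)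

/-- The matrix `g_{ij} = g(∂/∂xⁱ, ∂/∂xʲ)` of the metric in the chart `φ`. -/
def metricMatrix (g : SmoothMetric M) (φ : OpenPartialHomeomorph M E4) : CoordMetric :=
  fun x => Matrix.of fun i j => g.inner (φ.symm x) (coordVec φ x i) (coordVec φ x j)

end Manifold

/-- The curve `c` satisfies the geodesic equation `c̈^k + Γ^k_{ij}(c) ċⁱ ċʲ = 0` on `s`. -/
def IsGeodesicOn (G : CoordMetric) (c : ℝ → E4) (s : Set ℝ) : Prop :=
  ∀ t ∈ s, ∀ k, deriv (deriv c) t k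
    + ∑ i, ∑ j, christoffel G k i j (c t) * deriv c t i * deriv c t j = 0

/-- The chart `φ` is a system of geodesic (normal) coordinates centred at `p`, and its domain is
a normal neighbourhood of `p`: `φ` is a smooth chart with `φ(p) = 0`, its image is star-shaped about
the origin, the coordinate frame is orthonormal at `p`, and the rays `t ↦ t x` are
geodesics. Equivalently, `φ⁻¹(x) = exp_p(xⁱ eᵢ)` for an orthonormal basis `(eᵢ)` of `T_pM`. -/
structure IsGeodesicChart {M : Type*} [TopologicalSpace M] [ChartedSpace E4 M]
    [IsManifold 𝓘(ℝ, E4) ∞ M] (g : SmoothMetric M) (p : M)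
    (φ : OpenPartialHomeomorph M E4) : Prop where
  mem_atlas : φ ∈ IsManifold.maximalAtlas 𝓘(ℝ, E4) ∞ M
  mem_source : p ∈ φ.source
  map_center : φ p = 0
  star : StarConvex ℝ 0 φ.target
  orthonormal : metricMatrix g φ 0 = 1
  rays : ∀ x ∈ φ.target, IsGeodesicOn (metricMatrix g φ) (fun t => t • x) (Icc 0 1)

end LogDet

end

open LogDet

/-!
The proof is a Pohozaev argument: the equation is multiplied by `Xu`, where `X` is the radial field
`xⁱ ∂_i` or a field with constant components, and integrated over the domain. Both cases are treated
at once through the affine field `X = lam x + a` in the chart.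

*Pointwise identity.* If the metric were flat, `(γ₂/2 + 6γ₃) div Y₁ - 12γ₃ div Y₂ + 6γ₃ div Y₃` would
be exactly `Xu` times the operator for the fields `Y₁`, `Y₂`, `Y₃` called `biharmField`,
`quarticField` and `cubicField` below, because the problem is invariant under dilations and
translations in dimension four. For a general metric the failure of `X` to be conformal enters
through the three commutators `Δ(Xu) - XΔu - 2 lam Δu`,
`⟨∇u, ∇(Xu)⟩ - lam |∇u|² - X|∇u|²/2` and `∇²u[X] - ∇(Xu) + lam ∇u`, through `div X - 4 lam`, and
through the curvature terms of the operator. All of these are explicit in the coefficients of the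
metric; they are collected in `pohozaevDefect`, and `IsRiemannianOn.pohozaev_identity` is the
resulting identity. On the boundary the fields `Y₁`, `Y₂`, `Y₃` have the normal components that
appear in the boundary functionals.

*Size of the remainder.* In normal coordinates the Christoffel symbols, and hence the first
derivatives of the metric, vanish at the origin, so that they are `O(|x|)` on compact sets. The
components of `∇u` and `∇²u` are bounded by the Riemannian norms (Cauchy-Schwarz), and the estimate
`IsNormalOn.isBigO_pohozaevDefect` of the remainder by
`(|lam| |x| + |a|) (|∇u| + |∇²u| |∇u| + |∇u|³ + |x| (|∇²u|² + |∇u|⁴))` is a matter of counting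
factors. Uniformity in the function and the field is expressed by `=O` along a principal filter on
the type `EstDatum` of all data.

*Integration.* The divergence theorem `IsRiemannianOn.volInt_divg_eq_bdryInt` on domains with `C¹`
boundary is proved from scratch. Locally the domain lies on one side of a graph
(`IsDefiningFunctionAt.exists_isLocalGraph`); a shear reduces the flat statement to a half-space
(`integral_div_graph`); the surface measure, a supremum over all parametrizations, is on a graph the
area measure of the graph parametrization (`IsLocalGraph.surfaceMeasure_restrict`), whose density is
computed by a Gram determinant (`det_gram_graph`); a partition of unity finishes the argument. It is
applied to `Y₁`, `Y₂`, `Y₃` and to `e^{4u} X`, the latter producing the terms with `μ`, in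
`IsNormalOn.exists_bound`.

*Geodesic coordinates.* The geodesic equation of the rays at the origin reads
`Γ^k_{ij}(0) xⁱ xʲ = 0`, which gives `Γ(0) = 0` (`IsGeodesicChart.isNormalOn`).
-/

noncomputable section

namespace LogDet

/-! ### Slices of coordinate space and integration over half-spaces -/

/-- The `i`-th coordinate vector of `ℝ⁴`. -/
abbrev ev (i : Fin 4) : E4 := EuclideanSpace.single i 1

/-- The linear isomorphism `ℝ × ℝ³ ≃ ℝ⁴` that inserts a number as the `i`-th coordinate. -/
def slice (i : Fin 4) : (ℝ × E3) ≃L[ℝ] E4 :=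
  LinearEquiv.toContinuousLinearEquiv
    { toFun := fun p => WithLp.toLp 2 (i.insertNth p.1 p.2)
      invFun := fun x => (x i, WithLp.toLp 2 fun α => x (i.succAbove α))
      map_add' := by
        intro p q
        ext j
        refine i.succAboveCases ?_ (fun α => ?_) j <;> simp
      map_smul' := by
        intro c p
        ext j
        refine i.succAboveCases ?_ (fun α => ?_) j <;> simp
      left_inv := by
        intro p
        ext <;> simp
      right_inv := by
        intro x
        ext j
        refine i.succAboveCases ?_ (fun α => ?_) j <;> simp }

/-- The projection of `ℝ⁴` to `ℝ³` that forgets the `i`-th coordinate. -/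
def del (i : Fin 4) : E4 →L[ℝ] E3 :=
  (ContinuousLinearMap.snd ℝ ℝ E3).comp ((slice i).symm : E4 →L[ℝ] ℝ × E3)

@[simp] lemma slice_apply_same (i : Fin 4) (p : ℝ × E3) : slice i p i = p.1 := by
  simp [slice]

@[simp] lemma slice_apply_succAbove (i : Fin 4) (p : ℝ × E3) (α : Fin 3) :
    slice i p (i.succAbove α) = p.2 α := by
  simp [slice]

@[simp] lemma del_apply (i : Fin 4) (x : E4) (α : Fin 3) : del i x α = x (i.succAbove α) := by
  simp [del, slice]

@[simp] lemma del_slice (i : Fin 4) (p : ℝ × E3) : del i (slice i p) = p.2 := by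
  ext α; simp

lemma slice_del (i : Fin 4) (x : E4) : slice i (x i, del i x) = x := by
  ext j
  refine i.succAboveCases ?_ (fun α => ?_) j <;> simp

@[simp] lemma del_ev_same (i : Fin 4) : del i (ev i) = 0 := by
  ext α; simp [Fin.succAbove_ne]

lemma slice_add_smul (i : Fin 4) (t s : ℝ) (y : E3) :
    slice i (t, y) + s • ev i = slice i (t + s, y) := by
  ext j
  refine i.succAboveCases ?_ (fun α => ?_) j <;> simp [Fin.succAbove_ne]

lemma slice_volume_preserving (i : Fin 4) : MeasurePreserving (slice i) := by
  have h1 : MeasurePreserving (fun p : ℝ × E3 => (p.1, (p.2 : Fin 3 → ℝ))) :=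
    (MeasurePreserving.id _).prod (EuclideanSpace.volume_preserving_symm_measurableEquiv_toLp _)
  have h2 := (volume_preserving_piFinSuccAbove (fun _ : Fin 4 => ℝ) i).symm
  have h3 := (EuclideanSpace.volume_preserving_symm_measurableEquiv_toLp (Fin 4)).symm
  have := h3.comp (h2.comp h1)
  exact this

lemma integral_slice (i : Fin 4) (f : E4 → ℝ) :
    ∫ x, f x = ∫ p : ℝ × E3, f (slice i p) :=
  ((slice_volume_preserving i).integral_comp
    (slice i).toHomeomorph.measurableEmbedding f).symm

lemma hasDerivAt_slice (i : Fin 4) (y : E3) (f : E4 → ℝ) (hf : Differentiable ℝ f) (t : ℝ) :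
    HasDerivAt (fun t => f (slice i (t, y))) (pd i f (slice i (t, y))) t := by
  have h : HasDerivAt (fun t : ℝ => slice i (t, y)) (ev i) t := by
    have h0 : HasDerivAt (fun t : ℝ => slice i (0, y) + t • ev i) ((1:ℝ) • ev i) t :=
      ((hasDerivAt_id t).smul_const _).const_add _
    simpa [slice_add_smul] using h0
  exact (hf _).hasFDerivAt.comp_hasDerivAt t h

lemma continuous_pd (i : Fin 4) {f : E4 → ℝ} (hf : ContDiff ℝ 1 f) : Continuous (pd i f) :=
  (hf.continuous_fderiv one_ne_zero).clm_apply continuous_const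

lemma hasCompactSupport_pd (i : Fin 4) {f : E4 → ℝ} (hf : HasCompactSupport f) :
    HasCompactSupport (pd i f) :=
  (hf.fderiv (𝕜 := ℝ)).comp_left (g := fun L : E4 →L[ℝ] ℝ => L (ev i)) rfl

/-- Integration of a normal derivative over a half-space, weighted with a function of the
tangential variables. -/
lemma integral_halfspace_normal (i : Fin 4) {s : ℝ} (hs : s = 1 ∨ s = -1) {f : E4 → ℝ}
    (hf : ContDiff ℝ 1 f)
    (hc : HasCompactSupport f) {c : E3 → ℝ} (hcc : Continuous c) :
    ∫ x in {x : E4 | s * x i < 0}, c (del i x) * pd i f x = s * ∫ y, c y * f (slice i (0, y)) := by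
  have hm : MeasurableSet {x : E4 | s * x i < 0} :=
    measurableSet_lt (Continuous.measurable (by fun_prop)) measurable_const
  have hint : Integrable (fun x => c (del i x) * pd i f x) := by
    refine Continuous.integrable_of_hasCompactSupport
      ((hcc.comp (del i).continuous).mul (continuous_pd i hf)) ?_
    exact (hasCompactSupport_pd i hc).mul_left
  have hint2 := hint.indicator hm
  rw [← integral_indicator hm, integral_slice i]
  have hint3 := ((slice_volume_preserving i).integrable_comp_emb
    (slice i).toHomeomorph.measurableEmbedding).2 hint2
  simp only [Function.comp_def] at hint3
  rw [Measure.volume_eq_prod, integral_prod_symm _ hint3, ← integral_const_mul]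
  refine integral_congr_ae (ae_of_all _ fun y => ?_)
  have h1 : ∀ t : ℝ, indicator {x : E4 | s * x i < 0} (fun x => c (del i x) * pd i f x)
      (slice i (t, y))
      = indicator {t | s * t < 0} (fun t => c y * deriv (fun t => f (slice i (t, y))) t) t := by
    intro t
    have h2 := (hasDerivAt_slice i y f (hf.differentiable one_ne_zero) t).deriv
    simp [indicator, h2]
  simp only [h1]
  rw [integral_indicator (measurableSet_lt (Continuous.measurable (by fun_prop)) measurable_const),
    integral_const_mul]
  have hcd : ContDiff ℝ 1 (fun t : ℝ => f (slice i (t, y))) := by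
    refine hf.comp ((slice i).contDiff.comp (by fun_prop))
  have hcs : HasCompactSupport (fun t : ℝ => f (slice i (t, y))) := by
    refine hc.comp_isClosedEmbedding (g := fun t : ℝ => slice i (t, y)) ?_
    exact (slice i).toHomeomorph.isClosedEmbedding.comp
      (Function.LeftInverse.isClosedEmbedding (f := Prod.fst) (fun _ => rfl) continuous_fst
        (by fun_prop))
  rcases hs with rfl | rfl
  · have : {t : ℝ | 1 * t < 0} = Iio 0 := by ext; simp
    rw [this, ← integral_Iic_eq_integral_Iio, hcs.integral_Iic_deriv_eq hcd, one_mul]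
  · have : {t : ℝ | -1 * t < 0} = Ioi 0 := by ext; simp
    rw [this, hcs.integral_Ioi_deriv_eq hcd]
    ring

/-- Tangential derivatives have vanishing integral over a half-space. -/
lemma integral_halfspace_tangential (i : Fin 4) (s : ℝ) (α : Fin 3) {f : E4 → ℝ}
    (hf : ContDiff ℝ 1 f)
    (hc : HasCompactSupport f) :
    ∫ x in {x : E4 | s * x i < 0}, pd (i.succAbove α) f x = 0 := by
  have hm : MeasurableSet {x : E4 | s * x i < 0} :=
    measurableSet_lt (Continuous.measurable (by fun_prop)) measurable_const
  have hint : Integrable (pd (i.succAbove α) f) :=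
    (continuous_pd _ hf).integrable_of_hasCompactSupport (hasCompactSupport_pd _ hc)
  have hint2 := hint.indicator hm
  rw [← integral_indicator hm, integral_slice i]
  have hint3 := ((slice_volume_preserving i).integrable_comp_emb
    (slice i).toHomeomorph.measurableEmbedding).2 hint2
  simp only [Function.comp_def] at hint3
  rw [Measure.volume_eq_prod, integral_prod _ hint3]
  rw [integral_eq_zero_of_ae (ae_of_all _ fun t => ?_)]
  by_cases ht : s * t < 0
  swap
  · simp [indicator, ht]
  have h1 : ∀ y : E3, indicator {x : E4 | s * x i < 0} (pd (i.succAbove α) f) (slice i (t, y)) =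
      fderiv ℝ (fun y => f (slice i (t, y))) y (EuclideanSpace.single α 1) * (1:ℝ) := by
    intro y
    have h : HasFDerivAt (fun y : E3 => slice i (t, y))
        (((slice i : (ℝ × E3) →L[ℝ] E4)).comp (ContinuousLinearMap.inr ℝ ℝ E3)) y :=
      (slice i).hasFDerivAt.comp y (hasFDerivAt_prodMk_right t y)
    have h2 := ((hf.differentiable one_ne_zero (slice i (t, y))).hasFDerivAt.comp y h).fderiv
    simp only [Function.comp_def] at h2
    rw [h2]
    have h3 : slice i (0, EuclideanSpace.single α 1) = ev (i.succAbove α) := by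
      ext j
      refine i.succAboveCases ?_ (fun β => ?_) j <;> simp [Fin.ne_succAbove]
    simp [indicator, ht, pd, h3]
  simp only [h1, Pi.zero_apply]
  have hcd : ContDiff ℝ 1 (fun y : E3 => f (slice i (t, y))) := by
    refine hf.comp ((slice i).contDiff.comp (by fun_prop))
  have hcs : HasCompactSupport (fun y : E3 => f (slice i (t, y))) := by
    refine hc.comp_isClosedEmbedding (g := fun y : E3 => slice i (t, y)) ?_
    exact (slice i).toHomeomorph.isClosedEmbedding.comp
      (Function.LeftInverse.isClosedEmbedding (f := Prod.snd) (fun _ => rfl) continuous_snd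
        (by fun_prop))
  have hI : Integrable (fun y => fderiv ℝ (fun y => f (slice i (t, y))) y
      (EuclideanSpace.single α 1)) := by
    refine Continuous.integrable_of_hasCompactSupport
      ((hcd.continuous_fderiv one_ne_zero).clm_apply continuous_const) ?_
    exact (hcs.fderiv (𝕜 := ℝ)).comp_left
      (g := fun L : E3 →L[ℝ] ℝ => L (EuclideanSpace.single α 1)) rfl
  have := integral_mul_fderiv_eq_neg_fderiv_mul_of_integrable (𝕜 := ℝ) (μ := (volume : Measure E3))
    (f := fun _ => (1:ℝ)) (g := fun y : E3 => f (slice i (t, y))) (v := EuclideanSpace.single α 1)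
    (by simp) (by simpa using hI)
    (by simpa using hcd.continuous.integrable_of_hasCompactSupport hcs)
    (fun _ _ => differentiableAt_const _)
    (fun x _ => hcd.differentiable one_ne_zero x)
  simpa using this

/-! ### The flat divergence theorem on one side of a graph -/

/-- The shear `x ↦ x + h(x̂) eᵢ`, where `x̂` are the coordinates of `x` other than the `i`-th. -/
def shear (i : Fin 4) (h : E3 → ℝ) (hh : Continuous h) : E4 ≃ₜ E4 where
  toFun x := x + h (del i x) • ev i
  invFun x := x - h (del i x) • ev i
  left_inv x := by simp
  right_inv x := by simp
  continuous_toFun := by fun_prop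
  continuous_invFun := by fun_prop

lemma shear_apply (i : Fin 4) (h : E3 → ℝ) (hh : Continuous h) (x : E4) :
    shear i h hh x = x + h (del i x) • ev i := rfl

lemma shear_slice (i : Fin 4) (h : E3 → ℝ) (hh : Continuous h) (p : ℝ × E3) :
    shear i h hh (slice i p) = slice i (p.1 + h p.2, p.2) := by
  rw [shear_apply, del_slice, ← slice_add_smul]

lemma shear_volume_preserving (i : Fin 4) (h : E3 → ℝ) (hh : Continuous h) :
    MeasurePreserving (shear i h hh) := by
  have h1 : MeasurePreserving (fun p : E3 × ℝ => (p.1, p.2 + h p.1))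
      ((volume : Measure E3).prod volume) (volume.prod volume) :=
    (MeasurePreserving.id (volume : Measure E3)).skew_product (g := fun y t => t + h y)
      (Continuous.measurable (by fun_prop))
      (ae_of_all _ fun y => map_add_right_eq_self _ _)
  have h2 := ((Measure.measurePreserving_swap (μ := (volume : Measure E3))
    (ν := (volume : Measure ℝ))).comp h1).comp
      (Measure.measurePreserving_swap (μ := (volume : Measure ℝ)) (ν := (volume : Measure E3)))
  have hs : MeasurePreserving (slice i).toHomeomorph.toMeasurableEquiv :=
    slice_volume_preserving i
  have h3 := ((slice_volume_preserving i).comp h2).comp hs.symm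
  convert h3 using 1
  ext1 x
  obtain ⟨p, rfl⟩ := (slice i).surjective x
  have : (slice i).toHomeomorph.toMeasurableEquiv.symm (slice i p) = p :=
    (slice i).symm_apply_apply p
  simp only [Function.comp_apply, this, shear_slice]
  rfl

/-- The divergence theorem on the domain below or above the graph of a `C¹` function, for
compactly supported fields. -/
lemma integral_div_graph (i : Fin 4) {s : ℝ} (hs : s = 1 ∨ s = -1) {h : E3 → ℝ}
    (hh : ContDiff ℝ 1 h) {Y : E4 → E4} (hY : ContDiff ℝ 1 Y) (hc : HasCompactSupport Y) :
    ∫ x in {x : E4 | s * (x i - h (del i x)) < 0}, ∑ j, pd j (fun y => Y y j) x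
      = s * ∫ y, (Y (slice i (h y, y)) i - ∑ α, fderiv ℝ h y (EuclideanSpace.single α 1)
          * Y (slice i (h y, y)) (i.succAbove α)) := by
  set T := shear i h hh.continuous with hT
  have hTd : ContDiff ℝ 1 T := by
    have : ContDiff ℝ 1 fun x => x + h (del i x) • ev i := by fun_prop
    exact this
  set Z : Fin 4 → E4 → ℝ := fun j x => Y (T x) j with hZ
  have hYj : ∀ j, ContDiff ℝ 1 (fun y => Y y j) := fun j => by fun_prop
  have hZd : ∀ j, ContDiff ℝ 1 (Z j) := fun j => (hYj j).comp hTd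
  have hZc : ∀ j, HasCompactSupport (Z j) := fun j =>
    (hc.comp_homeomorph T).comp_left (g := fun v : E4 => v j) rfl
  have hTf : ∀ x, HasFDerivAt T (ContinuousLinearMap.id ℝ E4 +
      ((fderiv ℝ h (del i x)).comp (del i)).smulRight (ev i)) x := by
    intro x
    have h1 : HasFDerivAt (fun x => h (del i x)) ((fderiv ℝ h (del i x)).comp (del i)) x :=
      (hh.differentiable one_ne_zero _).hasFDerivAt.comp x (del i).hasFDerivAt
    exact (hasFDerivAt_id x).add (h1.smul_const (ev i))
  have hZi : ∀ j x, pd i (Z j) x = pd i (fun y => Y y j) (T x) := by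
    intro j x
    have := (((hYj j).differentiable one_ne_zero (T x)).hasFDerivAt.comp x (hTf x)).fderiv
    simp only [pd, hZ]
    simp only [Function.comp_def] at this
    rw [this]
    simp
  have hdel : ∀ α, del i (ev (i.succAbove α)) = EuclideanSpace.single α 1 := by
    intro α; ext β; simp
  have hZα : ∀ j α x, pd (i.succAbove α) (Z j) x = pd (i.succAbove α) (fun y => Y y j) (T x)
      + fderiv ℝ h (del i x) (EuclideanSpace.single α 1) * pd i (fun y => Y y j) (T x) := by
    intro j α x
    have := (((hYj j).differentiable one_ne_zero (T x)).hasFDerivAt.comp x (hTf x)).fderiv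
    simp only [pd, hZ]
    simp only [Function.comp_def] at this
    rw [this]
    simp [hdel]
  -- the volume preserving shear `T` carries the half-space to the domain on one side of the graph
  have hpre : T ⁻¹' {x : E4 | s * (x i - h (del i x)) < 0} = {x : E4 | s * x i < 0} := by
    ext x
    simp [hT, shear_apply]
  have hTm : MeasurePreserving T := shear_volume_preserving i h _
  rw [← hTm.setIntegral_preimage_emb T.measurableEmbedding, hpre]
  have hpt : ∀ x, ∑ j, pd j (fun y => Y y j) (T x) = (1 : ℝ) * pd i (Z i) x
      + ∑ α, (pd (i.succAbove α) (Z (i.succAbove α)) x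
        - fderiv ℝ h (del i x) (EuclideanSpace.single α 1) * pd i (Z (i.succAbove α)) x) := by
    intro x
    rw [Fin.sum_univ_succAbove _ i]
    simp [hZi, hZα]
  simp only [hpt]
  have hcont : ∀ α : Fin 3, Continuous fun y => fderiv ℝ h y (EuclideanSpace.single α 1) :=
    fun α => (hh.continuous_fderiv one_ne_zero).clm_apply continuous_const
  have hI : ∀ j k, Integrable (pd k (Z j)) := fun j k =>
    (continuous_pd _ (hZd j)).integrable_of_hasCompactSupport (hasCompactSupport_pd _ (hZc j))
  have hI2 : ∀ j α, Integrable
      (fun x => fderiv ℝ h (del i x) (EuclideanSpace.single α 1) * pd i (Z j) x) := fun j α =>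
    Continuous.integrable_of_hasCompactSupport
      (((hcont α).comp (del i).continuous).mul (continuous_pd _ (hZd j)))
      (hasCompactSupport_pd _ (hZc j)).mul_left
  have hemb : IsClosedEmbedding fun y : E3 => slice i (0, y) :=
    (slice i).toHomeomorph.isClosedEmbedding.comp
      (Function.LeftInverse.isClosedEmbedding (f := Prod.snd) (fun _ => rfl) continuous_snd
        (by fun_prop))
  have hI3 : ∀ (c : E3 → ℝ) j, Continuous c → Integrable fun y => c y * Z j (slice i (0, y)) := by
    intro c j hcc
    refine Continuous.integrable_of_hasCompactSupport
      (hcc.mul ((hZd j).continuous.comp hemb.continuous)) ?_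
    exact ((hZc j).comp_isClosedEmbedding hemb).mul_left
  have hT0 : ∀ y, T (slice i (0, y)) = slice i (h y, y) := fun y => by
    rw [hT, shear_slice]; simp
  rw [integral_add, integral_finsetSum]
  · have e1 := integral_halfspace_normal i hs (hZd i) (hZc i) (c := fun _ => 1) continuous_const
    rw [e1]
    have e2 : ∀ α, ∫ x in {x : E4 | s * x i < 0}, (pd (i.succAbove α) (Z (i.succAbove α)) x
        - fderiv ℝ h (del i x) (EuclideanSpace.single α 1) * pd i (Z (i.succAbove α)) x)
        = - (s * ∫ y, fderiv ℝ h y (EuclideanSpace.single α 1)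
          * Z (i.succAbove α) (slice i (0, y))) := by
      intro α
      rw [integral_sub (hI _ _).integrableOn (hI2 _ _).integrableOn,
        integral_halfspace_tangential i s α (hZd _) (hZc _),
        integral_halfspace_normal i hs (hZd _) (hZc _) (hcont α), zero_sub]
    simp only [e2]
    rw [integral_sub, integral_finsetSum]
    · simp only [hZ, hT0, one_mul, Finset.mul_sum, Finset.sum_neg_distrib, mul_sub]
      ring
    · intro α _
      simpa only [hZ, hT0] using hI3 _ (i.succAbove α) (hcont α)
    · simpa only [hZ, hT0, one_mul] using hI3 (fun _ => 1) i continuous_const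
    · refine integrable_finsetSum _ fun α _ => ?_
      simpa only [hZ, hT0] using hI3 _ (i.succAbove α) (hcont α)
  · intro α _
    exact ((hI _ _).sub (hI2 _ _)).integrableOn
  · simp only [one_mul]; exact (hI i i).integrableOn
  · exact (integrable_finsetSum _ fun α _ => (hI _ _).sub (hI2 _ _)).integrableOn

/-! ### Local graphs and the outer normal -/

/-- In the open set `W` the set `D` is the part below (`s = 1`) or above (`s = -1`) the graph
`xᵢ = h(x̂)` of a `C¹` function of the remaining coordinates. -/
structure IsLocalGraph (D W : Set E4) (i : Fin 4) (s : ℝ) (h : E3 → ℝ) : Prop where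
  isOpen : IsOpen W
  sign : s = 1 ∨ s = -1
  contDiff : ContDiff ℝ 1 h
  mem_iff : ∀ x ∈ W, x ∈ D ↔ s * (x i - h (del i x)) < 0

/-- A `C¹` function defined near a point agrees near that point with a globally `C¹` function. -/
lemma exists_contDiff_eventuallyEq {h : E3 → ℝ} {y : E3} (hh : ContDiffAt ℝ 1 h y) :
    ∃ k : E3 → ℝ, ContDiff ℝ 1 k ∧ k =ᶠ[𝓝 y] h := by
  have hev : ∀ᶠ z in 𝓝 y, ContDiffAt ℝ 1 h z := hh.eventually (by simp)
  obtain ⟨ε, hε, hball⟩ := Metric.eventually_nhds_iff_ball.1 hev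
  let χ : ContDiffBump y := ⟨ε / 4, ε / 2, by positivity, by linarith⟩
  refine ⟨fun z => χ z * h z, ?_, ?_⟩
  · rw [contDiff_iff_contDiffAt]
    intro z
    by_cases hz : z ∈ tsupport χ
    · refine χ.contDiff.contDiffAt.mul (hball z ?_)
      rw [χ.tsupport_eq] at hz
      have : dist z y ≤ ε / 2 := hz
      exact Metric.mem_ball.2 (by linarith)
    · have h0 : χ =ᶠ[𝓝 z] 0 := notMem_tsupport_iff_eventuallyEq.1 hz
      refine (contDiffAt_const (c := (0 : ℝ))).congr_of_eventuallyEq ?_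
      filter_upwards [h0] with w hw
      simp [hw]
  · filter_upwards [χ.eventuallyEq_one] with z hz
    simp [hz]

lemma hasDerivAt_slice_line (i : Fin 4) (y : E3) (t : ℝ) :
    HasDerivAt (fun t : ℝ => slice i (t, y)) (ev i) t := by
  have h0 : HasDerivAt (fun t : ℝ => slice i (0, y) + t • ev i) ((1:ℝ) • ev i) t :=
    ((hasDerivAt_id t).smul_const _).const_add _
  simpa [slice_add_smul] using h0

/-- Near each boundary point a set with `C¹` boundary lies on one side of the graph of a `C¹`
function over a coordinate hyperplane. -/
lemma IsDefiningFunctionAt.exists_isLocalGraph {D : Set E4} {x₀ : E4} {ρ : E4 → ℝ}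
    (hρ : IsDefiningFunctionAt D x₀ ρ) {V : Set E4} (hV : V ∈ 𝓝 x₀) :
    ∃ W i s h, x₀ ∈ W ∧ W ⊆ V ∧ IsLocalGraph D W i s h := by
  obtain ⟨hC, h0, hne, hD⟩ := hρ
  obtain ⟨i, hi⟩ : ∃ i, pd i ρ x₀ ≠ 0 := by
    by_contra! hcon
    apply hne
    refine ContinuousLinearMap.coe_injective
      ((EuclideanSpace.basisFun (Fin 4) ℝ).toBasis.ext fun i => ?_)
    simpa [pd] using hcon i
  obtain ⟨s, hs, hspos⟩ : ∃ s : ℝ, (s = 1 ∨ s = -1) ∧ 0 < s * pd i ρ x₀ := by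
    rcases lt_or_gt_of_ne hi with h | h
    · exact ⟨-1, Or.inr rfl, by linarith⟩
    · exact ⟨1, Or.inl rfl, by linarith⟩
  -- the implicit function theorem for `(y, t) ↦ ρ (slice i (t, y))`
  let f : E3 × ℝ → ℝ := fun p => ρ (slice i (p.2, p.1))
  let u : E3 × ℝ := (del i x₀, x₀ i)
  have hu : slice i (u.2, u.1) = x₀ := slice_del i x₀
  have hf : ContDiffAt ℝ 1 f u := by
    have : ContDiffAt ℝ 1 ρ (slice i (u.2, u.1)) := by rwa [hu]
    exact this.comp u (f := fun p : E3 × ℝ => slice i (p.2, p.1))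
      ((slice i).contDiff.comp (by fun_prop)).contDiffAt
  have hinv : (fderiv ℝ f u ∘L .inr ℝ E3 ℝ).IsInvertible := by
    have hval : (fderiv ℝ f u ∘L .inr ℝ E3 ℝ) 1 = pd i ρ x₀ := by
      have h1 : HasDerivAt (fun t : ℝ => f (u.1, t)) (fderiv ℝ f u (0, 1)) u.2 := by
        have := (hf.differentiableAt one_ne_zero).hasFDerivAt.comp_hasDerivAt u.2
          (f := fun t : ℝ => (u.1, t)) ((hasDerivAt_const u.2 u.1).prodMk (hasDerivAt_id u.2))
        simpa [Function.comp_def] using this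
      have h2 : HasDerivAt (fun t : ℝ => f (u.1, t)) (pd i ρ x₀) u.2 := by
        have hd : HasFDerivAt ρ (fderiv ℝ ρ x₀) (slice i (u.2, u.1)) := by
          rw [hu]; exact (hC.differentiableAt one_ne_zero).hasFDerivAt
        exact hd.comp_hasDerivAt u.2 (hasDerivAt_slice_line i u.1 u.2)
      simpa using h1.unique h2
    refine ⟨ContinuousLinearEquiv.unitsEquivAut ℝ (Units.mk0 (pd i ρ x₀) hi), ?_⟩
    ext
    simp [← hval]
  let h₀ := hf.implicitFunction one_ne_zero hinv
  have hh₀ : ContDiffAt ℝ 1 h₀ (del i x₀) := hf.contDiffAt_implicitFunction one_ne_zero hinv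
  have hh₀val : h₀ (del i x₀) = x₀ i := hf.implicitFunction_apply_self one_ne_zero hinv
  have hh₀eq : ∀ᶠ y in 𝓝 (del i x₀), f (y, h₀ y) = f u :=
    hf.eventually_apply_implicitFunction one_ne_zero hinv
  obtain ⟨h, hh, hheq⟩ := exists_contDiff_eventuallyEq hh₀
  have hhval : h (del i x₀) = x₀ i := by rw [hheq.self_of_nhds, hh₀val]
  have hfu : f u = 0 := by simp only [f, hu, h0]
  have hzero : ∀ᶠ y in 𝓝 (del i x₀), ρ (slice i (h y, y)) = 0 := by
    filter_upwards [hh₀eq, hheq] with y hy hy'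
    rw [hy', ← hfu, ← hy]
  have hpd : ContinuousAt (pd i ρ) x₀ :=
    ((hC.fderiv_right (m := 0) le_rfl).continuousAt).clm_apply continuousAt_const
  have hgood : ∀ᶠ x in 𝓝 x₀, DifferentiableAt ℝ ρ x ∧ 0 < s * pd i ρ x ∧ (x ∈ D ↔ ρ x < 0) := by
    have e1 : ∀ᶠ x in 𝓝 x₀, ContDiffAt ℝ 1 ρ x := hC.eventually (by simp)
    have e2 : ∀ᶠ x in 𝓝 x₀, 0 < s * pd i ρ x :=
      (continuousAt_const.mul hpd).eventually (lt_mem_nhds hspos)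
    filter_upwards [e1, e2, hD] with x a b c
    exact ⟨a.differentiableAt one_ne_zero, b, c⟩
  obtain ⟨ε, hε, hball⟩ := Metric.eventually_nhds_iff_ball.1 hgood
  have hψc : Continuous fun x : E4 => slice i (h (del i x), del i x) := by
    have := hh.continuous
    fun_prop
  have hψ0 : slice i (h (del i x₀), del i x₀) = x₀ := by rw [hhval, slice_del]
  have hψev : ∀ᶠ x in 𝓝 x₀, slice i (h (del i x), del i x) ∈ Metric.ball x₀ ε :=
    hψc.continuousAt.eventually_mem (by rw [hψ0]; exact Metric.ball_mem_nhds _ hε)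
  have hzev : ∀ᶠ x in 𝓝 x₀, ρ (slice i (h (del i x), del i x)) = 0 :=
    (del i).continuous.continuousAt.eventually hzero
  have hbev : ∀ᶠ x in 𝓝 x₀, x ∈ Metric.ball x₀ ε := Metric.ball_mem_nhds x₀ hε
  have hVev : ∀ᶠ x in 𝓝 x₀, x ∈ V := hV
  obtain ⟨W, hW, hWo, hxW⟩ := eventually_nhds_iff.1
    ((hψev.and hzev).and (hbev.and hVev))
  refine ⟨W, i, s, h, hxW, fun x hx => (hW x hx).2.2, hWo, hs, hh, fun x hx => ?_⟩
  obtain ⟨⟨hx1, hx2⟩, hx3, -⟩ := hW x hx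
  rw [(hball x hx3).2.2]
  set y := del i x with hy
  let T : Set ℝ := {t | slice i (t, y) ∈ Metric.ball x₀ ε}
  have hlc : Continuous fun t : ℝ => slice i (t, y) := by fun_prop
  have hTo : IsOpen T := Metric.isOpen_ball.preimage hlc
  have hTc : Convex ℝ T := by
    have : T = (fun t : ℝ => t • ev i) ⁻¹'
        ((fun v : E4 => v + slice i (0, y)) ⁻¹' Metric.ball x₀ ε) := by
      ext t
      simp only [T, mem_ofPred_eq, mem_preimage]
      rw [add_comm, slice_add_smul, zero_add]
    rw [this]
    exact ((convex_ball x₀ ε).translate_preimage_left _).is_linear_preimage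
      (IsLinearMap.isLinearMap_smul' (ev i))
  have hder : ∀ t ∈ T, HasDerivAt (fun t => s * ρ (slice i (t, y)))
      (s * pd i ρ (slice i (t, y))) t := fun t ht =>
    ((hball _ ht).1.hasFDerivAt.comp_hasDerivAt t (hasDerivAt_slice_line i y t)).const_mul s
  have hmono : StrictMonoOn (fun t => s * ρ (slice i (t, y))) T := by
    refine strictMonoOn_of_deriv_pos hTc (fun t ht => (hder t ht).continuousAt.continuousWithinAt)
      fun t ht => ?_
    rw [hTo.interior_eq] at ht
    rw [(hder t ht).deriv]
    exact (hball _ ht).2.1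
  have hxi : x i ∈ T := by simpa [T, hy, slice_del] using hx3
  have hhi : h y ∈ T := hx1
  have hρx : ρ (slice i (x i, y)) = ρ x := by rw [hy, slice_del]
  have k1 := hmono.lt_iff_lt hxi hhi
  have k2 := hmono.lt_iff_lt hhi hxi
  simp only [hρx, hx2, mul_zero] at k1 k2
  rcases hs with rfl | rfl
  · simpa using k1
  · simpa using k2

/-- Two defining functions of a set at a boundary point have positively proportional
differentials there. -/
lemma IsDefiningFunctionAt.fderiv_eq_smul {D : Set E4} {x : E4} {ρ₁ ρ₂ : E4 → ℝ}
    (h₁ : IsDefiningFunctionAt D x ρ₁) (h₂ : IsDefiningFunctionAt D x ρ₂) :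
    ∃ c : ℝ, 0 < c ∧ fderiv ℝ ρ₁ x = c • fderiv ℝ ρ₂ x := by
  obtain ⟨hC₁, h01, hne₁, hD₁⟩ := h₁
  obtain ⟨hC₂, h02, hne₂, hD₂⟩ := h₂
  have hline : ∀ (ρ : E4 → ℝ), ContDiffAt ℝ 1 ρ x → ∀ v,
      HasDerivAt (fun t : ℝ => ρ (x + t • v)) (fderiv ℝ ρ x v) 0 := by
    intro ρ hρ v
    have hl : HasDerivAt (fun t : ℝ => x + t • v) ((1 : ℝ) • v) 0 :=
      ((hasDerivAt_id (0:ℝ)).smul_const v).const_add x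
    have hd : HasFDerivAt ρ (fderiv ℝ ρ x) (x + (0 : ℝ) • v) := by
      simpa using (hρ.differentiableAt one_ne_zero).hasFDerivAt
    exact hd.comp_hasDerivAt (0:ℝ) (by simpa using hl)
  -- a direction in which `ρ₂` decreases points into `D`, so that `ρ₁` does not increase in it
  have key : ∀ v, fderiv ℝ ρ₂ x v < 0 → fderiv ℝ ρ₁ x v ≤ 0 := by
    intro v hv
    have hx : Tendsto (fun t : ℝ => x + t • v) (𝓝[>] 0) (𝓝 x) := by
      have : Tendsto (fun t : ℝ => x + t • v) (𝓝 0) (𝓝 (x + (0 : ℝ) • v)) :=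
        Continuous.tendsto (by fun_prop) 0
      simpa using this.mono_left nhdsWithin_le_nhds
    have hslope : ∀ᶠ t in 𝓝[>] (0 : ℝ), t⁻¹ * ρ₂ (x + t • v) < 0 := by
      have := (hasDerivAt_iff_tendsto_slope_zero.1 (hline ρ₂ hC₂ v)).mono_left
        (nhdsWithin_mono (0:ℝ) (fun t (ht : t ∈ Ioi (0:ℝ)) => ne_of_gt ht))
      simpa [h02] using this.eventually (gt_mem_nhds hv)
    have hlim := (hasDerivAt_iff_tendsto_slope_zero.1 (hline ρ₁ hC₁ v)).mono_left
        (nhdsWithin_mono (0:ℝ) (fun t (ht : t ∈ Ioi (0:ℝ)) => ne_of_gt ht))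
    refine le_of_tendsto hlim ?_
    filter_upwards [hslope, hx.eventually hD₁, hx.eventually hD₂, self_mem_nhdsWithin]
      with t ht e1 e2 ht0
    have ht0 : 0 < t := ht0
    have hneg : ρ₂ (x + t • v) < 0 := by
      by_contra hcon
      exact absurd ht (not_lt.2 (mul_nonneg (inv_pos.2 ht0).le (not_lt.1 hcon)))
    have : ρ₁ (x + t • v) < 0 := e1.1 (e2.2 hneg)
    simpa [h01] using mul_nonpos_of_nonneg_of_nonpos (inv_pos.2 ht0).le this.le
  obtain ⟨v₀, hv₀⟩ : ∃ v, fderiv ℝ ρ₂ x v < 0 := by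
    obtain ⟨v, hv⟩ : ∃ v, fderiv ℝ ρ₂ x v ≠ 0 := by
      by_contra! hcon
      exact hne₂ (ContinuousLinearMap.ext hcon)
    rcases lt_or_gt_of_ne hv with h | h
    · exact ⟨v, h⟩
    · exact ⟨-v, by simpa using h⟩
  have hker : ∀ v, fderiv ℝ ρ₂ x v = 0 → fderiv ℝ ρ₁ x v = 0 := by
    intro v hv
    have hall : ∀ t : ℝ, fderiv ℝ ρ₁ x v₀ + t * fderiv ℝ ρ₁ x v ≤ 0 := by
      intro t
      have := key (v₀ + t • v) (by simpa [hv] using hv₀)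
      simpa using this
    by_contra hcon
    have := hall ((1 - fderiv ℝ ρ₁ x v₀) / fderiv ℝ ρ₁ x v)
    rw [div_mul_cancel₀ _ hcon] at this
    linarith
  set c := fderiv ℝ ρ₁ x v₀ / fderiv ℝ ρ₂ x v₀ with hc
  have heq : fderiv ℝ ρ₁ x = c • fderiv ℝ ρ₂ x := by
    ext v
    have := hker (v - (fderiv ℝ ρ₂ x v / fderiv ℝ ρ₂ x v₀) • v₀) (by
      simp [div_mul_cancel₀ _ hv₀.ne])
    simp only [map_sub, map_smul, smul_eq_mul, sub_eq_zero] at this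
    simp only [_root_.smul_apply, smul_eq_mul, hc, this]
    ring
  refine ⟨c, lt_of_le_of_ne (div_nonneg_of_nonpos (key v₀ hv₀) hv₀.le) fun h => hne₁ ?_, heq⟩
  rw [heq, ← h, zero_smul]

lemma pd_eq_of_fderiv_eq_smul {f g : E4 → ℝ} {x : E4} {c : ℝ}
    (h : fderiv ℝ f x = c • fderiv ℝ g x) (i : Fin 4) : pd i f x = c * pd i g x := by
  simp [pd, h]

/-- The outer normal may be computed with any defining function. -/
lemma outerNormal_eq (G : CoordMetric) {D : Set E4} {x : E4} {ρ : E4 → ℝ}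
    (hρ : IsDefiningFunctionAt D x ρ) :
    outerNormal G D x = (gradNorm G ρ x)⁻¹ • grad G ρ x := by
  have hex : ∃ ρ, IsDefiningFunctionAt D x ρ := ⟨ρ, hρ⟩
  obtain ⟨c, hc, h⟩ := hex.choose_spec.fderiv_eq_smul hρ
  rw [outerNormal, dif_pos hex]
  have hg : grad G hex.choose x = c • grad G ρ x := by
    ext i
    simp only [grad, pd_eq_of_fderiv_eq_smul h, PiLp.smul_apply, smul_eq_mul, Finset.mul_sum]
    exact Finset.sum_congr rfl fun j _ => by ring
  have hn : gradNorm G hex.choose x = c * gradNorm G ρ x := by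
    have : ginner G x (c • grad G ρ x) (c • grad G ρ x)
        = c ^ 2 * ginner G x (grad G ρ x) (grad G ρ x) := by
      simp only [ginner, PiLp.smul_apply, smul_eq_mul, Finset.mul_sum]
      exact Finset.sum_congr rfl fun j _ => Finset.sum_congr rfl fun k _ => by ring
    rw [gradNorm, hg, this, Real.sqrt_mul (sq_nonneg c), Real.sqrt_sq hc.le, gradNorm]
  rw [hn, hg, smul_smul, mul_inv, mul_comm c⁻¹, mul_assoc, inv_mul_cancel₀ hc.ne', mul_one]

/-! ### The area element of a graph -/

/-- If the covector `N` annihilates the vectors `v_α = e_{i.succAbove α} - N_{i.succAbove α} eᵢ`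
(so `N i = 1`), the Gram determinant of the `v_α` is `det M` times the squared norm of `N`. -/
lemma det_gram_graph {M : Matrix (Fin 4) (Fin 4) ℝ} (hM : M.PosDef) (i : Fin 4) (N : Fin 4 → ℝ)
    (hN : N i = 1) (v : Fin 3 → Fin 4 → ℝ)
    (hv : ∀ α, v α = Pi.single (i.succAbove α) 1 - N (i.succAbove α) • Pi.single i 1) :
    0 < ∑ j, ∑ k, M⁻¹ j k * N j * N k ∧
    (Matrix.of fun α β => ∑ j, ∑ k, M j k * v α j * v β k).det
      = M.det * ∑ j, ∑ k, M⁻¹ j k * N j * N k := by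
  open Matrix in
  have hunit : IsUnit M.det := hM.det_pos.ne'.isUnit
  have hN0 : N ≠ 0 := fun h => by simp [h] at hN
  set q := ∑ j, ∑ k, M⁻¹ j k * N j * N k with hq
  have hq' : q = N ⬝ᵥ M⁻¹ *ᵥ N := by
    simp only [hq, dotProduct, mulVec, Finset.mul_sum]
    exact Finset.sum_congr rfl fun j _ => Finset.sum_congr rfl fun k _ => by ring
  have hqpos : 0 < q := by
    rw [hq']
    simpa using hM.inv.dotProduct_mulVec_pos hN0
  refine ⟨hqpos, ?_⟩
  set w := M⁻¹ *ᵥ N with hw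
  -- the matrix with the columns `v_α` and, as column `i`, the gradient `w = M⁻¹ N`
  let B : Matrix (Fin 4) (Fin 4) ℝ :=
    Matrix.of fun j k => i.insertNth (α := fun _ => ℝ) (w j) (fun α => v α j) k
  have hBi : ∀ j, B j i = w j := fun j => by simp [B]
  have hBα : ∀ j α, B j (i.succAbove α) = v α j := fun j α => by simp [B]
  have hNv : ∀ α, N ⬝ᵥ v α = 0 := by
    intro α
    simp [hv, dotProduct_sub, hN]
  have hMw : M *ᵥ w = N := by
    rw [hw, mulVec_mulVec, mul_nonsing_inv _ hunit, one_mulVec]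
  have hsub : ∀ α β, v β (i.succAbove α) = (1 : Matrix (Fin 3) (Fin 3) ℝ) α β := by
    intro α β
    simp [hv, Fin.succAbove_ne, Pi.single_apply, Matrix.one_apply]
  -- replacing row `i` of `B` by the combination `N B` of rows does not change the determinant
  let P : Matrix (Fin 4) (Fin 4) ℝ := (1 : Matrix (Fin 4) (Fin 4) ℝ).updateRow i N
  have hP : P.det = 1 := by
    rw [det_succ_column P i, Finset.sum_eq_single i]
    · have : P.submatrix i.succAbove i.succAbove = 1 := by
        ext α β
        simp [P, updateRow_apply, Fin.succAbove_ne, Matrix.one_apply]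
      rw [this]
      simp [P, hN, ← two_mul, pow_mul]
    · intro j _ hj
      simp [P, updateRow_apply, hj]
    · simp
  have hPBi : ∀ k, (P * B) i k = if k = i then q else 0 := by
    intro k
    have : (P * B) i k = N ⬝ᵥ fun j => B j k := by
      simp [P, Matrix.mul_apply, dotProduct]
    rw [this]
    refine i.succAboveCases ?_ (fun α => ?_) k
    · simp [hBi, hq', hw]
    · simp only [hBα, Fin.succAbove_ne, if_false]
      exact hNv α
  have hB : B.det = q := by
    have h1 : (P * B).det = q := by
      rw [det_succ_row _ i, Finset.sum_eq_single i]
      · have : (P * B).submatrix i.succAbove i.succAbove = 1 := by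
          ext α β
          rw [submatrix_apply, Matrix.mul_apply, Finset.sum_eq_single (i.succAbove α)]
          · simp [P, updateRow_apply, Fin.succAbove_ne, hBα, hsub]
          · intro j _ hj
            simp [P, updateRow_apply, Fin.succAbove_ne, hj.symm]
          · simp
        rw [this, hPBi]
        simp [← two_mul, pow_mul]
      · intro j _ hj
        simp [hPBi, hj]
      · simp
    rwa [det_mul, hP, one_mul] at h1
  have hsymm : Mᵀ = M := (by simpa using hM.isHermitian : M.IsSymm)
  have hC : ∀ j k, (Bᵀ * M * B) j k = (fun l => B l j) ⬝ᵥ M *ᵥ (fun l => B l k) := by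
    intro j k
    simp only [Matrix.mul_apply, dotProduct, mulVec, Finset.sum_mul, Finset.mul_sum,
      transpose_apply]
    rw [Finset.sum_comm]
    exact Finset.sum_congr rfl fun _ _ => Finset.sum_congr rfl fun _ _ => by ring
  have hcol : ∀ α, (fun l => B l (i.succAbove α)) = v α := fun α => funext fun l => hBα l α
  have hcoli : (fun l => B l i) = w := funext hBi
  have hCi : ∀ k, (Bᵀ * M * B) i k = if k = i then q else 0 := by
    intro k
    rw [hC, hcoli, dotProduct_mulVec, ← mulVec_transpose, hsymm, hMw]
    refine i.succAboveCases ?_ (fun α => ?_) k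
    · simp [hcoli, hq', hw]
    · simp only [hcol, Fin.succAbove_ne, if_false]
      exact hNv α
  have hdet : (Bᵀ * M * B).det
      = q * (Matrix.of fun α β => ∑ j, ∑ k, M j k * v α j * v β k).det := by
    rw [det_succ_row _ i, Finset.sum_eq_single i]
    · rw [hCi]
      have : (Bᵀ * M * B).submatrix i.succAbove i.succAbove
          = Matrix.of fun α β => ∑ j, ∑ k, M j k * v α j * v β k := by
        ext α β
        rw [submatrix_apply, hC, hcol, hcol]
        simp only [dotProduct, mulVec, Finset.mul_sum, of_apply]
        exact Finset.sum_congr rfl fun _ _ => Finset.sum_congr rfl fun _ _ => by ring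
      rw [this]
      simp [← two_mul, pow_mul]
    · intro j _ hj
      simp [hCi, hj]
    · simp
  rw [det_mul, det_mul, det_transpose, hB] at hdet
  have : q * (M.det * q) = q * (Matrix.of fun α β => ∑ j, ∑ k, M j k * v α j * v β k).det := by
    rw [← hdet]; ring
  exact (mul_left_cancel₀ hqpos.ne' this).symm

/-! ### Patches of the boundary and the surface measure -/

lemma IsBoundaryPatch.aemeasurable {D : Set E4} {U : Set E3} {ψ : E3 → E4}
    (h : IsBoundaryPatch D U ψ) : AEMeasurable ψ (volume.restrict U) :=
  h.contDiffOn.continuousOn.aemeasurable h.isOpen.measurableSet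

lemma IsBoundaryPatch.measurableSet_inter_preimage {D : Set E4} {U : Set E3} {ψ : E3 → E4}
    (h : IsBoundaryPatch D U ψ) {S : Set E4} (hS : MeasurableSet S) :
    MeasurableSet (U ∩ ψ ⁻¹' S) := by
  classical
  have hm : Measurable (U.piecewise ψ fun _ => 0) :=
    h.contDiffOn.continuousOn.measurable_piecewise continuousOn_const h.isOpen.measurableSet
  have : U ∩ ψ ⁻¹' S = U ∩ (U.piecewise ψ fun _ => 0) ⁻¹' S := by
    ext y
    simp only [mem_inter_iff, mem_preimage]
    exact and_congr_right fun hy => by rw [piecewise_eq_of_mem _ _ _ hy]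
  rw [this]
  exact h.isOpen.measurableSet.inter (hm hS)

lemma IsBoundaryPatch.patchMeasure_apply {D : Set E4} {U : Set E3} {ψ : E3 → E4}
    (h : IsBoundaryPatch D U ψ) (G : CoordMetric) {S : Set E4} (hS : MeasurableSet S) :
    patchMeasure G U ψ S
      = ∫⁻ y in U ∩ ψ ⁻¹' S, ENNReal.ofReal (Real.sqrt (inducedMetric G ψ y).det) := by
  rw [patchMeasure, Measure.map_apply_of_aemeasurable
    (h.aemeasurable.mono_ac (withDensity_absolutelyContinuous _ _)) hS, withDensity_apply']
  rw [Measure.restrict_restrict₀' h.isOpen.measurableSet.nullMeasurableSet, inter_comm]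

lemma IsBoundaryPatch.patchMeasure_restrict_frontier {D : Set E4} {U : Set E3} {ψ : E3 → E4}
    (h : IsBoundaryPatch D U ψ) (G : CoordMetric) :
    (patchMeasure G U ψ).restrict (frontier D) = patchMeasure G U ψ := by
  ext S hS
  have hm := hS.inter (isClosed_frontier (s := D)).measurableSet
  rw [Measure.restrict_apply hS, h.patchMeasure_apply G hm, h.patchMeasure_apply G hS]
  congr 2
  ext y
  simp only [mem_inter_iff, mem_preimage]
  exact ⟨fun a => ⟨a.1, a.2.1⟩, fun a => ⟨a.1, a.2, h.mapsTo a.1⟩⟩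

/-- The surface measure is carried by the boundary. -/
lemma surfaceMeasure_restrict_frontier (G : CoordMetric) (D : Set E4) :
    (surfaceMeasure G D).restrict (frontier D) = surfaceMeasure G D := by
  refine le_antisymm Measure.restrict_le_self (sSup_le ?_)
  rintro m ⟨U, ψ, h, rfl⟩
  rw [← h.patchMeasure_restrict_frontier G]
  exact Measure.restrict_mono le_rfl (le_sSup ⟨U, ψ, h, rfl⟩)

lemma ae_surfaceMeasure_mem_frontier (G : CoordMetric) (D : Set E4) :
    ∀ᵐ x ∂surfaceMeasure G D, x ∈ frontier D := by
  rw [← surfaceMeasure_restrict_frontier G D]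
  exact ae_restrict_mem isClosed_frontier.measurableSet

/-- The parametrization of a graph. -/
def graphMap (i : Fin 4) (h : E3 → ℝ) (y : E3) : E4 := slice i (h y, y)

/-- The parameters of the part of a graph that lies in `W`. -/
def graphDomain (W : Set E4) (i : Fin 4) (h : E3 → ℝ) : Set E3 := graphMap i h ⁻¹' W

lemma contDiff_graphMap (i : Fin 4) {h : E3 → ℝ} (hh : ContDiff ℝ 1 h) :
    ContDiff ℝ 1 (graphMap i h) :=
  (slice i).contDiff.comp (by fun_prop)

@[simp] lemma del_graphMap (i : Fin 4) (h : E3 → ℝ) (y : E3) : del i (graphMap i h y) = y := by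
  simp [graphMap]

lemma fderiv_graphMap (i : Fin 4) {h : E3 → ℝ} (hh : ContDiff ℝ 1 h) (y v : E3) :
    fderiv ℝ (graphMap i h) y v = slice i (fderiv ℝ h y v, v) := by
  have h1 : HasFDerivAt (fun y => (h y, y)) ((fderiv ℝ h y).prod (.id ℝ E3)) y :=
    (hh.differentiable one_ne_zero y).hasFDerivAt.prodMk (hasFDerivAt_id y)
  have := ((slice i).hasFDerivAt.comp y h1).fderiv
  simp only [Function.comp_def] at this
  unfold graphMap
  rw [this]
  simp

namespace IsLocalGraph

variable {D W : Set E4} {i : Fin 4} {s : ℝ} {h : E3 → ℝ}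

lemma frontier_inter (H : IsLocalGraph D W i s h) (hD : IsOpen D) {x : E4} (hx : x ∈ W) :
    x ∈ frontier D ↔ x i = h (del i x) := by
  have hc : Continuous fun x : E4 => s * (x i - h (del i x)) := by
    have := H.contDiff.continuous
    fun_prop
  have hs0 : s ≠ 0 := by rcases H.sign with rfl | rfl <;> norm_num
  rw [hD.frontier_eq, Set.mem_sdiff, H.mem_iff x hx, not_lt]
  constructor
  · rintro ⟨h1, h2⟩
    have h3 : s * (x i - h (del i x)) ≤ 0 := by
      have hcl : x ∈ closure (W ∩ D) := H.isOpen.inter_closure ⟨hx, h1⟩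
      have : W ∩ D ⊆ {x | s * (x i - h (del i x)) ≤ 0} := fun z hz =>
        ((H.mem_iff z hz.1).1 hz.2).le
      exact closure_minimal this (isClosed_le hc continuous_const) hcl
    have := le_antisymm h3 h2
    rcases mul_eq_zero.1 this with h | h
    · exact absurd h hs0
    · linarith
  · intro hxi
    refine ⟨?_, by rw [hxi]; simp⟩
    have hl : Tendsto (fun t : ℝ => x + (-s * t) • ev i) (𝓝[>] 0) (𝓝 x) := by
      have : Tendsto (fun t : ℝ => x + (-s * t) • ev i) (𝓝 0) (𝓝 (x + (-s * 0) • ev i)) :=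
        Continuous.tendsto (by fun_prop) 0
      simpa using this.mono_left nhdsWithin_le_nhds
    refine mem_closure_of_tendsto hl ?_
    filter_upwards [hl.eventually (H.isOpen.mem_nhds hx), self_mem_nhdsWithin] with t ht ht0
    rw [H.mem_iff _ ht]
    have : 0 < t := ht0
    have hss : s * s = 1 := by rcases H.sign with rfl | rfl <;> norm_num
    have e : s * ((x + (-s * t) • ev i) i - h (del i (x + (-s * t) • ev i))) = -(s * s * t) := by
      simp [hxi]; ring
    rw [e, hss]
    linarith

lemma graphMap_mem_frontier (H : IsLocalGraph D W i s h) (hD : IsOpen D) {y : E3}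
    (hy : y ∈ graphDomain W i h) : graphMap i h y ∈ frontier D := by
  rw [H.frontier_inter hD hy]
  simp [graphMap]

lemma graphMap_del (H : IsLocalGraph D W i s h) (hD : IsOpen D) {x : E4} (hx : x ∈ W)
    (hxf : x ∈ frontier D) : graphMap i h (del i x) = x := by
  rw [graphMap, ← (H.frontier_inter hD hx).1 hxf, slice_del]

lemma isBoundaryPatch (H : IsLocalGraph D W i s h) (hD : IsOpen D) :
    IsBoundaryPatch D (graphDomain W i h) (graphMap i h) where
  isOpen := H.isOpen.preimage (contDiff_graphMap i H.contDiff).continuous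
  contDiffOn := (contDiff_graphMap i H.contDiff).contDiffOn
  injOn := fun y _ z _ hyz => by simpa using congrArg (del i) hyz
  mapsTo := fun y hy => H.graphMap_mem_frontier hD hy
  immersion := fun y _ v w hvw => by
    rw [fderiv_graphMap i H.contDiff, fderiv_graphMap i H.contDiff] at hvw
    simpa using congrArg (del i) hvw

/-- On the part of the boundary that is a graph, the area measure of any patch is at most that of
the graph parametrization, by the change of variables formula. -/
lemma patchMeasure_restrict_le (H : IsLocalGraph D W i s h) (hD : IsOpen D) (G : CoordMetric)
    {U : Set E3} {ψ : E3 → E4} (hψ : IsBoundaryPatch D U ψ) :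
    (patchMeasure G U ψ).restrict W ≤ patchMeasure G (graphDomain W i h) (graphMap i h) := by
  rw [Measure.le_iff]
  intro S hS
  have hSW := hS.inter H.isOpen.measurableSet
  rw [Measure.restrict_apply hS, hψ.patchMeasure_apply G hSW,
    (H.isBoundaryPatch hD).patchMeasure_apply G hS]
  set E := U ∩ ψ ⁻¹' (S ∩ W) with hE
  have hEm : MeasurableSet E := hψ.measurableSet_inter_preimage hSW
  set θ : E3 → E3 := fun y => del i (ψ y) with hθ
  have hEW : ∀ y ∈ E, ψ y ∈ W := fun y hy => hy.2.2
  have hψθ : ∀ y ∈ U, ψ y ∈ W → graphMap i h (θ y) = ψ y := fun y hy hyW =>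
    H.graphMap_del hD hyW (hψ.mapsTo hy)
  have hψd : ∀ y ∈ U, HasFDerivAt ψ (fderiv ℝ ψ y) y := fun y hy =>
    ((hψ.contDiffOn.contDiffAt (hψ.isOpen.mem_nhds hy)).differentiableAt one_ne_zero).hasFDerivAt
  have hθd : ∀ y ∈ U, HasFDerivAt θ ((del i).comp (fderiv ℝ ψ y)) y := fun y hy =>
    (del i).hasFDerivAt.comp y (hψd y hy)
  have hθinj : InjOn θ E := fun y hy z hz hyz => by
    refine hψ.injOn hy.1 hz.1 ?_
    rw [← hψθ y hy.1 (hEW y hy), ← hψθ z hz.1 (hEW z hz), hyz]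
  have hdet : ∀ y ∈ E, (inducedMetric G ψ y).det
      = ((del i).comp (fderiv ℝ ψ y)).det ^ 2 * (inducedMetric G (graphMap i h) (θ y)).det := by
    intro y hy
    set L := (del i).comp (fderiv ℝ ψ y) with hL
    have hev : ψ =ᶠ[𝓝 y] fun z => graphMap i h (θ z) := by
      have hcont : ContinuousAt ψ y := (hψd y hy.1).continuousAt
      filter_upwards [hψ.isOpen.mem_nhds hy.1, hcont.eventually (H.isOpen.mem_nhds (hEW y hy))]
        with z hz hzW
      exact (hψθ z hz hzW).symm
    have hchain : fderiv ℝ ψ y = (fderiv ℝ (graphMap i h) (θ y)).comp L := by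
      rw [hev.fderiv_eq]
      exact (((contDiff_graphMap i H.contDiff).differentiable one_ne_zero (θ y)).hasFDerivAt.comp y
        (hθd y hy.1)).fderiv
    let b := (EuclideanSpace.basisFun (Fin 3) ℝ).toBasis
    set J := LinearMap.toMatrix b b (L : E3 →ₗ[ℝ] E3) with hJ
    have hJdet : J.det = L.det := LinearMap.det_toMatrix b _
    have hLα : ∀ α, L (EuclideanSpace.single α 1)
        = ∑ β, J β α • EuclideanSpace.single β (1 : ℝ) := by
      intro α
      ext γ
      simp [hJ, LinearMap.toMatrix_apply, b, Pi.single_apply]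
    have hψα : ∀ α j, fderiv ℝ ψ y (EuclideanSpace.single α 1) j
        = ∑ β, J β α * fderiv ℝ (graphMap i h) (θ y) (EuclideanSpace.single β 1) j := by
      intro α j
      rw [hchain, ContinuousLinearMap.comp_apply, hLα, map_sum]
      simp
    have hmat : inducedMetric G ψ y
        = Matrix.transpose J * inducedMetric G (graphMap i h) (θ y) * J := by
      ext α β
      simp only [inducedMetric, Matrix.of_apply, Matrix.mul_apply, Matrix.transpose_apply, ginner,
        hψα, hψθ y hy.1 (hEW y hy), Finset.mul_sum, Finset.sum_mul]
      simp only [Fin.sum_univ_three, Finset.sum_add_distrib]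
      rw [← sub_eq_zero]
      simp only [← Finset.sum_sub_distrib, ← Finset.sum_add_distrib]
      exact Finset.sum_eq_zero fun j _ => Finset.sum_eq_zero fun k _ => by ring
    rw [hmat, Matrix.det_mul, Matrix.det_mul, Matrix.det_transpose, hJdet]
    ring
  calc ∫⁻ y in E, ENNReal.ofReal (Real.sqrt (inducedMetric G ψ y).det)
      = ∫⁻ y in E, ENNReal.ofReal |((del i).comp (fderiv ℝ ψ y)).det|
          * ENNReal.ofReal (Real.sqrt (inducedMetric G (graphMap i h) (θ y)).det) := by
        refine setLIntegral_congr_fun hEm fun y hy => ?_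
        simp only
        rw [hdet y hy, Real.sqrt_mul (sq_nonneg _), Real.sqrt_sq_eq_abs,
          ENNReal.ofReal_mul (abs_nonneg _)]
    _ = ∫⁻ z in θ '' E, ENNReal.ofReal (Real.sqrt (inducedMetric G (graphMap i h) z).det) :=
        (lintegral_image_eq_lintegral_abs_det_fderiv_mul volume hEm
          (fun y hy => (hθd y hy.1).hasFDerivWithinAt) hθinj
          fun z => ENNReal.ofReal (Real.sqrt (inducedMetric G (graphMap i h) z).det)).symm
    _ ≤ _ := by
        refine lintegral_mono_set ?_
        rintro _ ⟨y, hy, rfl⟩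
        have := hψθ y hy.1 (hEW y hy)
        refine ⟨?_, ?_⟩
        · rw [graphDomain, mem_preimage, this]; exact hEW y hy
        · rw [mem_preimage, this]; exact hy.2.1

/-- On the part of the boundary that is a graph, the surface measure is the area measure of the
graph parametrization. -/
lemma surfaceMeasure_restrict (H : IsLocalGraph D W i s h) (hD : IsOpen D) (G : CoordMetric) :
    (surfaceMeasure G D).restrict W = patchMeasure G (graphDomain W i h) (graphMap i h) := by
  set m₀ := patchMeasure G (graphDomain W i h) (graphMap i h) with hm₀
  have hpatch := H.isBoundaryPatch hD
  have hW := H.isOpen.measurableSet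
  have hm₀W : m₀.restrict W = m₀ := by
    ext S hS
    rw [Measure.restrict_apply hS, hpatch.patchMeasure_apply G (hS.inter hW),
      hpatch.patchMeasure_apply G hS]
    congr 2
    ext y
    simp only [mem_inter_iff, mem_preimage]
    exact ⟨fun a => ⟨a.1, a.2.1⟩, fun a => ⟨a.1, a.2, a.1⟩⟩
  refine le_antisymm ?_ ?_
  -- `m₀` plus the part of the surface measure outside `W` dominates every patch
  · have hle : surfaceMeasure G D ≤ m₀ + (surfaceMeasure G D).restrict Wᶜ := by
      refine sSup_le ?_
      rintro m ⟨U, ψ, hψ, rfl⟩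
      rw [← Measure.restrict_add_restrict_compl (μ := patchMeasure G U ψ) hW]
      exact add_le_add (H.patchMeasure_restrict_le hD G hψ)
        (Measure.restrict_mono le_rfl (le_sSup ⟨U, ψ, hψ, rfl⟩))
    calc (surfaceMeasure G D).restrict W
        ≤ (m₀ + (surfaceMeasure G D).restrict Wᶜ).restrict W := Measure.restrict_mono le_rfl hle
      _ = m₀ := by
        rw [Measure.restrict_add, hm₀W, Measure.restrict_restrict hW]
        simp
  · rw [← hm₀W]
    exact Measure.restrict_mono le_rfl (le_sSup ⟨_, _, hpatch, rfl⟩)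

end IsLocalGraph

/-! ### Gradients and inner products -/

lemma fderiv_eq_sum_pd (u : E4 → ℝ) (x v : E4) : fderiv ℝ u x v = ∑ j, pd j u x * v j := by
  have hv : v = ∑ j, v j • ev j := by
    ext k
    simp [Pi.single_apply]
  conv_lhs => rw [hv]
  simp only [map_sum, map_smul, smul_eq_mul, pd]
  exact Finset.sum_congr rfl fun j _ => mul_comm _ _

lemma inv_apply_comm {M : Matrix (Fin 4) (Fin 4) ℝ} (hM : M.PosDef) (i j : Fin 4) :
    M⁻¹ i j = M⁻¹ j i := by
  have : M⁻¹.IsSymm := by simpa using hM.inv.isHermitian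
  exact this.apply j i

lemma apply_comm {M : Matrix (Fin 4) (Fin 4) ℝ} (hM : M.PosDef) (i j : Fin 4) :
    M i j = M j i := by
  have : M.IsSymm := by simpa using hM.isHermitian
  exact this.apply j i

lemma sum_mul_inv {M : Matrix (Fin 4) (Fin 4) ℝ} (hM : M.PosDef) (i k : Fin 4) :
    ∑ j, M i j * M⁻¹ j k = if i = k then 1 else 0 := by
  rw [← Matrix.mul_apply, Matrix.mul_nonsing_inv _ hM.det_pos.ne'.isUnit, Matrix.one_apply]

lemma ginner_grad_right {G : CoordMetric} {x : E4} (hG : (G x).PosDef) (u : E4 → ℝ) (v : E4) :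
    ginner G x v (grad G u x) = fderiv ℝ u x v := by
  have h1 : ∀ i, ∑ j, G x i j * grad G u x j = pd i u x := by
    intro i
    simp only [grad, Finset.mul_sum, ← mul_assoc]
    rw [Finset.sum_comm]
    simp [← Finset.sum_mul, sum_mul_inv hG]
  rw [fderiv_eq_sum_pd, ginner]
  refine Finset.sum_congr rfl fun i _ => ?_
  rw [← h1 i, Finset.sum_mul]
  exact Finset.sum_congr rfl fun j _ => by ring

lemma ginner_comm {G : CoordMetric} {x : E4} (hG : (G x).PosDef) (v w : E4) :
    ginner G x v w = ginner G x w v := by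
  rw [ginner, Finset.sum_comm]
  exact Finset.sum_congr rfl fun i _ => Finset.sum_congr rfl fun j _ => by
    rw [apply_comm hG j i]; ring

lemma ginner_smul_right (G : CoordMetric) (x v w : E4) (c : ℝ) :
    ginner G x v (c • w) = c * ginner G x v w := by
  simp only [ginner, PiLp.smul_apply, smul_eq_mul, Finset.mul_sum]
  exact Finset.sum_congr rfl fun i _ => Finset.sum_congr rfl fun j _ => by ring

lemma ginner_smul_left (G : CoordMetric) (x v w : E4) (c : ℝ) :
    ginner G x (c • v) w = c * ginner G x v w := by
  simp only [ginner, PiLp.smul_apply, smul_eq_mul, Finset.mul_sum]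
  exact Finset.sum_congr rfl fun i _ => Finset.sum_congr rfl fun j _ => by ring

lemma ginner_add_left (G : CoordMetric) (x v v' w : E4) :
    ginner G x (v + v') w = ginner G x v w + ginner G x v' w := by
  simp only [ginner, PiLp.add_apply, ← Finset.sum_add_distrib]
  exact Finset.sum_congr rfl fun i _ => Finset.sum_congr rfl fun j _ => by ring

lemma ginner_sub_left (G : CoordMetric) (x v v' w : E4) :
    ginner G x (v - v') w = ginner G x v w - ginner G x v' w := by
  simp only [ginner, PiLp.sub_apply, ← Finset.sum_sub_distrib]
  exact Finset.sum_congr rfl fun i _ => Finset.sum_congr rfl fun j _ => by ring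

lemma ginner_sum_left {ι : Type*} (G : CoordMetric) (x w : E4) (t : Finset ι) (v : ι → E4) :
    ginner G x (∑ k ∈ t, v k) w = ∑ k ∈ t, ginner G x (v k) w := by
  classical
  induction t using Finset.induction_on with
  | empty => simp [ginner]
  | insert k t hk ih => rw [Finset.sum_insert hk, Finset.sum_insert hk, ginner_add_left, ih]

lemma ginner_grad_self {G : CoordMetric} {x : E4} (hG : (G x).PosDef) (u : E4 → ℝ) :
    ginner G x (grad G u x) (grad G u x) = ∑ i, ∑ j, (G x)⁻¹ i j * pd i u x * pd j u x := by
  rw [ginner_grad_right hG, fderiv_eq_sum_pd]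
  refine Finset.sum_congr rfl fun i _ => ?_
  simp only [grad, Finset.mul_sum]
  exact Finset.sum_congr rfl fun j _ => by ring

lemma sum_sum_eq_dotProduct (M : Matrix (Fin 4) (Fin 4) ℝ) (ξ : Fin 4 → ℝ) :
    ∑ i, ∑ j, M i j * ξ i * ξ j = dotProduct ξ (Matrix.mulVec M ξ) := by
  simp only [dotProduct, Matrix.mulVec, Finset.mul_sum]
  exact Finset.sum_congr rfl fun i _ => Finset.sum_congr rfl fun j _ => by ring

lemma sum_inv_nonneg {M : Matrix (Fin 4) (Fin 4) ℝ} (hM : M.PosDef) (ξ : Fin 4 → ℝ) :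
    0 ≤ ∑ i, ∑ j, M⁻¹ i j * ξ i * ξ j := by
  rw [sum_sum_eq_dotProduct]
  simpa using hM.inv.posSemidef.dotProduct_mulVec_nonneg ξ

lemma gradNorm_sq {G : CoordMetric} {x : E4} (hG : (G x).PosDef) (u : E4 → ℝ) :
    gradNorm G u x ^ 2 = ∑ i, ∑ j, (G x)⁻¹ i j * pd i u x * pd j u x := by
  rw [gradNorm, ginner_grad_self hG, Real.sq_sqrt (sum_inv_nonneg hG _)]

/-! ### Continuity of the inverse metric -/

lemma ContinuousOn.matrix_inv_apply {G : CoordMetric} {W : Set E4} (hG : ContinuousOn G W)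
    (hpos : ∀ x ∈ W, (G x).PosDef) (i j : Fin 4) : ContinuousOn (fun x => (G x)⁻¹ i j) W := by
  have hdet : ContinuousOn (fun x => (G x).det) W :=
    (Continuous.matrix_det continuous_id).comp_continuousOn hG
  have hadj : ContinuousOn (fun x => (G x).adjugate i j) W :=
    ((Continuous.matrix_adjugate continuous_id).matrix_elem i j).comp_continuousOn hG
  refine ((hdet.inv₀ fun x hx => (hpos x hx).det_pos.ne').mul hadj).congr fun x _ => ?_
  simp [Matrix.inv_def, Ring.inverse_eq_inv']

/-! ### The flux through a graph -/

namespace IsLocalGraph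

variable {D W : Set E4} {i : Fin 4} {s : ℝ} {h : E3 → ℝ}

/-- The defining function `s (xᵢ - h(x̂))` of the domain on one side of a graph. -/
def defFun (i : Fin 4) (s : ℝ) (h : E3 → ℝ) (x : E4) : ℝ := s * (x i - h (del i x))

lemma contDiff_defFun (i : Fin 4) (s : ℝ) {h : E3 → ℝ} (hh : ContDiff ℝ 1 h) :
    ContDiff ℝ 1 (defFun i s h) := by
  unfold defFun
  fun_prop

lemma fderiv_defFun (i : Fin 4) (s : ℝ) {h : E3 → ℝ} (hh : ContDiff ℝ 1 h) (x v : E4) :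
    fderiv ℝ (defFun i s h) x v = s * (v i - fderiv ℝ h (del i x) (del i v)) := by
  have h1 : HasFDerivAt (fun x => h (del i x)) ((fderiv ℝ h (del i x)).comp (del i)) x :=
    (hh.differentiable one_ne_zero _).hasFDerivAt.comp x (del i).hasFDerivAt
  have h2 : HasFDerivAt (fun x : E4 => x i) (EuclideanSpace.proj i : E4 →L[ℝ] ℝ) x :=
    (EuclideanSpace.proj i : E4 →L[ℝ] ℝ).hasFDerivAt
  have := ((h2.sub h1).const_mul s).fderiv
  unfold defFun
  rw [show (fun x : E4 => s * (x i - h (del i x)))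
    = fun y => s * ((fun x : E4 => x i) - fun x => h (del i x)) y from rfl, this]
  simp

lemma isDefiningFunctionAt (H : IsLocalGraph D W i s h) (hD : IsOpen D) {x : E4} (hx : x ∈ W)
    (hxf : x ∈ frontier D) : IsDefiningFunctionAt D x (defFun i s h) := by
  refine ⟨(contDiff_defFun i s H.contDiff).contDiffAt, ?_, fun h0 => ?_, ?_⟩
  · simp [defFun, (H.frontier_inter hD hx).1 hxf]
  · have := fderiv_defFun i s H.contDiff x (ev i)
    rw [h0, del_ev_same] at this
    rcases H.sign with rfl | rfl <;> simp at this
  · filter_upwards [H.isOpen.mem_nhds hx] with y hy using H.mem_iff y hy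

lemma pd_defFun_same (i : Fin 4) (s : ℝ) {h : E3 → ℝ} (hh : ContDiff ℝ 1 h) (x : E4) :
    pd i (defFun i s h) x = s := by
  have := fderiv_defFun i s hh x (ev i)
  rw [del_ev_same] at this
  rw [pd, this]
  simp

lemma pd_defFun_succAbove (i : Fin 4) (s : ℝ) {h : E3 → ℝ} (hh : ContDiff ℝ 1 h) (x : E4)
    (α : Fin 3) : pd (i.succAbove α) (defFun i s h) x
      = - (s * fderiv ℝ h (del i x) (EuclideanSpace.single α 1)) := by
  have := fderiv_defFun i s hh x (ev (i.succAbove α))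
  have hdel : del i (ev (i.succAbove α)) = EuclideanSpace.single α 1 := by ext β; simp
  rw [hdel] at this
  rw [pd, this]
  simp [Fin.ne_succAbove]

/-- The area element of a graph is `√(det g)` times the norm of the differential of its defining
function. -/
lemma sqrt_det_inducedMetric (H : IsLocalGraph D W i s h) {G : CoordMetric} {y : E3}
    (hG : (G (graphMap i h y)).PosDef) :
    0 < gradNorm G (defFun i s h) (graphMap i h y) ∧
    Real.sqrt (inducedMetric G (graphMap i h) y).det
      = Real.sqrt (G (graphMap i h y)).det * gradNorm G (defFun i s h) (graphMap i h y) := by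
  set x := graphMap i h y with hx
  have hss : s * s = 1 := by rcases H.sign with rfl | rfl <;> norm_num
  set N : Fin 4 → ℝ := fun j => s * pd j (defFun i s h) x with hN
  have hNi : N i = 1 := by simp only [hN, pd_defFun_same i s H.contDiff, hss]
  have hNα : ∀ α, N (i.succAbove α) = - fderiv ℝ h y (EuclideanSpace.single α 1) := by
    intro α
    simp only [hN, pd_defFun_succAbove i s H.contDiff, hx, del_graphMap]
    linear_combination (- fderiv ℝ h y (EuclideanSpace.single α 1)) * hss
  obtain ⟨h1, h2⟩ := det_gram_graph hG i N hNi
    (fun α j => fderiv ℝ (graphMap i h) y (EuclideanSpace.single α 1) j) (by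
      intro α
      ext j
      rw [fderiv_graphMap i H.contDiff]
      refine i.succAboveCases ?_ (fun β => ?_) j
      · simp [hNα, Fin.ne_succAbove]
      · simp [hNα, Pi.single_apply, Fin.succAbove_ne])
  have hq : ∑ j, ∑ k, (G x)⁻¹ j k * N j * N k = gradNorm G (defFun i s h) x ^ 2 := by
    rw [gradNorm_sq hG]
    refine Finset.sum_congr rfl fun j _ => Finset.sum_congr rfl fun k _ => ?_
    simp only [hN]
    linear_combination ((G x)⁻¹ j k * pd j (defFun i s h) x * pd k (defFun i s h) x) * hss
  rw [hq] at h1 h2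
  have hn : 0 ≤ gradNorm G (defFun i s h) x := Real.sqrt_nonneg _
  refine ⟨lt_of_le_of_ne hn fun h0 => by rw [← h0] at h1; simp at h1, ?_⟩
  have : inducedMetric G (graphMap i h) y = Matrix.of fun α β => ∑ j, ∑ k, G x j k
      * (fderiv ℝ (graphMap i h) y (EuclideanSpace.single α 1) j)
      * (fderiv ℝ (graphMap i h) y (EuclideanSpace.single β 1) k) := rfl
  rw [this, h2, Real.sqrt_mul hG.det_pos.le, Real.sqrt_sq hn]

/-- The divergence theorem for fields supported in the domain of a local graph. -/
lemma flux (H : IsLocalGraph D W i s h) (hD : IsOpen D) {G : CoordMetric}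
    (hG : ∀ x ∈ W, (G x).PosDef) (hGc : ContinuousOn G W) {X Y : E4 → E4}
    (hY : ContDiff ℝ 1 Y) (hYc : HasCompactSupport Y) (hYW : tsupport Y ⊆ W)
    (hYX : ∀ x, Y x = Real.sqrt (G x).det • X x) (hX : ∀ x ∉ W, X x = 0) :
    Integrable (fun x => ginner G x (X x) (outerNormal G D x)) (surfaceMeasure G D) ∧
    ∫ x in D, ∑ j, pd j (fun y => Y y j) x
      = bdryInt G D (fun x => ginner G x (X x) (outerNormal G D x)) := by
  have hWm := H.isOpen.measurableSet
  have hss : s * s = 1 := by rcases H.sign with rfl | rfl <;> norm_num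
  set σ := surfaceMeasure G D with hσ
  set ρ := defFun i s h with hρ
  have hρC : ContDiff ℝ 1 ρ := contDiff_defFun i s H.contDiff
  set f : E4 → ℝ := fun x => ginner G x (X x) (outerNormal G D x) with hf
  -- the flux density in terms of the graph
  set k : E4 → ℝ := fun x =>
    (Real.sqrt (G x).det)⁻¹ * (∑ j, pd j ρ x * Y x j) * (gradNorm G ρ x)⁻¹ with hk
  have hfk : ∀ x ∈ W, x ∈ frontier D → f x = k x := by
    intro x hx hxf
    have hdet : 0 < Real.sqrt (G x).det := Real.sqrt_pos.2 (hG x hx).det_pos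
    have hXY : ∀ j, X x j = (Real.sqrt (G x).det)⁻¹ * Y x j := by
      intro j
      rw [hYX x, PiLp.smul_apply, smul_eq_mul, inv_mul_cancel_left₀ hdet.ne']
    simp only [hf, hk]
    rw [outerNormal_eq G (H.isDefiningFunctionAt hD hx hxf), ginner_smul_right,
      ginner_grad_right (hG x hx), fderiv_eq_sum_pd, mul_comm]
    congr 1
    rw [Finset.mul_sum]
    exact Finset.sum_congr rfl fun j _ => by rw [hXY j]; ring
  have hpatch := H.isBoundaryPatch hD
  have hres : σ.restrict W = patchMeasure G (graphDomain W i h) (graphMap i h) :=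
    H.surfaceMeasure_restrict hD G
  set U := graphDomain W i h with hU
  have hUo : IsOpen U := hpatch.isOpen
  have hdetc : ContinuousOn (fun x => Real.sqrt (G x).det) W :=
    Real.continuous_sqrt.comp_continuousOn
      ((Continuous.matrix_det continuous_id).comp_continuousOn hGc)
  have hnormpos : ∀ x ∈ W, gradNorm G ρ x ≠ 0 := by
    intro x hx h0
    have h1 := gradNorm_sq (hG x hx) ρ
    rw [h0] at h1
    have h2 : (fun j => pd j ρ x) ≠ 0 := by
      intro hz
      have := congrFun hz i
      simp only [hρ, pd_defFun_same i s H.contDiff, Pi.zero_apply] at this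
      rw [this] at hss
      norm_num at hss
    have h3 := (hG x hx).inv.dotProduct_mulVec_pos h2
    rw [star_trivial, ← sum_sum_eq_dotProduct, ← h1] at h3
    norm_num at h3
  have hnormc : ContinuousOn (gradNorm G ρ) W := by
    have h1 : ContinuousOn (fun x => Real.sqrt
        (∑ i, ∑ j, (G x)⁻¹ i j * pd i ρ x * pd j ρ x)) W := by
      refine Real.continuous_sqrt.comp_continuousOn ?_
      refine continuousOn_finsetSum _ fun j _ => continuousOn_finsetSum _ fun l _ => ?_
      exact ((ContinuousOn.matrix_inv_apply hGc hG j l).mul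
        (continuous_pd j hρC).continuousOn).mul (continuous_pd l hρC).continuousOn
    refine h1.congr fun x hx => ?_
    rw [gradNorm, ginner_grad_self (hG x hx)]
  have hkc : ContinuousOn k W := by
    refine ((hdetc.inv₀ fun x hx => (Real.sqrt_pos.2 (hG x hx).det_pos).ne').mul
      (continuousOn_finsetSum _ fun j _ => ?_)).mul (hnormc.inv₀ hnormpos)
    have : Continuous fun x => Y x j := by
      have := hY.continuous
      fun_prop
    exact ((continuous_pd j hρC).mul this).continuousOn
  have hkm : AEStronglyMeasurable k (σ.restrict W) := hkc.aestronglyMeasurable hWm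
  have hfkae : f =ᵐ[σ.restrict W] k := by
    filter_upwards [ae_restrict_mem hWm, ae_restrict_of_ae (ae_surfaceMeasure_mem_frontier G D)]
      with x hx hxf using hfk x hx hxf
  -- the density of the pulled back measure
  set d : E3 → ENNReal := fun y => ENNReal.ofReal (Real.sqrt (inducedMetric G (graphMap i h) y).det)
  have hdU : ∀ y ∈ U, Real.sqrt (inducedMetric G (graphMap i h) y).det
      = Real.sqrt (G (graphMap i h y)).det * gradNorm G ρ (graphMap i h y) := fun y hy =>
    (H.sqrt_det_inducedMetric (hG _ hy)).2
  have hψc : ContinuousOn (graphMap i h) U := hpatch.contDiffOn.continuousOn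
  have hdm : AEMeasurable d (volume.restrict U) := by
    refine AEMeasurable.ennreal_ofReal (ContinuousOn.aemeasurable ?_ hUo.measurableSet)
    exact ((hdetc.comp hψc fun y hy => hy).mul (hnormc.comp hψc fun y hy => hy)).congr hdU
  have hψm : AEMeasurable (graphMap i h) ((volume.restrict U).withDensity d) :=
    hpatch.aemeasurable.mono_ac (withDensity_absolutelyContinuous _ _)
  have hdtop : ∀ᵐ y ∂volume.restrict U, d y < ⊤ := ae_of_all _ fun y => ENNReal.ofReal_lt_top
  set b : E3 → ℝ := fun y => s * (Y (graphMap i h y) i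
    - ∑ α, fderiv ℝ h y (EuclideanSpace.single α 1) * Y (graphMap i h y) (i.succAbove α)) with hb
  have hdb : ∀ y ∈ U, (d y).toReal • k (graphMap i h y) = b y := by
    intro y hy
    have hdet : 0 < Real.sqrt (G (graphMap i h y)).det := Real.sqrt_pos.2 (hG _ hy).det_pos
    have hn := hnormpos _ hy
    have hsum : ∑ j, pd j ρ (graphMap i h y) * Y (graphMap i h y) j = b y := by
      rw [Fin.sum_univ_succAbove _ i]
      simp only [hρ, pd_defFun_same i s H.contDiff, pd_defFun_succAbove i s H.contDiff,
        del_graphMap, hb, mul_sub, Finset.mul_sum, neg_mul, Finset.sum_neg_distrib]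
      rw [sub_eq_add_neg]
      congr 2
      exact Finset.sum_congr rfl fun α _ => by ring
    have hd : (d y).toReal = Real.sqrt (inducedMetric G (graphMap i h) y).det :=
      ENNReal.toReal_ofReal (Real.sqrt_nonneg _)
    rw [hd, hdU y hy, smul_eq_mul]
    simp only [hk, hsum]
    field_simp
  have hY0 : ∀ x ∉ W, Y x = 0 := fun x hx => by rw [hYX, hX x hx, smul_zero]
  have hb0 : ∀ y ∉ U, b y = 0 := by
    intro y hy
    have : Y (graphMap i h y) = 0 := hY0 _ hy
    simp [hb, this]
  have hψemb : IsClosedEmbedding (graphMap i h) :=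
    Function.LeftInverse.isClosedEmbedding (f := del i) (del_graphMap i h) (del i).continuous
      (contDiff_graphMap i H.contDiff).continuous
  have hbI : Integrable b := by
    refine Continuous.integrable_of_hasCompactSupport ?_ ?_
    · have h1 : Continuous fun y => Y (graphMap i h y) := hY.continuous.comp hψemb.continuous
      have h2 : ∀ α : Fin 3, Continuous fun y => fderiv ℝ h y (EuclideanSpace.single α 1) :=
        fun α => (H.contDiff.continuous_fderiv one_ne_zero).clm_apply continuous_const
      have h3 : ∀ j, Continuous fun y => Y (graphMap i h y) j := fun j => by fun_prop
      exact continuous_const.mul ((h3 i).sub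
        (continuous_finsetSum _ fun α _ => (h2 α).mul (h3 _)))
    · refine (hYc.comp_isClosedEmbedding hψemb).mono fun y hy => ?_
      contrapose! hy
      have : Y (graphMap i h y) = 0 := by simpa using hy
      simp [hb, this]
  have hkI : Integrable k (σ.restrict W) ∧ ∫ x, k x ∂(σ.restrict W) = ∫ y in U, b y := by
    rw [hres] at hkm ⊢
    unfold patchMeasure at hkm ⊢
    rw [integrable_map_measure hkm hψm, integral_map hψm hkm,
      integral_withDensity_eq_integral_toReal_smul₀ hdm hdtop,
      integrable_withDensity_iff_integrable_smul₀' hdm hdtop]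
    refine ⟨?_, setIntegral_congr_fun hUo.measurableSet hdb⟩
    exact (hbI.integrableOn (s := U)).congr (by
      filter_upwards [ae_restrict_mem hUo.measurableSet] with y hy using (hdb y hy).symm)
  have hfI : Integrable f (σ.restrict W) := hkI.1.congr hfkae.symm
  have hf0 : ∀ x ∉ W, f x = 0 := fun x hx => by simp [hf, hX x hx, ginner]
  have hfind : W.indicator f = f := indicator_eq_self.2 fun x hx => by
    by_contra hcon; exact hx (hf0 x hcon)
  refine ⟨?_, ?_⟩
  · rw [← hfind]
    exact (integrable_indicator_iff hWm).2 hfI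
  · have e1 : bdryInt G D f = ∫ y, b y := by
      rw [bdryInt, ← setIntegral_eq_integral_of_forall_compl_eq_zero (s := W) hf0,
        integral_congr_ae hfkae, hkI.2, setIntegral_eq_integral_of_forall_compl_eq_zero hb0]
    rw [e1]
    simp only [hb]
    rw [integral_const_mul]
    have := integral_div_graph i H.sign H.contDiff hY hYc
    simp only [graphMap]
    rw [← this]
    have hDm := hD.measurableSet
    have hgm : MeasurableSet {x : E4 | s * (x i - h (del i x)) < 0} :=
      measurableSet_lt (contDiff_defFun i s H.contDiff).continuous.measurable measurable_const
    rw [← integral_indicator hDm, ← integral_indicator hgm]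
    congr 1
    ext x
    by_cases hx : x ∈ W
    · by_cases hxD : x ∈ D
      · have := (H.mem_iff x hx).1 hxD
        simp [indicator, hxD, this]
      · have := mt (H.mem_iff x hx).2 hxD
        simp only [indicator, hxD, mem_ofPred_eq, this, if_false]
    · have hz : ∑ j, pd j (fun y => Y y j) x = 0 := by
        refine Finset.sum_eq_zero fun j _ => ?_
        have : (fun y => Y y j) =ᶠ[𝓝 x] fun _ => 0 := by
          filter_upwards [notMem_tsupport_iff_eventuallyEq.1 fun hcon => hx (hYW hcon)] with z hz
          simp [hz]
        rw [pd, this.fderiv_eq]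
        simp
      simp [indicator, hz]

end IsLocalGraph

/-! ### The divergence theorem -/

lemma integral_div_eq_zero {Y : E4 → E4} (hY : ContDiff ℝ 1 Y) (hYc : HasCompactSupport Y) :
    ∫ x, ∑ j, pd j (fun y => Y y j) x = 0 := by
  -- the support lies below a hyperplane, which serves as a graph
  obtain ⟨r, hr⟩ := hYc.isBounded.subset_closedBall 0
  set R := |r| + 1
  have hsupp : ∀ x : E4, R ≤ x 0 → x ∉ tsupport Y := by
    intro x hx hxs
    have h1 : ‖x‖ ≤ r := by simpa using hr hxs
    have h2 : |x 0| ≤ ‖x‖ := PiLp.norm_apply_le x 0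
    have h3 := le_abs_self (x 0)
    have h4 := le_abs_self r
    simp only [R] at hx
    linarith
  have h := integral_div_graph 0 (Or.inl rfl) (h := fun _ => R) contDiff_const hY hYc
  have hz : ∀ x, x ∉ tsupport Y → ∑ j, pd j (fun y => Y y j) x = 0 := by
    intro x hx
    refine Finset.sum_eq_zero fun j _ => ?_
    have : (fun y => Y y j) =ᶠ[𝓝 x] fun _ => 0 := by
      filter_upwards [notMem_tsupport_iff_eventuallyEq.1 hx] with z hz
      simp [hz]
    rw [pd, this.fderiv_eq]
    simp
  rw [setIntegral_eq_integral_of_forall_compl_eq_zero] at h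
  · rw [h]
    have : ∀ y, Y (slice 0 (R, y)) = 0 := fun y =>
      image_eq_zero_of_notMem_tsupport (hsupp _ (by simp))
    simp [this]
  · intro x hx
    refine hz x (hsupp x ?_)
    simpa using hx

/-- The divergence theorem for fields with compact support in the domain. -/
lemma flux_interior {D : Set E4} (hD : IsOpen D) (G : CoordMetric) {X Y : E4 → E4}
    (hY : ContDiff ℝ 1 Y) (hYc : HasCompactSupport Y) (hYD : tsupport Y ⊆ D)
    (hX : ∀ x ∉ D, X x = 0) :
    Integrable (fun x => ginner G x (X x) (outerNormal G D x)) (surfaceMeasure G D) ∧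
    ∫ x in D, ∑ j, pd j (fun y => Y y j) x
      = bdryInt G D (fun x => ginner G x (X x) (outerNormal G D x)) := by
  have h0 : (fun x => ginner G x (X x) (outerNormal G D x)) =ᵐ[surfaceMeasure G D] fun _ => 0 := by
    filter_upwards [ae_surfaceMeasure_mem_frontier G D] with x hx
    rw [hD.frontier_eq] at hx
    simp [hX x hx.2, ginner]
  refine ⟨(integrable_zero _ _ _).congr h0.symm, ?_⟩
  rw [bdryInt, integral_congr_ae h0, integral_zero,
    setIntegral_eq_integral_of_forall_compl_eq_zero, integral_div_eq_zero hY hYc]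
  intro x hx
  refine Finset.sum_eq_zero fun j _ => ?_
  have : (fun y => Y y j) =ᶠ[𝓝 x] fun _ => 0 := by
    filter_upwards [notMem_tsupport_iff_eventuallyEq.1 fun hcon => hx (hYD hcon)] with z hz
    simp [hz]
  rw [pd, this.fderiv_eq]
  simp

/-- The divergence theorem on a bounded domain with `C¹` boundary, in terms of the flat divergence
of the density `√(det g) X`. -/
theorem integral_flat_div_eq_bdryInt {D V : Set E4} (hD : IsOpen D) (hDc : IsCompact (closure D))
    (hDb : HasC1Boundary D) (hV : IsOpen V) (hDV : closure D ⊆ V) {G : CoordMetric}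
    (hG : ∀ x ∈ V, (G x).PosDef) (hGc : ContinuousOn G V) {X Y : E4 → E4}
    (hYX : ∀ x, Y x = Real.sqrt (G x).det • X x)
    (hY : ∀ x ∈ closure D, ContDiffAt ℝ 1 Y x) :
    ∫ x in D, ∑ j, pd j (fun y => Y y j) x
      = bdryInt G D (fun x => ginner G x (X x) (outerNormal G D x)) := by
  let P : (E4 → E4) → (E4 → E4) → Prop := fun X Y =>
    Integrable (fun x => ginner G x (X x) (outerNormal G D x)) (surfaceMeasure G D) ∧
    ∫ x in D, ∑ j, pd j (fun y => Y y j) x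
      = bdryInt G D (fun x => ginner G x (X x) (outerNormal G D x))
  have hloc : ∀ x ∈ closure D, ∃ W, IsOpen W ∧ x ∈ W ∧ (∀ y ∈ W, ContDiffAt ℝ 1 Y y) ∧
      W ⊆ Metric.ball x 1 ∧ ∀ X' Y' : E4 → E4, ContDiff ℝ 1 Y' → HasCompactSupport Y' →
        tsupport Y' ⊆ W → (∀ x, Y' x = Real.sqrt (G x).det • X' x) → (∀ x ∉ W, X' x = 0) →
        P X' Y' := by
    intro x hx
    have hev : {y | ContDiffAt ℝ 1 Y y} ∈ 𝓝 x := (hY x hx).eventually (by simp)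
    by_cases hxD : x ∈ D
    · obtain ⟨W, hW, hWo, hxW⟩ := mem_nhds_iff.1
        (inter_mem hev (inter_mem (hD.mem_nhds hxD) (Metric.ball_mem_nhds x one_pos)))
      refine ⟨W, hWo, hxW, fun y hy => (hW hy).1, fun y hy => (hW hy).2.2, ?_⟩
      intro X' Y' h1 h2 h3 _ h5
      exact flux_interior hD G h1 h2 (fun y hy => (hW (h3 hy)).2.1)
        fun y hy => h5 y fun hcon => hy (hW hcon).2.1
    · have hxf : x ∈ frontier D := by rw [hD.frontier_eq]; exact ⟨hx, hxD⟩
      obtain ⟨ρ, hρ⟩ := hDb x hxf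
      obtain ⟨W, i, s, h, hxW, hW, H⟩ := hρ.exists_isLocalGraph
        (inter_mem hev (inter_mem (hV.mem_nhds (hDV hx)) (Metric.ball_mem_nhds x one_pos)))
      refine ⟨W, H.isOpen, hxW, fun y hy => (hW hy).1, fun y hy => (hW hy).2.2, ?_⟩
      intro X' Y' h1 h2 h3 h4 h5
      exact H.flux hD (fun y hy => hG y (hW hy).2.1) (hGc.mono fun y hy => (hW hy).2.1)
        h1 h2 h3 h4 h5
  -- a partition of unity reduces the claim to fields supported in the sets `W`
  choose! W hWo hxW hWC hWb hWP using hloc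
  obtain ⟨t, ht, hcover⟩ := hDc.elim_nhds_subcover W fun x hx => (hWo x hx).mem_nhds (hxW x hx)
  obtain ⟨f, hf⟩ := SmoothPartitionOfUnity.exists_isSubordinate 𝓘(ℝ, E4)
    (isClosed_closure (s := D)) (fun k : t => W k) (fun k => hWo k (ht k k.2)) (by
      intro x hx
      obtain ⟨k, hk, hxk⟩ := mem_iUnion₂.1 (hcover hx)
      exact mem_iUnion.2 ⟨⟨k, hk⟩, hxk⟩)
  have hfC : ∀ k, ContDiff ℝ 1 (f k) := fun k =>
    ((f k).contMDiff.contDiff).of_le (by simp)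
  have hfsum : ∀ x ∈ closure D, ∑ k, f k x = 1 := fun x hx => by
    rw [← finsum_eq_sum_of_fintype]; exact f.sum_eq_one hx
  have hfW : ∀ k : t, tsupport (f k) ⊆ W k := fun k => hf k
  let Yk : t → E4 → E4 := fun k x => f k x • Y x
  let Xk : t → E4 → E4 := fun k x => f k x • X x
  have hYkt : ∀ k, tsupport (Yk k) ⊆ tsupport (f k) := fun k =>
    closure_mono fun x hx hcon => hx (by simp only [Yk, hcon, zero_smul])
  have hYkC : ∀ k, ContDiff ℝ 1 (Yk k) := by
    intro k
    rw [contDiff_iff_contDiffAt]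
    intro x
    by_cases hx : x ∈ tsupport (f k)
    · exact (hfC k).contDiffAt.smul (hWC k (ht k k.2) x (hfW k hx))
    · refine (contDiffAt_const (c := (0 : E4))).congr_of_eventuallyEq ?_
      filter_upwards [notMem_tsupport_iff_eventuallyEq.1 hx] with w hw
      simp [Yk, hw]
  have hYkc : ∀ k, HasCompactSupport (Yk k) := by
    intro k
    refine Metric.isCompact_of_isClosed_isBounded (isClosed_tsupport _) ?_
    exact (Metric.isBounded_ball (x := (k : E4)) (r := 1)).subset
      (((hYkt k).trans (hfW k)).trans (hWb k (ht k k.2)))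
  have hPk : ∀ k, P (Xk k) (Yk k) := by
    intro k
    refine hWP k (ht k k.2) _ _ (hYkC k) (hYkc k) ((hYkt k).trans (hfW k)) ?_ ?_
    · intro x
      simp only [Yk, Xk, hYX x]
      rw [smul_comm]
    · intro x hx
      have : f k x = 0 := image_eq_zero_of_notMem_tsupport fun hcon => hx (hfW k hcon)
      simp [Xk, this]
  have hint : ∀ k, Integrable (fun x => ∑ j, pd j (fun y => Yk k y j) x) := by
    intro k
    refine integrable_finsetSum _ fun j _ => ?_
    have h1 : ContDiff ℝ 1 fun y => Yk k y j := by
      have := hYkC k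
      fun_prop
    exact (continuous_pd j h1).integrable_of_hasCompactSupport
      (hasCompactSupport_pd j ((hYkc k).comp_left (g := fun v : E4 => v j) rfl))
  calc ∫ x in D, ∑ j, pd j (fun y => Y y j) x
      = ∫ x in D, ∑ k, ∑ j, pd j (fun y => Yk k y j) x := by
        refine setIntegral_congr_fun hD.measurableSet fun x hx => ?_
        simp only
        rw [Finset.sum_comm]
        refine Finset.sum_congr rfl fun j _ => ?_
        have hev : (fun y => Y y j) =ᶠ[𝓝 x] fun y => ∑ k, Yk k y j := by
          filter_upwards [hD.mem_nhds hx] with y hy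
          simp only [Yk, PiLp.smul_apply, smul_eq_mul]
          rw [← Finset.sum_mul, hfsum y (subset_closure hy), one_mul]
        simp only [pd]
        rw [hev.fderiv_eq, fderiv_fun_sum]
        · simp
        · intro k _
          have h1 : ContDiff ℝ 1 fun y => Yk k y j := by
            have := hYkC k
            fun_prop
          exact h1.differentiable one_ne_zero x
    _ = ∑ k, ∫ x in D, ∑ j, pd j (fun y => Yk k y j) x :=
        integral_finsetSum _ fun k _ => (hint k).integrableOn
    _ = ∑ k, bdryInt G D (fun x => ginner G x (Xk k x) (outerNormal G D x)) :=
        Finset.sum_congr rfl fun k _ => (hPk k).2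
    _ = bdryInt G D (fun x => ginner G x (X x) (outerNormal G D x)) := by
        simp only [bdryInt]
        rw [← integral_finsetSum _ fun k _ => (hPk k).1]
        refine integral_congr_ae ?_
        filter_upwards [ae_surfaceMeasure_mem_frontier G D] with x hx
        rw [← ginner_sum_left, ← Finset.sum_smul, hfsum x (frontier_subset_closure hx), one_smul]

/-! ### The Riemannian divergence -/

/-- Jacobi's formula for the derivative of a determinant. -/
lemma pd_det {G : CoordMetric} {x : E4} (hG : ∀ i j, DifferentiableAt ℝ (fun y => G y i j) x)
    (l : Fin 4) :
    pd l (fun y => (G y).det) x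
      = ∑ i, ∑ j, (G x).adjugate i j * pd l (fun y => G y j i) x := by
  have h1 : HasFDerivAt (fun y => (G y).det)
      (∑ σ : Equiv.Perm (Fin 4), ((Equiv.Perm.sign σ : ℤ) : ℝ) •
        ∑ i, (∏ j ∈ Finset.univ.erase i, G x (σ j) j) • fderiv ℝ (fun y => G y (σ i) i) x) x := by
    simp only [Matrix.det_apply']
    refine HasFDerivAt.fun_sum fun σ _ => HasFDerivAt.const_mul ?_ _
    exact HasFDerivAt.finsetProd fun i _ => (hG (σ i) i).hasFDerivAt
  have h2 : ∀ i, ∑ j, (G x).adjugate i j * pd l (fun y => G y j i) x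
      = ((G x).updateCol i fun j => pd l (fun y => G y j i) x).det := by
    intro i
    rw [← Matrix.cramer_apply, Matrix.cramer_eq_adjugate_mulVec]
    rfl
  rw [pd, h1.fderiv]
  simp only [h2, Matrix.det_apply']
  rw [Finset.sum_comm]
  simp only [_root_.sum_apply, _root_.smul_apply, smul_eq_mul, Finset.mul_sum]
  refine Finset.sum_congr rfl fun σ _ => Finset.sum_congr rfl fun i _ => ?_
  rw [← Finset.mul_prod_erase Finset.univ _ (Finset.mem_univ i), Matrix.updateCol_self]
  have : ∏ j ∈ Finset.univ.erase i, ((G x).updateCol i fun j => pd l (fun y => G y j i) x) (σ j) j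
      = ∏ j ∈ Finset.univ.erase i, G x (σ j) j :=
    Finset.prod_congr rfl fun j hj => Matrix.updateCol_ne (Finset.ne_of_mem_erase hj)
  rw [this, pd]
  ring

/-- `G` is the coordinate matrix of a smooth Riemannian metric on the open set `V`. -/
structure IsRiemannianOn (G : CoordMetric) (V : Set E4) : Prop where
  isOpen : IsOpen V
  contDiffOn : ∀ i j, ContDiffOn ℝ ∞ (fun x => G x i j) V
  posDef : ∀ x ∈ V, (G x).PosDef

namespace IsRiemannianOn

variable {G : CoordMetric} {V : Set E4} {x : E4}

lemma contDiffAt (H : IsRiemannianOn G V) (hx : x ∈ V) (i j : Fin 4) :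
    ContDiffAt ℝ ∞ (fun x => G x i j) x :=
  (H.contDiffOn i j).contDiffAt (H.isOpen.mem_nhds hx)

lemma differentiableAt (H : IsRiemannianOn G V) (hx : x ∈ V) (i j : Fin 4) :
    DifferentiableAt ℝ (fun x => G x i j) x :=
  (H.contDiffAt hx i j).differentiableAt (by simp)

lemma continuousOn (H : IsRiemannianOn G V) : ContinuousOn G V :=
  continuousOn_pi.2 fun i => continuousOn_pi.2 fun j => (H.contDiffOn i j).continuousOn

lemma pd_comm (H : IsRiemannianOn G V) (hx : x ∈ V) (l i j : Fin 4) :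
    pd l (fun y => G y i j) x = pd l (fun y => G y j i) x := by
  have : (fun y => G y i j) =ᶠ[𝓝 x] fun y => G y j i := by
    filter_upwards [H.isOpen.mem_nhds hx] with y hy using apply_comm (H.posDef y hy) i j
  rw [pd, pd, this.fderiv_eq]

lemma sum_christoffel (H : IsRiemannianOn G V) (hx : x ∈ V) (j : Fin 4) :
    ∑ i, christoffel G i i j x
      = 1 / 2 * ∑ i, ∑ l, (G x)⁻¹ i l * pd j (fun y => G y l i) x := by
  simp only [christoffel, ← Finset.mul_sum]
  congr 1
  have hswap : ∑ i, ∑ l, (G x)⁻¹ i l * pd l (fun y => G y i j) x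
      = ∑ i, ∑ l, (G x)⁻¹ i l * pd i (fun y => G y j l) x := by
    rw [Finset.sum_comm]
    refine Finset.sum_congr rfl fun i _ => Finset.sum_congr rfl fun l _ => ?_
    rw [inv_apply_comm (H.posDef x hx) l i, H.pd_comm hx i l j]
  simp only [mul_sub, mul_add, Finset.sum_sub_distrib, Finset.sum_add_distrib, hswap]
  rw [add_sub_cancel_left]
  exact Finset.sum_congr rfl fun i _ => Finset.sum_congr rfl fun l _ => by
    rw [H.pd_comm hx j i l]

lemma contDiffAt_det (H : IsRiemannianOn G V) (hx : x ∈ V) :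
    ContDiffAt ℝ ∞ (fun y => (G y).det) x := by
  simp only [Matrix.det_apply']
  refine ContDiffAt.sum fun σ _ => contDiffAt_const.mul ?_
  exact contDiffAt_prod fun i _ => H.contDiffAt hx (σ i) i

lemma contDiffAt_sqrt_det (H : IsRiemannianOn G V) (hx : x ∈ V) :
    ContDiffAt ℝ ∞ (fun y => Real.sqrt (G y).det) x :=
  (H.contDiffAt_det hx).sqrt (H.posDef x hx).det_pos.ne'

lemma pd_sqrt_det (H : IsRiemannianOn G V) (hx : x ∈ V) (j : Fin 4) :
    pd j (fun y => Real.sqrt (G y).det) x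
      = Real.sqrt (G x).det * ∑ i, christoffel G i i j x := by
  have hpos := (H.posDef x hx).det_pos
  have hd : DifferentiableAt ℝ (fun y => (G y).det) x :=
    (H.contDiffAt_det hx).differentiableAt (by simp)
  have h1 := (hd.hasFDerivAt.sqrt hpos.ne').fderiv
  rw [pd, h1, H.sum_christoffel hx]
  have h2 : fderiv ℝ (fun y => (G y).det) x (EuclideanSpace.single j 1)
      = (G x).det * ∑ i, ∑ l, (G x)⁻¹ i l * pd j (fun y => G y l i) x := by
    have h3 := pd_det (fun i j => H.differentiableAt hx i j) j
    rw [pd] at h3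
    rw [h3]
    simp only [Finset.mul_sum, ← mul_assoc]
    refine Finset.sum_congr rfl fun i _ => Finset.sum_congr rfl fun l _ => ?_
    congr 1
    simp [Matrix.inv_def, Ring.inverse_eq_inv', hpos.ne']
  rw [_root_.smul_apply, h2, smul_eq_mul]
  have hs : Real.sqrt (G x).det * Real.sqrt (G x).det = (G x).det := Real.mul_self_sqrt hpos.le
  have hs0 : Real.sqrt (G x).det ≠ 0 := (Real.sqrt_pos.2 hpos).ne'
  field_simp
  rw [sq, hs]

/-- The flat divergence of `√(det g) X` is `√(det g)` times the Riemannian divergence of `X`. -/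
lemma sum_pd_sqrt_det_mul (H : IsRiemannianOn G V) (hx : x ∈ V) {X : E4 → E4}
    (hX : DifferentiableAt ℝ X x) :
    ∑ j, pd j (fun y => (Real.sqrt (G y).det • X y) j) x
      = divg G X x * Real.sqrt (G x).det := by
  have hXj : ∀ j, DifferentiableAt ℝ (fun y => X y j) x := fun j => by fun_prop
  have hs : DifferentiableAt ℝ (fun y => Real.sqrt (G y).det) x :=
    (H.contDiffAt_sqrt_det hx).differentiableAt (by simp)
  have h1 : ∀ j, pd j (fun y => (Real.sqrt (G y).det • X y) j) x
      = Real.sqrt (G x).det * pd j (fun y => X y j) x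
        + Real.sqrt (G x).det * (∑ i, christoffel G i i j x) * X x j := by
    intro j
    rw [← H.pd_sqrt_det hx j]
    simp only [PiLp.smul_apply, smul_eq_mul, pd]
    rw [fderiv_fun_mul hs (hXj j)]
    simp
    ring
  simp only [h1, divg, Finset.sum_add_distrib, Finset.sum_mul, add_mul, Finset.mul_sum]
  rw [Finset.sum_comm (f := fun i j => christoffel G i i j x * X x j * Real.sqrt (G x).det)]
  congr 1
  · exact Finset.sum_congr rfl fun j _ => by ring
  · exact Finset.sum_congr rfl fun j _ => Finset.sum_congr rfl fun i _ => by ring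

/-- The divergence theorem for the Riemannian volume and surface measures on a bounded domain with
`C¹` boundary. -/
theorem volInt_divg_eq_bdryInt (H : IsRiemannianOn G V) {D : Set E4} (hD : IsOpen D)
    (hDc : IsCompact (closure D)) (hDb : HasC1Boundary D) (hDV : closure D ⊆ V) {X : E4 → E4}
    (hX : ∀ x ∈ closure D, ContDiffAt ℝ 1 X x) :
    volInt G D (divg G X) = bdryInt G D (fun x => ginner G x (X x) (outerNormal G D x)) := by
  rw [← integral_flat_div_eq_bdryInt hD hDc hDb H.isOpen hDV H.posDef H.continuousOn
    (Y := fun x => Real.sqrt (G x).det • X x) (fun _ => rfl) fun x hx =>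
      ((H.contDiffAt_sqrt_det (hDV hx)).of_le (by simp)).smul (hX x hx)]
  refine setIntegral_congr_fun hD.measurableSet fun x hx => ?_
  exact (H.sum_pd_sqrt_det_mul (hDV (subset_closure hx))
    ((hX x (subset_closure hx)).differentiableAt one_ne_zero)).symm

end IsRiemannianOn

/-! ### Partial derivatives -/

section Partial

variable {f g : E4 → ℝ} {x : E4}

lemma contDiffAt_pd {m n : ℕ∞ω} (hf : ContDiffAt ℝ n f x) (hmn : m + 1 ≤ n) (i : Fin 4) :
    ContDiffAt ℝ m (pd i f) x :=
  (hf.fderiv_right hmn).clm_apply contDiffAt_const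

lemma pd_add (hf : DifferentiableAt ℝ f x) (hg : DifferentiableAt ℝ g x) (i : Fin 4) :
    pd i (fun y => f y + g y) x = pd i f x + pd i g x := by
  rw [pd, fderiv_fun_add hf hg]; rfl

lemma pd_mul (hf : DifferentiableAt ℝ f x) (hg : DifferentiableAt ℝ g x) (i : Fin 4) :
    pd i (fun y => f y * g y) x = pd i f x * g x + f x * pd i g x := by
  rw [pd, fderiv_fun_mul hf hg]
  simp only [_root_.add_apply, _root_.smul_apply, smul_eq_mul, pd]
  ring

lemma pd_sum {ι : Type*} {t : Finset ι} {f : ι → E4 → ℝ}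
    (hf : ∀ k ∈ t, DifferentiableAt ℝ (f k) x) (i : Fin 4) :
    pd i (fun y => ∑ k ∈ t, f k y) x = ∑ k ∈ t, pd i (f k) x := by
  rw [pd, fderiv_fun_sum hf, _root_.sum_apply]; rfl

lemma pd_congr (h : f =ᶠ[𝓝 x] g) (i : Fin 4) : pd i f x = pd i g x := by
  rw [pd, pd, h.fderiv_eq]

lemma pd_pd_comm (hf : ContDiffAt ℝ 2 f x) (i j : Fin 4) :
    pd i (pd j f) x = pd j (pd i f) x := by
  have hd : DifferentiableAt ℝ (fderiv ℝ f) x :=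
    (hf.fderiv_right (m := 1) le_rfl).differentiableAt one_ne_zero
  have key : ∀ i j, pd i (pd j f) x = fderiv ℝ (fderiv ℝ f) x (ev i) (ev j) := by
    intro i j
    have : fderiv ℝ (fun y => fderiv ℝ f y (ev j)) x (ev i)
        = fderiv ℝ (fderiv ℝ f) x (ev i) (ev j) := by
      rw [fderiv_clm_apply hd (differentiableAt_const _)]
      simp
    exact this
  rw [key, key]
  exact (hf.isSymmSndFDerivAt (by simp)).eq _ _

end Partial

/-! ### Smoothness of the metric coefficients -/

namespace IsRiemannianOn

variable {G : CoordMetric} {V : Set E4} {x : E4}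

lemma contDiffAt_inv (H : IsRiemannianOn G V) (hx : x ∈ V) (i j : Fin 4) :
    ContDiffAt ℝ ∞ (fun y => (G y)⁻¹ i j) x := by
  have hadj : ContDiffAt ℝ ∞ (fun y => (G y).adjugate i j) x := by
    simp only [Matrix.adjugate_apply, Matrix.det_apply']
    refine ContDiffAt.sum fun σ _ => contDiffAt_const.mul (contDiffAt_prod fun k _ => ?_)
    simp only [Matrix.updateRow_apply]
    split_ifs
    · exact contDiffAt_const
    · exact H.contDiffAt hx _ _
  have := ((H.contDiffAt_det hx).inv (H.posDef x hx).det_pos.ne').mul hadj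
  simpa [Matrix.inv_def, Ring.inverse_eq_inv'] using this

lemma contDiffAt_christoffel (H : IsRiemannianOn G V) (hx : x ∈ V) (k i j : Fin 4) :
    ContDiffAt ℝ ∞ (christoffel G k i j) x := by
  have hp : ∀ a b c, ContDiffAt ℝ ∞ (pd a fun y => G y b c) x := fun a b c =>
    contDiffAt_pd (H.contDiffAt hx b c) (by simp) a
  refine contDiffAt_const.mul (ContDiffAt.sum fun l _ => (H.contDiffAt_inv hx k l).mul ?_)
  exact ((hp i j l).add (hp j i l)).sub (hp l i j)

lemma contDiffAt_ricci (H : IsRiemannianOn G V) (hx : x ∈ V) (i j : Fin 4) :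
    ContDiffAt ℝ ∞ (ricci G i j) x := by
  have hp : ∀ a b c d, ContDiffAt ℝ ∞ (pd a (christoffel G b c d)) x := fun a b c d =>
    contDiffAt_pd (H.contDiffAt_christoffel hx b c d) (by simp) a
  refine ContDiffAt.sum fun k _ => ((hp k k i j).sub (hp j k i k)).add
    (ContDiffAt.sum fun l _ => ContDiffAt.sub ?_ ?_)
  · exact (H.contDiffAt_christoffel hx _ _ _).mul (H.contDiffAt_christoffel hx _ _ _)
  · exact (H.contDiffAt_christoffel hx _ _ _).mul (H.contDiffAt_christoffel hx _ _ _)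

lemma contDiffAt_scalarCurv (H : IsRiemannianOn G V) (hx : x ∈ V) :
    ContDiffAt ℝ ∞ (scalarCurv G) x :=
  ContDiffAt.sum fun i _ => ContDiffAt.sum fun j _ =>
    (H.contDiffAt_inv hx i j).mul (H.contDiffAt_ricci hx i j)

end IsRiemannianOn

/-- The contracted Christoffel symbols `Γ^i_{ij}`. -/
def christoffelTrace (G : CoordMetric) (j : Fin 4) (x : E4) : ℝ := ∑ i, christoffel G i i j x

/-- The first order coefficients of the Laplace-Beltrami operator
`Δu = g^{ij} ∂_i ∂_j u + bʲ ∂_j u`. -/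
def lapDrift (G : CoordMetric) (j : Fin 4) (x : E4) : ℝ :=
  ∑ i, pd i (fun y => (G y)⁻¹ i j) x + ∑ i, christoffelTrace G i x * (G x)⁻¹ i j

lemma divg_eq (G : CoordMetric) (X : E4 → E4) (x : E4) :
    divg G X x = ∑ i, pd i (fun y => X y i) x + ∑ j, christoffelTrace G j x * X x j := by
  simp only [divg, christoffelTrace, Finset.sum_add_distrib, Finset.sum_mul]
  rw [Finset.sum_comm (f := fun i j => christoffel G i i j x * X x j)]

section Divergence

variable {G : CoordMetric} {X Y : E4 → E4} {f : E4 → ℝ} {x : E4}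

lemma divg_add (hX : DifferentiableAt ℝ X x) (hY : DifferentiableAt ℝ Y x) :
    divg G (fun y => X y + Y y) x = divg G X x + divg G Y x := by
  have h : ∀ i, pd i (fun y => X y i + Y y i) x
      = pd i (fun y => X y i) x + pd i (fun y => Y y i) x := fun i =>
    pd_add (f := fun y => X y i) (g := fun y => Y y i) (by fun_prop) (by fun_prop) i
  simp only [divg_eq, h, PiLp.add_apply, mul_add, Finset.sum_add_distrib]
  ring

lemma divg_smul (hf : DifferentiableAt ℝ f x) (hX : DifferentiableAt ℝ X x) :
    divg G (fun y => f y • X y) x = f x * divg G X x + fderiv ℝ f x (X x) := by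
  have h : ∀ i, pd i (fun y => f y * X y i) x
      = pd i f x * X x i + f x * pd i (fun y => X y i) x := fun i =>
    pd_mul (f := f) (g := fun y => X y i) hf (by fun_prop) i
  have h2 : ∑ j, christoffelTrace G j x * (f x * X x j)
      = f x * ∑ j, christoffelTrace G j x * X x j := by
    rw [Finset.mul_sum]
    exact Finset.sum_congr rfl fun j _ => by ring
  simp only [divg_eq, PiLp.smul_apply, smul_eq_mul, h, h2, Finset.sum_add_distrib, mul_add,
    fderiv_eq_sum_pd, ← Finset.mul_sum]
  ring

lemma divg_const_smul (c : ℝ) (hX : DifferentiableAt ℝ X x) :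
    divg G (fun y => c • X y) x = c * divg G X x := by
  rw [divg_smul (f := fun _ => c) (differentiableAt_const c) hX]
  simp

lemma divg_sub (hX : DifferentiableAt ℝ X x) (hY : DifferentiableAt ℝ Y x) :
    divg G (fun y => X y - Y y) x = divg G X x - divg G Y x := by
  have h := divg_add (G := G) hX (hY.const_smul (-1 : ℝ))
  have h2 := divg_const_smul (G := G) (-1) hY
  have h3 : (fun y => X y - Y y) = fun y => X y + (-1 : ℝ) • Y y := by
    funext y; simp [sub_eq_add_neg]
  rw [h3]
  calc _ = divg G X x + divg G (fun y => (-1 : ℝ) • Y y) x := h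
    _ = _ := by rw [h2]; ring

/-- The divergence of a field that depends linearly on the first derivatives of a function. -/
lemma divg_linear {c : Fin 4 → Fin 4 → E4 → ℝ} {u : E4 → ℝ}
    (hc : ∀ i k, DifferentiableAt ℝ (c i k) x) (hu : ∀ k, DifferentiableAt ℝ (pd k u) x)
    {L : E4 → E4} (hL : ∀ᶠ y in 𝓝 x, ∀ i, L y i = ∑ k, c i k y * pd k u y) :
    divg G L x = ∑ i, ∑ k, (pd i (c i k) x * pd k u x + c i k x * pd i (pd k u) x)
      + ∑ j, christoffelTrace G j x * ∑ k, c j k x * pd k u x := by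
  rw [divg_eq]
  congr 1
  · refine Finset.sum_congr rfl fun i _ => ?_
    have : (fun y => L y i) =ᶠ[𝓝 x] fun y => ∑ k, c i k y * pd k u y := by
      filter_upwards [hL] with y hy using hy i
    rw [pd_congr this, pd_sum fun k _ => (hc i k).fun_mul (hu k)]
    exact Finset.sum_congr rfl fun k _ => pd_mul (hc i k) (hu k) i
  · exact Finset.sum_congr rfl fun j _ => by rw [hL.self_of_nhds j]

end Divergence

/-! ### Affine vector fields -/

/-- The affine vector field `x ↦ lam x + a`, which is the radial field for `lam = 1`, `a = 0` and a
field with constant components for `lam = 0`. -/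
def affField (lam : ℝ) (a : E4) (x : E4) : E4 := lam • x + a

lemma contDiff_affField (lam : ℝ) (a : E4) {n : ℕ∞ω} : ContDiff ℝ n (affField lam a) := by
  unfold affField
  fun_prop

lemma pd_affField (lam : ℝ) (a x : E4) (i k : Fin 4) :
    pd i (fun y => affField lam a y k) x = if i = k then lam else 0 := by
  have h : HasFDerivAt (fun y : E4 => lam * y k + a k)
      (lam • (EuclideanSpace.proj k : E4 →L[ℝ] ℝ)) x :=
    ((EuclideanSpace.proj k : E4 →L[ℝ] ℝ).hasFDerivAt.const_mul lam).add_const (a k)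
  have h2 : (fun y => affField lam a y k) = fun y => lam * y k + a k := by
    funext y; simp [affField]
  rw [pd, h2, h.fderiv]
  simp [eq_comm]

/-- The derivative `X u` of `u` along the affine field. -/
def affDeriv (lam : ℝ) (a : E4) (u : E4 → ℝ) (x : E4) : ℝ := fderiv ℝ u x (affField lam a x)

section AffDeriv

variable {lam : ℝ} {a x : E4} {u : E4 → ℝ}

lemma affDeriv_eq (lam : ℝ) (a : E4) (u : E4 → ℝ) :
    affDeriv lam a u = fun y => ∑ k, pd k u y * affField lam a y k := by
  funext y
  rw [affDeriv, fderiv_eq_sum_pd]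

lemma differentiableAt_affField (lam : ℝ) (a x : E4) (k : Fin 4) :
    DifferentiableAt ℝ (fun y => affField lam a y k) x := by
  have := (contDiff_affField lam a (n := 1)).differentiable one_ne_zero x
  fun_prop

lemma contDiffAt_affDeriv {m n : ℕ∞ω} (hu : ContDiffAt ℝ n u x) (hmn : m + 1 ≤ n) :
    ContDiffAt ℝ m (affDeriv lam a u) x :=
  (hu.fderiv_right hmn).clm_apply (contDiff_affField lam a).contDiffAt

lemma pd_affDeriv (hu : ContDiffAt ℝ 2 u x) (i : Fin 4) :
    pd i (affDeriv lam a u) x = lam * pd i u x + ∑ k, affField lam a x k * pd i (pd k u) x := by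
  have hd : ∀ k, DifferentiableAt ℝ (pd k u) x := fun k =>
    (contDiffAt_pd (m := 1) hu (by norm_num) k).differentiableAt one_ne_zero
  rw [affDeriv_eq, pd_sum fun k _ => (hd k).fun_mul (differentiableAt_affField lam a x k)]
  simp only [pd_mul (hd _) (differentiableAt_affField lam a x _), pd_affField,
    Finset.sum_add_distrib]
  rw [add_comm]
  congr 1
  · simp [mul_comm]
  · exact Finset.sum_congr rfl fun k _ => mul_comm _ _

lemma pd_pd_affDeriv (hu : ContDiffAt ℝ 3 u x) (i j : Fin 4) :
    pd i (pd j (affDeriv lam a u)) x = 2 * lam * pd i (pd j u) x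
      + ∑ k, affField lam a x k * pd i (pd j (pd k u)) x := by
  have hev : pd j (affDeriv lam a u) =ᶠ[𝓝 x]
      fun y => lam * pd j u y + ∑ k, affField lam a y k * pd j (pd k u) y := by
    filter_upwards [hu.eventually (by simp)] with y hy
      using pd_affDeriv (hy.of_le (by norm_num)) j
  have h1 : ∀ k, ContDiffAt ℝ 2 (pd k u) x := fun k => contDiffAt_pd hu (by norm_num) k
  have h2 : ∀ k, DifferentiableAt ℝ (pd j (pd k u)) x := fun k =>
    (contDiffAt_pd (m := 1) (h1 k) (by norm_num) j).differentiableAt one_ne_zero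
  have hj : DifferentiableAt ℝ (pd j u) x := (h1 j).differentiableAt two_ne_zero
  have hX := differentiableAt_affField lam a x
  rw [pd_congr hev, pd_add (hj.const_mul lam)
      (DifferentiableAt.fun_sum fun k _ => (hX k).fun_mul (h2 k)),
    pd_sum fun k _ => (hX k).fun_mul (h2 k), pd_mul (differentiableAt_const lam) hj]
  simp only [pd_mul (hX _) (h2 _), pd_affField, Finset.sum_add_distrib]
  have h0 : pd i (fun _ => lam) x = 0 := by simp [pd]
  have h3 : ∑ k, (if i = k then lam else 0) * pd j (pd k u) x = lam * pd i (pd j u) x := by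
    simp [pd_pd_comm (hu.of_le (by norm_num)) i j]
  rw [h0, h3]
  ring

end AffDeriv

/-! ### Regularity of gradient and Laplacian -/

namespace IsRiemannianOn

variable {G : CoordMetric} {V : Set E4} {x : E4} {u : E4 → ℝ}

lemma contDiffAt_christoffelTrace (H : IsRiemannianOn G V) (hx : x ∈ V) (j : Fin 4) :
    ContDiffAt ℝ ∞ (christoffelTrace G j) x :=
  ContDiffAt.sum fun i _ => H.contDiffAt_christoffel hx i i j

lemma contDiffAt_lapDrift (H : IsRiemannianOn G V) (hx : x ∈ V) (j : Fin 4) :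
    ContDiffAt ℝ ∞ (lapDrift G j) x :=
  (ContDiffAt.sum fun i _ => contDiffAt_pd (H.contDiffAt_inv hx i j) (by simp) i).add
    (ContDiffAt.sum fun i _ => (H.contDiffAt_christoffelTrace hx i).mul (H.contDiffAt_inv hx i j))

lemma contDiffAt_grad (H : IsRiemannianOn G V) (hx : x ∈ V) {m n : ℕ∞} (hu : ContDiffAt ℝ n u x)
    (hmn : (m : ℕ∞ω) + 1 ≤ n) : ContDiffAt ℝ m (grad G u) x := by
  rw [contDiffAt_euclidean]
  intro i
  change ContDiffAt ℝ m (fun x => ∑ j, (G x)⁻¹ i j * pd j u x) x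
  exact ContDiffAt.sum fun j _ => ((H.contDiffAt_inv hx i j).of_le (by exact_mod_cast le_top)).mul
    (contDiffAt_pd hu hmn j)

lemma lap_eq (H : IsRiemannianOn G V) (hx : x ∈ V) (hu : ContDiffAt ℝ 2 u x) :
    lap G u x = ∑ i, ∑ j, (G x)⁻¹ i j * pd i (pd j u) x + ∑ j, lapDrift G j x * pd j u x := by
  rw [lap, divg_linear (c := fun i k y => (G y)⁻¹ i k) (u := u)
    (fun i k => (H.contDiffAt_inv hx i k).differentiableAt (by simp))
    (fun k => (contDiffAt_pd (m := 1) hu (by norm_num) k).differentiableAt one_ne_zero)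
    (Eventually.of_forall fun y i => rfl)]
  simp only [lapDrift, Finset.sum_add_distrib, add_mul, Finset.sum_mul, Finset.mul_sum]
  rw [Finset.sum_comm (f := fun i k => pd i (fun y => (G y)⁻¹ i k) x * pd k u x),
    Finset.sum_comm (f := fun j k => christoffelTrace G j x * ((G x)⁻¹ j k * pd k u x))]
  simp only [mul_assoc]
  ring

lemma eventually_lap_eq (H : IsRiemannianOn G V) (hx : x ∈ V) (hu : ContDiffAt ℝ 2 u x) :
    lap G u =ᶠ[𝓝 x] fun x =>
      ∑ i, ∑ j, (G x)⁻¹ i j * pd i (pd j u) x + ∑ j, lapDrift G j x * pd j u x := by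
  filter_upwards [H.isOpen.mem_nhds hx, hu.eventually (by simp)] with y hy hyu using H.lap_eq hy hyu

lemma contDiffAt_lap (H : IsRiemannianOn G V) (hx : x ∈ V) {m n k : ℕ∞} (hu : ContDiffAt ℝ n u x)
    (hkn : (k : ℕ∞ω) + 1 ≤ n) (hmk : (m : ℕ∞ω) + 1 ≤ k) : ContDiffAt ℝ m (lap G u) x := by
  have hle : ∀ l : ℕ∞, (l : ℕ∞ω) ≤ ∞ := fun l => by exact_mod_cast le_top
  have h2 : ContDiffAt ℝ 2 u x := hu.of_le (by
    refine le_trans ?_ hkn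
    refine le_trans ?_ (add_le_add_left hmk 1)
    rw [add_assoc]
    exact le_add_left (by norm_num))
  have hmk' : (m : ℕ∞ω) ≤ k := le_trans (by exact_mod_cast le_self_add) hmk
  refine ContDiffAt.congr_of_eventuallyEq ?_ (H.eventually_lap_eq hx h2)
  refine ContDiffAt.add (ContDiffAt.sum fun i _ => ContDiffAt.sum fun j _ => ?_)
    (ContDiffAt.sum fun j _ => ?_)
  · exact ((H.contDiffAt_inv hx i j).of_le (hle m)).mul
      (contDiffAt_pd (contDiffAt_pd hu hkn j) hmk i)
  · exact ((H.contDiffAt_lapDrift hx j).of_le (hle m)).mul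
      ((contDiffAt_pd hu hkn j).of_le hmk')

lemma eventually_gradNorm_sq (H : IsRiemannianOn G V) (hx : x ∈ V) (u : E4 → ℝ) :
    (fun y => gradNorm G u y ^ 2) =ᶠ[𝓝 x]
      fun x => ∑ i, ∑ j, (G x)⁻¹ i j * pd i u x * pd j u x := by
  filter_upwards [H.isOpen.mem_nhds hx] with y hy using gradNorm_sq (H.posDef y hy) u

lemma contDiffAt_gradNorm_sq (H : IsRiemannianOn G V) (hx : x ∈ V) {m n : ℕ∞}
    (hu : ContDiffAt ℝ n u x) (hmn : (m : ℕ∞ω) + 1 ≤ n) :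
    ContDiffAt ℝ m (fun y => gradNorm G u y ^ 2) x := by
  refine ContDiffAt.congr_of_eventuallyEq ?_ (H.eventually_gradNorm_sq hx u)
  refine ContDiffAt.sum fun i _ => ContDiffAt.sum fun j _ => ?_
  exact (((H.contDiffAt_inv hx i j).of_le (by exact_mod_cast le_top)).mul
    (contDiffAt_pd hu hmn i)).mul (contDiffAt_pd hu hmn j)

end IsRiemannianOn

/-! ### The pointwise Pohozaev identity -/

/-- The scalar product `⟨∇f, ∇h⟩ = g^{ij} ∂_i f ∂_j h` of two gradients. -/
def gradInner (G : CoordMetric) (f h : E4 → ℝ) (x : E4) : ℝ :=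
  ∑ i, ∑ j, (G x)⁻¹ i j * pd i f x * pd j h x

lemma fderiv_grad (G : CoordMetric) (f h : E4 → ℝ) (x : E4) :
    fderiv ℝ f x (grad G h x) = gradInner G f h x := by
  rw [fderiv_eq_sum_pd, gradInner]
  refine Finset.sum_congr rfl fun i _ => ?_
  simp only [grad, Finset.mul_sum]
  exact Finset.sum_congr rfl fun j _ => by ring

lemma gradInner_comm {G : CoordMetric} {x : E4} (hG : (G x).PosDef) (f h : E4 → ℝ) :
    gradInner G f h x = gradInner G h f x := by
  rw [gradInner, Finset.sum_comm]
  exact Finset.sum_congr rfl fun i _ => Finset.sum_congr rfl fun j _ => by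
    rw [inv_apply_comm hG j i]; ring

/-- The defect in `Δ(Xu) = X(Δu) + 2 lam Δu` for the affine field `X`. -/
def lapDefect (G : CoordMetric) (lam : ℝ) (a : E4) (u : E4 → ℝ) (x : E4) : ℝ :=
  - (lam * ∑ j, lapDrift G j x * pd j u x)
    - ∑ k, affField lam a x k * (∑ i, ∑ j, pd k (fun y => (G y)⁻¹ i j) x * pd i (pd j u) x
      + ∑ j, pd k (lapDrift G j) x * pd j u x)

/-- The defect in `⟨∇u, ∇(Xu)⟩ = lam |∇u|² + X|∇u|² / 2` for the affine field `X`. -/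
def gradDefect (G : CoordMetric) (lam : ℝ) (a : E4) (u : E4 → ℝ) (x : E4) : ℝ :=
  - (1 / 2 * ∑ k, affField lam a x k *
    ∑ i, ∑ j, pd k (fun y => (G y)⁻¹ i j) x * pd i u x * pd j u x)

/-- The coefficients `g^{jl} Γ^k_{il} Xⁱ` of the field `hessDefect`. -/
def hessDefectCoeff (G : CoordMetric) (lam : ℝ) (a : E4) (j k : Fin 4) (x : E4) : ℝ :=
  ∑ l, (G x)⁻¹ j l * ∑ i, christoffel G k i l x * affField lam a x i

/-- The difference between `∇(Xu) - lam ∇u` and the field `∇²u[X]` with index raised, for the affine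
field `X`. -/
def hessDefect (G : CoordMetric) (lam : ℝ) (a : E4) (u : E4 → ℝ) (x : E4) : E4 :=
  WithLp.toLp 2 fun j => ∑ k, hessDefectCoeff G lam a j k x * pd k u x

lemma divg_affField (G : CoordMetric) (lam : ℝ) (a x : E4) :
    divg G (affField lam a) x = 4 * lam + ∑ j, christoffelTrace G j x * affField lam a x j := by
  rw [divg_eq]
  simp [pd_affField]

lemma ginner_raise {G : CoordMetric} {x : E4} (hG : (G x).PosDef) (ζ : Fin 4 → ℝ) (v : E4) :
    ginner G x (WithLp.toLp 2 fun i => ∑ j, (G x)⁻¹ i j * ζ j) v = ∑ j, ζ j * v j := by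
  rw [ginner_comm hG, ginner]
  refine Finset.sum_congr rfl fun i _ => ?_
  have h1 : ∑ j, G x i j * ∑ k, (G x)⁻¹ j k * ζ k = ζ i := by
    simp only [Finset.mul_sum, ← mul_assoc]
    rw [Finset.sum_comm]
    simp [← Finset.sum_mul, sum_mul_inv hG]
  rw [← h1, Finset.sum_mul]
  exact Finset.sum_congr rfl fun j _ => by ring

/-- The field `w ∇Δu - Δu ∇w + (Δu)² X / 2`, where `w = Xu`. -/
def biharmField (G : CoordMetric) (lam : ℝ) (a : E4) (u : E4 → ℝ) (y : E4) : E4 :=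
  affDeriv lam a u y • grad G (lap G u) y - lap G u y • grad G (affDeriv lam a u) y
    + (1 / 2 * lap G u y ^ 2) • affField lam a y

/-- The field `w |∇u|² ∇u - |∇u|⁴ X / 4`, where `w = Xu`. -/
def quarticField (G : CoordMetric) (lam : ℝ) (a : E4) (u : E4 → ℝ) (y : E4) : E4 :=
  affDeriv lam a u y • (gradNorm G u y ^ 2 • grad G u y)
    - (1 / 4 * (gradNorm G u y ^ 2) ^ 2) • affField lam a y

/-- The field `w (∇|∇u|² - 2 Δu ∇u) + |∇u|² (Δu X - lam ∇u - ∇²u[X])`, where `w = Xu`; the last two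
terms are written as `-∇w` plus `hessDefect`. -/
def cubicField (G : CoordMetric) (lam : ℝ) (a : E4) (u : E4 → ℝ) (y : E4) : E4 :=
  affDeriv lam a u y • (grad G (fun z => gradNorm G u z ^ 2) y
      - (2 : ℝ) • (lap G u y • grad G u y))
    + gradNorm G u y ^ 2 • (lap G u y • affField lam a y - grad G (affDeriv lam a u) y
      + hessDefect G lam a u y)

namespace IsRiemannianOn

variable {G : CoordMetric} {V : Set E4} {x : E4} {u : E4 → ℝ} {lam : ℝ} {a : E4}

/-- The commutation rule for `Δ` and the derivative along an affine field, with its defect. -/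
lemma lap_affDeriv (H : IsRiemannianOn G V) (hx : x ∈ V) (hu : ContDiffAt ℝ 3 u x) :
    lap G (affDeriv lam a u) x = fderiv ℝ (lap G u) x (affField lam a x) + 2 * lam * lap G u x
      + lapDefect G lam a u x := by
  have hu2 : ContDiffAt ℝ 2 u x := hu.of_le (by norm_num)
  have hA : ∀ i j, DifferentiableAt ℝ (fun y => (G y)⁻¹ i j) x := fun i j =>
    (H.contDiffAt_inv hx i j).differentiableAt (by simp)
  have hb : ∀ j, DifferentiableAt ℝ (lapDrift G j) x := fun j =>
    (H.contDiffAt_lapDrift hx j).differentiableAt (by simp)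
  have h1 : ∀ k, ContDiffAt ℝ 2 (pd k u) x := fun k => contDiffAt_pd hu (by norm_num) k
  have h1d : ∀ k, DifferentiableAt ℝ (pd k u) x := fun k => (h1 k).differentiableAt two_ne_zero
  have h2 : ∀ i j, DifferentiableAt ℝ (pd i (pd j u)) x := fun i j =>
    (contDiffAt_pd (m := 1) (h1 j) (by norm_num) i).differentiableAt one_ne_zero
  have h3 : ∀ i j k, pd k (pd i (pd j u)) x = pd i (pd j (pd k u)) x := by
    intro i j k
    rw [pd_pd_comm (h1 j) k i]
    refine pd_congr ?_ i
    filter_upwards [hu2.eventually (by simp)] with y hy using pd_pd_comm hy k j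
  have hF : ∀ k, pd k (lap G u) x
      = ∑ i, ∑ j, (pd k (fun y => (G y)⁻¹ i j) x * pd i (pd j u) x
          + (G x)⁻¹ i j * pd i (pd j (pd k u)) x)
        + ∑ j, (pd k (lapDrift G j) x * pd j u x + lapDrift G j x * pd k (pd j u) x) := by
    intro k
    rw [pd_congr (H.eventually_lap_eq hx hu2), pd_add, pd_sum, pd_sum]
    · congr 1
      · refine Finset.sum_congr rfl fun i _ => ?_
        rw [pd_sum fun j _ => (hA i j).fun_mul (h2 i j)]
        exact Finset.sum_congr rfl fun j _ => by rw [pd_mul (hA i j) (h2 i j) k, h3]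
      · exact Finset.sum_congr rfl fun j _ => pd_mul (hb j) (h1d j) k
    · exact fun j _ => (hb j).fun_mul (h1d j)
    · exact fun i _ => DifferentiableAt.fun_sum fun j _ => (hA i j).fun_mul (h2 i j)
    · exact DifferentiableAt.fun_sum fun i _ =>
        DifferentiableAt.fun_sum fun j _ => (hA i j).fun_mul (h2 i j)
    · exact DifferentiableAt.fun_sum fun j _ => (hb j).fun_mul (h1d j)
  have hw : ContDiffAt ℝ 2 (affDeriv lam a u) x := contDiffAt_affDeriv hu (by norm_num)
  rw [H.lap_eq hx hw, fderiv_eq_sum_pd, H.lap_eq hx hu2, lapDefect]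
  simp only [hF, pd_pd_affDeriv hu, pd_affDeriv hu2]
  have hsymm : ∀ j k, pd j (pd k u) x = pd k (pd j u) x := fun j k => pd_pd_comm hu2 j k
  simp only [Fin.sum_univ_four]
  rw [hsymm 1 0, hsymm 2 0, hsymm 3 0, hsymm 2 1, hsymm 3 1, hsymm 3 2]
  ring

lemma pd_gradNorm_sq (H : IsRiemannianOn G V) (hx : x ∈ V) (hu : ContDiffAt ℝ 2 u x) (k : Fin 4) :
    pd k (fun y => gradNorm G u y ^ 2) x
      = ∑ i, ∑ j, pd k (fun y => (G y)⁻¹ i j) x * pd i u x * pd j u x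
        + 2 * ∑ i, ∑ j, (G x)⁻¹ i j * pd i u x * pd k (pd j u) x := by
  have hA : ∀ i j, DifferentiableAt ℝ (fun y => (G y)⁻¹ i j) x := fun i j =>
    (H.contDiffAt_inv hx i j).differentiableAt (by simp)
  have h1d : ∀ k, DifferentiableAt ℝ (pd k u) x := fun k =>
    (contDiffAt_pd (m := 1) hu (by norm_num) k).differentiableAt one_ne_zero
  have hsw : ∑ i, ∑ j, (G x)⁻¹ i j * pd k (pd i u) x * pd j u x
      = ∑ i, ∑ j, (G x)⁻¹ i j * pd i u x * pd k (pd j u) x := by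
    rw [Finset.sum_comm]
    exact Finset.sum_congr rfl fun i _ => Finset.sum_congr rfl fun j _ => by
      rw [inv_apply_comm (H.posDef x hx) j i]; ring
  rw [pd_congr (H.eventually_gradNorm_sq hx u), pd_sum, two_mul]
  · nth_rewrite 1 [← hsw]
    simp only [← Finset.sum_add_distrib]
    refine Finset.sum_congr rfl fun i _ => ?_
    rw [pd_sum fun j _ => ((hA i j).fun_mul (h1d i)).fun_mul (h1d j)]
    refine Finset.sum_congr rfl fun j _ => ?_
    rw [pd_mul ((hA i j).fun_mul (h1d i)) (h1d j), pd_mul (hA i j) (h1d i)]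
    ring
  · exact fun i _ => DifferentiableAt.fun_sum fun j _ =>
      ((hA i j).fun_mul (h1d i)).fun_mul (h1d j)

/-- `⟨∇u, ∇(Xu)⟩` for the affine field `X`, with the defect due to the derivatives of `g^{ij}`. -/
lemma gradInner_affDeriv (H : IsRiemannianOn G V) (hx : x ∈ V) (hu : ContDiffAt ℝ 2 u x) :
    gradInner G u (affDeriv lam a u) x = lam * gradNorm G u x ^ 2
      + 1 / 2 * fderiv ℝ (fun y => gradNorm G u y ^ 2) x (affField lam a x)
      + gradDefect G lam a u x := by
  have hS := H.pd_gradNorm_sq hx hu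
  have hlin : gradInner G u (affDeriv lam a u) x
      = lam * (∑ i, ∑ j, (G x)⁻¹ i j * pd i u x * pd j u x)
        + ∑ k, affField lam a x k * ∑ i, ∑ j, (G x)⁻¹ i j * pd i u x * pd k (pd j u) x := by
    have hsymm : ∀ j k, pd j (pd k u) x = pd k (pd j u) x := fun j k => pd_pd_comm hu j k
    simp only [gradInner, pd_affDeriv hu, mul_add, Finset.sum_add_distrib, Finset.mul_sum]
    congr 1
    · exact Finset.sum_congr rfl fun i _ => Finset.sum_congr rfl fun j _ => by ring
    · rw [Finset.sum_comm' (t' := Finset.univ) (s' := fun _ => Finset.univ) (by simp)]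
      rw [Finset.sum_comm]
      conv_rhs => rw [Finset.sum_comm]
      refine Finset.sum_congr rfl fun i _ => ?_
      rw [Finset.sum_comm]
      refine Finset.sum_congr rfl fun k _ => Finset.sum_congr rfl fun j _ => ?_
      rw [hsymm j k]
      ring
  rw [hlin, gradNorm_sq (H.posDef x hx), fderiv_eq_sum_pd, gradDefect]
  have hsum : ∀ c : Fin 4 → ℝ, ∑ k, (c k + 2 * ∑ i, ∑ j, (G x)⁻¹ i j * pd i u x * pd k (pd j u) x)
      * affField lam a x k = ∑ k, affField lam a x k * c k + 2 * ∑ k, affField lam a x k *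
        ∑ i, ∑ j, (G x)⁻¹ i j * pd i u x * pd k (pd j u) x := by
    intro c
    rw [Finset.mul_sum, ← Finset.sum_add_distrib]
    exact Finset.sum_congr rfl fun k _ => by ring
  simp only [hS]
  rw [hsum]
  ring

/-- `∇²u[X, v]` in terms of the differential of `Xu`. -/
lemma hessForm_affField (H : IsRiemannianOn G V) (hx : x ∈ V) (hu : ContDiffAt ℝ 2 u x) (v : E4) :
    hessForm G u x (affField lam a x) v = fderiv ℝ (affDeriv lam a u) x v
      - lam * fderiv ℝ u x v - ginner G x (hessDefect G lam a u x) v := by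
  have hZ : hessDefect G lam a u x = WithLp.toLp 2 fun i => ∑ j, (G x)⁻¹ i j *
      ∑ k, (∑ i, christoffel G k i j x * affField lam a x i) * pd k u x := by
    ext j
    simp only [hessDefect, hessDefectCoeff, Finset.mul_sum, Finset.sum_mul]
    rw [Finset.sum_comm]
    simp only [mul_assoc]
  rw [hZ, ginner_raise (H.posDef x hx), fderiv_eq_sum_pd, fderiv_eq_sum_pd, hessForm,
    Finset.sum_comm, Finset.mul_sum, ← Finset.sum_sub_distrib, ← Finset.sum_sub_distrib]
  refine Finset.sum_congr rfl fun j _ => ?_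
  have hsymm : ∀ k, pd j (pd k u) x = pd k (pd j u) x := fun k => pd_pd_comm hu j k
  simp only [hess, pd_affDeriv hu, hsymm, Fin.sum_univ_four]
  ring

section Regularity

lemma contDiffAt_hessDefectCoeff (H : IsRiemannianOn G V) (hx : x ∈ V) (j k : Fin 4) :
    ContDiffAt ℝ ∞ (hessDefectCoeff G lam a j k) x := by
  refine ContDiffAt.sum fun l _ => (H.contDiffAt_inv hx j l).mul (ContDiffAt.sum fun i _ =>
    (H.contDiffAt_christoffel hx k i l).mul ?_)
  have := contDiff_affField lam a (n := ∞)
  have h2 : ContDiff ℝ ∞ fun y => affField lam a y i := by fun_prop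
  exact h2.contDiffAt

lemma contDiffAt_hessDefect (H : IsRiemannianOn G V) (hx : x ∈ V) (hu : ContDiffAt ℝ 2 u x) :
    ContDiffAt ℝ 1 (hessDefect G lam a u) x := by
  rw [contDiffAt_euclidean]
  intro j
  change ContDiffAt ℝ 1 (fun x => ∑ k, hessDefectCoeff G lam a j k x * pd k u x) x
  exact ContDiffAt.sum fun k _ => ((H.contDiffAt_hessDefectCoeff hx j k).of_le (by simp)).mul
    (contDiffAt_pd hu (by norm_num) k)

variable (H : IsRiemannianOn G V) (hx : x ∈ V) (hu : ContDiffAt ℝ 4 u x)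
include H hx hu

lemma contDiffAt_lap_two : ContDiffAt ℝ 2 (lap G u) x :=
  H.contDiffAt_lap hx (n := 4) (k := 3) (m := 2) hu (by norm_num) (by norm_num)

lemma contDiffAt_grad_lap : ContDiffAt ℝ 1 (grad G (lap G u)) x :=
  H.contDiffAt_grad hx (n := 2) (m := 1) (H.contDiffAt_lap_two hx hu) (by norm_num)

lemma contDiffAt_gradNorm_sq_three : ContDiffAt ℝ 3 (fun y => gradNorm G u y ^ 2) x :=
  H.contDiffAt_gradNorm_sq hx (n := 4) (m := 3) hu (by norm_num)

lemma contDiffAt_grad_gradNorm_sq : ContDiffAt ℝ 1 (grad G fun y => gradNorm G u y ^ 2) x :=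
  H.contDiffAt_grad hx (n := 3) (m := 1) (H.contDiffAt_gradNorm_sq_three hx hu) (by norm_num)

lemma contDiffAt_grad_affDeriv : ContDiffAt ℝ 1 (grad G (affDeriv lam a u)) x :=
  H.contDiffAt_grad hx (n := 3) (m := 1) (contDiffAt_affDeriv hu (by norm_num)) (by norm_num)

lemma contDiffAt_grad_one : ContDiffAt ℝ 1 (grad G u) x :=
  H.contDiffAt_grad hx (n := 4) (m := 1) hu (by norm_num)

lemma contDiffAt_biharmField : ContDiffAt ℝ 1 (biharmField G lam a u) x := by
  have hF := (H.contDiffAt_lap_two hx hu).of_le (m := 1) (by norm_num)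
  have hw : ContDiffAt ℝ 1 (affDeriv lam a u) x := contDiffAt_affDeriv hu (by norm_num)
  exact ((hw.smul (H.contDiffAt_grad_lap hx hu)).sub
    (hF.smul (H.contDiffAt_grad_affDeriv hx hu))).add
    ((contDiffAt_const.mul (hF.pow 2)).smul (contDiff_affField lam a).contDiffAt)

lemma contDiffAt_quarticField : ContDiffAt ℝ 1 (quarticField G lam a u) x := by
  have hS := (H.contDiffAt_gradNorm_sq_three hx hu).of_le (m := 1) (by norm_num)
  have hw : ContDiffAt ℝ 1 (affDeriv lam a u) x := contDiffAt_affDeriv hu (by norm_num)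
  exact (hw.smul (hS.smul (H.contDiffAt_grad_one hx hu))).sub
    ((contDiffAt_const.mul (hS.pow 2)).smul (contDiff_affField lam a).contDiffAt)

lemma contDiffAt_cubicField : ContDiffAt ℝ 1 (cubicField G lam a u) x := by
  have hF := (H.contDiffAt_lap_two hx hu).of_le (m := 1) (by norm_num)
  have hS := (H.contDiffAt_gradNorm_sq_three hx hu).of_le (m := 1) (by norm_num)
  have hw : ContDiffAt ℝ 1 (affDeriv lam a u) x := contDiffAt_affDeriv hu (by norm_num)
  have hX : ContDiffAt ℝ 1 (affField lam a) x := (contDiff_affField lam a).contDiffAt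
  have h1 := H.contDiffAt_grad_gradNorm_sq hx hu
  have h2 := H.contDiffAt_grad_one hx hu
  have h3 := H.contDiffAt_grad_affDeriv (lam := lam) (a := a) hx hu
  have h4 := H.contDiffAt_hessDefect (lam := lam) (a := a) hx (hu.of_le (by norm_num))
  have h5 : ContDiffAt ℝ 1 (fun y => (2 : ℝ) • (lap G u y • grad G u y)) x :=
    contDiffAt_const.fun_smul (hF.fun_smul h2)
  have h6 : ContDiffAt ℝ 1 (fun y => lap G u y • affField lam a y
      - grad G (affDeriv lam a u) y + hessDefect G lam a u y) x := ((hF.smul hX).sub h3).add h4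
  exact (hw.smul (h1.sub h5)).add (hS.smul h6)

lemma divg_biharmField : divg G (biharmField G lam a u) x
    = affDeriv lam a u x * lap G (lap G u) x
      - lap G u x * lapDefect G lam a u x
      + 1 / 2 * lap G u x ^ 2 * ∑ j, christoffelTrace G j x * affField lam a x j := by
  have hF := (H.contDiffAt_lap_two hx hu).differentiableAt two_ne_zero
  have hw : DifferentiableAt ℝ (affDeriv lam a u) x :=
    (contDiffAt_affDeriv (m := 1) hu (by norm_num)).differentiableAt one_ne_zero
  have h1 := (H.contDiffAt_grad_lap hx hu).differentiableAt one_ne_zero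
  have h2 := (H.contDiffAt_grad_affDeriv (lam := lam) (a := a) hx hu).differentiableAt one_ne_zero
  have h3 := (contDiff_affField lam a (n := 1)).differentiable one_ne_zero x
  have h4 : DifferentiableAt ℝ (fun y => 1 / 2 * lap G u y ^ 2) x := (hF.pow 2).const_mul _
  have h5 : fderiv ℝ (fun y => 1 / 2 * lap G u y ^ 2) x (affField lam a x)
      = lap G u x * fderiv ℝ (lap G u) x (affField lam a x) := by
    have h6 := ((hF.hasFDerivAt.pow 2).const_mul (1 / 2)).fderiv
    rw [h6]
    simp
    ring
  unfold biharmField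
  rw [divg_add ((hw.fun_smul h1).fun_sub (hF.fun_smul h2)) (h4.fun_smul h3),
    divg_sub (hw.fun_smul h1) (hF.fun_smul h2), divg_smul hw h1, divg_smul hF h2, divg_smul h4 h3,
    h5, fderiv_grad, fderiv_grad, gradInner_comm (H.posDef x hx) (lap G u), divg_affField]
  have h8 := H.lap_affDeriv (lam := lam) (a := a) hx (hu.of_le (by norm_num))
  have h9 : divg G (grad G (affDeriv lam a u)) x = lap G (affDeriv lam a u) x := rfl
  have h10 : divg G (grad G (lap G u)) x = lap G (lap G u) x := rfl
  rw [h9, h10, h8]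
  ring

lemma divg_quarticField : divg G (quarticField G lam a u) x
    = affDeriv lam a u x * divg G (fun y => gradNorm G u y ^ 2 • grad G u y) x
      + gradNorm G u x ^ 2 * gradDefect G lam a u x
      - 1 / 4 * (gradNorm G u x ^ 2) ^ 2
        * ∑ j, christoffelTrace G j x * affField lam a x j := by
  have hS := (H.contDiffAt_gradNorm_sq_three hx hu).differentiableAt (by norm_num)
  have hw : DifferentiableAt ℝ (affDeriv lam a u) x :=
    (contDiffAt_affDeriv (m := 1) hu (by norm_num)).differentiableAt one_ne_zero
  have h1 := (H.contDiffAt_grad_one hx hu).differentiableAt one_ne_zero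
  have h3 := (contDiff_affField lam a (n := 1)).differentiable one_ne_zero x
  have h4 : DifferentiableAt ℝ (fun y => 1 / 4 * (gradNorm G u y ^ 2) ^ 2) x :=
    (hS.pow 2).const_mul _
  have h5 : fderiv ℝ (fun y => 1 / 4 * (gradNorm G u y ^ 2) ^ 2) x (affField lam a x)
      = 1 / 2 * gradNorm G u x ^ 2
        * fderiv ℝ (fun y => gradNorm G u y ^ 2) x (affField lam a x) := by
    have h6 := ((hS.hasFDerivAt.pow 2).const_mul (1 / 4)).fderiv
    rw [h6]
    simp
    ring
  unfold quarticField
  rw [divg_sub (hw.fun_smul (hS.fun_smul h1)) (h4.fun_smul h3), divg_smul hw (hS.fun_smul h1),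
    divg_smul h4 h3, h5, map_smul, fderiv_grad, gradInner_comm (H.posDef x hx) (affDeriv lam a u),
    H.gradInner_affDeriv hx (hu.of_le (by norm_num)), divg_affField, smul_eq_mul]
  ring

lemma divg_cubicField : divg G (cubicField G lam a u) x
    = affDeriv lam a u x * (lap G (fun y => gradNorm G u y ^ 2) x
        - 2 * divg G (fun y => lap G u y • grad G u y) x)
      + gradNorm G u x ^ 2 * lap G u x * (∑ j, christoffelTrace G j x * affField lam a x j)
      - gradNorm G u x ^ 2 * lapDefect G lam a u x
      - 2 * lap G u x * gradDefect G lam a u x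
      + gradNorm G u x ^ 2 * divg G (hessDefect G lam a u) x
      + fderiv ℝ (fun y => gradNorm G u y ^ 2) x (hessDefect G lam a u x) := by
  have hF := (H.contDiffAt_lap_two hx hu).differentiableAt two_ne_zero
  have hS := (H.contDiffAt_gradNorm_sq_three hx hu).differentiableAt (by norm_num)
  have hw : DifferentiableAt ℝ (affDeriv lam a u) x :=
    (contDiffAt_affDeriv (m := 1) hu (by norm_num)).differentiableAt one_ne_zero
  have h1 := (H.contDiffAt_grad_one hx hu).differentiableAt one_ne_zero
  have h2 := (H.contDiffAt_grad_affDeriv (lam := lam) (a := a) hx hu).differentiableAt one_ne_zero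
  have h3 := (contDiff_affField lam a (n := 1)).differentiable one_ne_zero x
  have h4 := (H.contDiffAt_grad_gradNorm_sq hx hu).differentiableAt one_ne_zero
  have h5 := (H.contDiffAt_hessDefect (lam := lam) (a := a) hx
    (hu.of_le (by norm_num))).differentiableAt one_ne_zero
  have h6 : DifferentiableAt ℝ (fun y => lap G u y • grad G u y) x := hF.fun_smul h1
  have h7 : DifferentiableAt ℝ (fun y => (2 : ℝ) • (lap G u y • grad G u y)) x :=
    h6.fun_const_smul (2 : ℝ)
  have h8 : DifferentiableAt ℝ (fun y => lap G u y • affField lam a y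
      - grad G (affDeriv lam a u) y + hessDefect G lam a u y) x :=
    ((hF.fun_smul h3).fun_sub h2).fun_add h5
  unfold cubicField
  rw [divg_add (hw.fun_smul (h4.fun_sub h7)) (hS.fun_smul h8), divg_smul hw (h4.fun_sub h7),
    divg_smul hS h8, divg_sub h4 h7, divg_const_smul _ h6,
    divg_add ((hF.fun_smul h3).fun_sub h2) h5, divg_sub (hF.fun_smul h3) h2, divg_smul hF h3,
    divg_affField]
  have h9 : divg G (grad G (affDeriv lam a u)) x = lap G (affDeriv lam a u) x := rfl
  have h10 : divg G (grad G fun z => gradNorm G u z ^ 2) x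
    = lap G (fun z => gradNorm G u z ^ 2) x := rfl
  rw [h9, h10, H.lap_affDeriv hx (hu.of_le (by norm_num))]
  simp only [map_sub, map_add, map_smul, fderiv_grad, smul_eq_mul]
  rw [gradInner_comm (H.posDef x hx) (affDeriv lam a u) u,
    H.gradInner_affDeriv hx (hu.of_le (by norm_num)),
    gradInner_comm (H.posDef x hx) (affDeriv lam a u) fun y => gradNorm G u y ^ 2]
  ring

end Regularity

end IsRiemannianOn

/-- The remainder in the Pohozaev identity for the affine field `X`. It contains no derivatives of `u`
of order higher than two. -/
def pohozaevDefect (G : CoordMetric) (γ₂ γ₃ lam : ℝ) (a : E4) (u : E4 → ℝ) (x : E4) : ℝ :=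
  let δ := ∑ j, christoffelTrace G j x * affField lam a x j
  let F := lap G u x
  let S := gradNorm G u x ^ 2
  (γ₂ / 2 + 6 * γ₃) * (1 / 2 * F ^ 2 * δ - F * lapDefect G lam a u x)
    - 12 * γ₃ * (S * gradDefect G lam a u x - 1 / 4 * S ^ 2 * δ)
    + 6 * γ₃ * (S * F * δ - S * lapDefect G lam a u x - 2 * F * gradDefect G lam a u x
      + S * divg G (hessDefect G lam a u) x
      + fderiv ℝ (fun y => gradNorm G u y ^ 2) x (hessDefect G lam a u x))
    + affDeriv lam a u x * (γ₂ / 2 * divg G (fun y => ((2 / 3 : ℝ) * scalarCurv G y) • grad G u y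
        - (2 : ℝ) • ricGrad G u y) x
      - 2 * γ₃ * divg G (fun y => scalarCurv G y • grad G u y) x)

namespace IsRiemannianOn

variable {G : CoordMetric} {V : Set E4} {x : E4} {u : E4 → ℝ} {lam : ℝ} {a : E4}

lemma lap_add (H : IsRiemannianOn G V) (hx : x ∈ V) {f g : E4 → ℝ} (hf : ContDiffAt ℝ 2 f x)
    (hg : ContDiffAt ℝ 2 g x) : lap G (fun y => f y + g y) x = lap G f x + lap G g x := by
  have hev : ∀ {h : E4 → ℝ}, ContDiffAt ℝ 2 h x → ∀ᶠ y in 𝓝 x, DifferentiableAt ℝ h y :=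
    fun hh => by
      filter_upwards [hh.eventually (by simp)] with y hy using hy.differentiableAt two_ne_zero
  have hpd : ∀ j, pd j (fun y => f y + g y) =ᶠ[𝓝 x] fun y => pd j f y + pd j g y := fun j => by
    filter_upwards [hev hf, hev hg] with y h1 h2 using pd_add h1 h2 j
  have hd : ∀ {h : E4 → ℝ}, ContDiffAt ℝ 2 h x → ∀ j, DifferentiableAt ℝ (pd j h) x :=
    fun hh j => (contDiffAt_pd (m := 1) hh (by norm_num) j).differentiableAt one_ne_zero
  have h2 : ∀ i j, pd i (pd j fun y => f y + g y) x = pd i (pd j f) x + pd i (pd j g) x :=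
    fun i j => by rw [pd_congr (hpd j), pd_add (hd hf j) (hd hg j)]
  rw [H.lap_eq hx (hf.add hg), H.lap_eq hx hf, H.lap_eq hx hg]
  simp only [h2, (hpd _).self_of_nhds, mul_add, Finset.sum_add_distrib]
  ring

/-- The pointwise Pohozaev identity: up to lower order terms, the product of `Xu` with the operator
is a divergence. -/
lemma pohozaev_identity (H : IsRiemannianOn G V) (hx : x ∈ V) (hu : ContDiffAt ℝ 4 u x)
    (γ₂ γ₃ : ℝ) :
    (γ₂ / 2 + 6 * γ₃) * divg G (biharmField G lam a u) x
      - 12 * γ₃ * divg G (quarticField G lam a u) x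
      + 6 * γ₃ * divg G (cubicField G lam a u) x
    = affDeriv lam a u x * logDetOp G γ₂ γ₃ u x + pohozaevDefect G γ₂ γ₃ lam a u x := by
  have hF2 := H.contDiffAt_lap_two hx hu
  have hS3 := H.contDiffAt_gradNorm_sq_three hx hu
  have hF := hF2.differentiableAt two_ne_zero
  have hS := hS3.differentiableAt (by norm_num)
  have h1 := (H.contDiffAt_grad_one hx hu).differentiableAt one_ne_zero
  have e1 := H.lap_add hx hF2 (hS3.of_le (by norm_num))
  have e2 : divg G (fun y => (lap G u y + gradNorm G u y ^ 2) • grad G u y) x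
      = divg G (fun y => lap G u y • grad G u y) x
        + divg G (fun y => gradNorm G u y ^ 2 • grad G u y) x := by
    simp only [add_smul]
    exact divg_add (hF.fun_smul h1) (hS.fun_smul h1)
  rw [H.divg_biharmField hx hu, H.divg_quarticField hx hu, H.divg_cubicField hx hu, logDetOp,
    paneitz, e1, e2, pohozaevDefect]
  ring

end IsRiemannianOn

/-! ### The boundary integrands -/

section Boundary

variable {G : CoordMetric} {x : E4} {u : E4 → ℝ} {lam : ℝ} {a : E4}

lemma ginner_biharmField (hG : (G x).PosDef) (ν : E4) :
    ginner G x (biharmField G lam a u x) ν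
      = affDeriv lam a u x * fderiv ℝ (lap G u) x ν
        - lap G u x * fderiv ℝ (affDeriv lam a u) x ν
        + 1 / 2 * lap G u x ^ 2 * ginner G x (affField lam a x) ν := by
  rw [biharmField, ginner_add_left, ginner_sub_left, ginner_smul_left, ginner_smul_left,
    ginner_smul_left, ginner_comm hG (grad G _ x), ginner_comm hG (grad G _ x),
    ginner_grad_right hG, ginner_grad_right hG]

lemma ginner_quarticField (hG : (G x).PosDef) (ν : E4) :
    ginner G x (quarticField G lam a u x) ν
      = gradNorm G u x ^ 2 * fderiv ℝ u x ν * affDeriv lam a u x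
        - 1 / 4 * gradNorm G u x ^ 4 * ginner G x (affField lam a x) ν := by
  rw [quarticField, ginner_sub_left, ginner_smul_left, ginner_smul_left, ginner_smul_left,
    ginner_comm hG (grad G _ x), ginner_grad_right hG]
  ring

lemma IsRiemannianOn.ginner_cubicField {V : Set E4} (H : IsRiemannianOn G V) (hx : x ∈ V)
    (hu : ContDiffAt ℝ 2 u x) (ν : E4) :
    ginner G x (cubicField G lam a u x) ν
      = affDeriv lam a u x * (fderiv ℝ (fun y => gradNorm G u y ^ 2) x ν
          - 2 * lap G u x * fderiv ℝ u x ν)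
        + gradNorm G u x ^ 2 * (ginner G x (affField lam a x) ν * lap G u x
          - lam * fderiv ℝ u x ν - hessForm G u x (affField lam a x) ν) := by
  have hG := H.posDef x hx
  rw [cubicField, H.hessForm_affField hx hu]
  simp only [ginner_add_left, ginner_sub_left, ginner_smul_left]
  rw [ginner_comm hG (grad G _ x), ginner_comm hG (grad G _ x), ginner_comm hG (grad G _ x),
    ginner_grad_right hG, ginner_grad_right hG, ginner_grad_right hG]
  ring

end Boundary

/-! ### Components are controlled by the Riemannian norms -/

section Norms

variable {M : Matrix (Fin 4) (Fin 4) ℝ}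

open scoped MatrixOrder in
/-- Factorization `M = Bᵀ B` of a positive definite matrix, with `C = B⁻¹`. -/
lemma exists_factorization (hM : M.PosDef) :
    ∃ B C : Matrix (Fin 4) (Fin 4) ℝ, M = B.transpose * B ∧ M⁻¹ = C * C.transpose ∧ C * B = 1 := by
  obtain ⟨B, hB⟩ := CStarAlgebra.nonneg_iff_eq_star_mul_self.mp hM.posSemidef.nonneg
  rw [Matrix.star_eq_conjTranspose, Matrix.conjTranspose_eq_transpose_of_trivial] at hB
  have hdet : IsUnit B.det := by
    have := hM.det_pos.ne'
    rw [hB, Matrix.det_mul] at this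
    exact (right_ne_zero_of_mul this).isUnit
  refine ⟨B, B⁻¹, hB, ?_, Matrix.nonsing_inv_mul _ hdet⟩
  rw [hB, Matrix.mul_inv_rev, Matrix.transpose_nonsing_inv]

/-- The Cauchy-Schwarz inequality for a component of a covector. -/
lemma sq_le_mul_sum_inv (hM : M.PosDef) (ξ : Fin 4 → ℝ) (i : Fin 4) :
    ξ i ^ 2 ≤ M i i * ∑ j, ∑ k, M⁻¹ j k * ξ j * ξ k := by
  obtain ⟨B, C, hB, hC, hCB⟩ := exists_factorization hM
  set η := Matrix.mulVec C.transpose ξ with hη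
  have hQ : ∑ j, ∑ k, M⁻¹ j k * ξ j * ξ k = ∑ a, η a ^ 2 := by
    rw [sum_sum_eq_dotProduct, hC, ← Matrix.mulVec_mulVec, Matrix.dotProduct_mulVec,
      ← Matrix.mulVec_transpose]
    simp only [dotProduct, hη, sq]
  have hξ : ξ i = ∑ a, B a i * η a := by
    have : ξ = Matrix.mulVec B.transpose η := by
      rw [hη, Matrix.mulVec_mulVec, ← Matrix.transpose_mul, hCB, Matrix.transpose_one,
        Matrix.one_mulVec]
    conv_lhs => rw [this]
    simp [Matrix.mulVec, dotProduct]
  have hMii : M i i = ∑ a, B a i ^ 2 := by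
    simp only [hB, Matrix.mul_apply, Matrix.transpose_apply, sq]
  rw [hQ, hξ, hMii]
  exact Finset.sum_mul_sq_le_sq_mul_sq _ _ _

lemma sum_four_eq_trace (hM : M.PosDef) (h : Matrix (Fin 4) (Fin 4) ℝ) :
    ∑ i, ∑ j, ∑ k, ∑ l, M⁻¹ i k * M⁻¹ j l * h i j * h k l
      = (M⁻¹ * h * M⁻¹ * h.transpose).trace := by
  simp only [Matrix.trace, Matrix.diag_apply, Matrix.mul_apply, Matrix.transpose_apply,
    Finset.sum_mul]
  refine Finset.sum_congr rfl fun i _ => Finset.sum_congr rfl fun j _ => ?_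
  rw [Finset.sum_comm]
  exact Finset.sum_congr rfl fun l _ => Finset.sum_congr rfl fun k _ => by
    rw [inv_apply_comm hM j l]; ring

/-- The Cauchy-Schwarz inequality for a component of a bilinear form, in the norm induced by `M`. -/
lemma sq_le_mul_sum_inv_inv (hM : M.PosDef) (h : Matrix (Fin 4) (Fin 4) ℝ) (i j : Fin 4) :
    0 ≤ ∑ i, ∑ j, ∑ k, ∑ l, M⁻¹ i k * M⁻¹ j l * h i j * h k l ∧
    h i j ^ 2 ≤ M i i * M j j * ∑ i, ∑ j, ∑ k, ∑ l, M⁻¹ i k * M⁻¹ j l * h i j * h k l := by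
  obtain ⟨B, C, hB, hC, hCB⟩ := exists_factorization hM
  set N := C.transpose * h * C with hN
  have hQ : ∑ i, ∑ j, ∑ k, ∑ l, M⁻¹ i k * M⁻¹ j l * h i j * h k l = ∑ a, ∑ b, N a b ^ 2 := by
    rw [sum_four_eq_trace hM, hC]
    have : C * C.transpose * h * (C * C.transpose) * h.transpose
        = C * (C.transpose * h * C * C.transpose * h.transpose) := by
      simp only [Matrix.mul_assoc]
    rw [this, Matrix.trace_mul_comm]
    have h2 : C.transpose * h * C * C.transpose * h.transpose * C = N * N.transpose := by
      rw [hN]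
      simp only [Matrix.transpose_mul, Matrix.transpose_transpose, Matrix.mul_assoc]
    rw [h2]
    simp only [Matrix.trace, Matrix.diag_apply, Matrix.mul_apply, Matrix.transpose_apply, sq]
  have hh : h i j = ∑ p : Fin 4 × Fin 4, (B p.1 i * B p.2 j) * N p.1 p.2 := by
    have hBC : B.transpose * C.transpose = 1 := by
      rw [← Matrix.transpose_mul, hCB, Matrix.transpose_one]
    have : h = B.transpose * N * B := by
      have e : B.transpose * N * B = (B.transpose * C.transpose) * h * (C * B) := by
        rw [hN]; simp only [Matrix.mul_assoc]
      rw [e, hBC, hCB, Matrix.one_mul, Matrix.mul_one]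
    conv_lhs => rw [this]
    simp only [Matrix.mul_apply, Matrix.transpose_apply, Finset.sum_mul, Fintype.sum_prod_type]
    rw [Finset.sum_comm]
    exact Finset.sum_congr rfl fun a _ => Finset.sum_congr rfl fun b _ => by ring
  have hMd : ∀ i, M i i = ∑ a, B a i ^ 2 := fun i => by
    simp only [hB, Matrix.mul_apply, Matrix.transpose_apply, sq]
  rw [hQ]
  refine ⟨Finset.sum_nonneg fun a _ => Finset.sum_nonneg fun b _ => sq_nonneg _, ?_⟩
  have e1 : ∑ a, ∑ b, N a b ^ 2 = ∑ p : Fin 4 × Fin 4, N p.1 p.2 ^ 2 := by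
    rw [Fintype.sum_prod_type]
  have e2 : M i i * M j j = ∑ p : Fin 4 × Fin 4, (B p.1 i * B p.2 j) ^ 2 := by
    rw [hMd, hMd, Finset.sum_mul_sum, Fintype.sum_prod_type]
    exact Finset.sum_congr rfl fun a _ => Finset.sum_congr rfl fun b _ => by ring
  rw [hh, e1, e2]
  exact Finset.sum_mul_sq_le_sq_mul_sq _ _ _

lemma abs_pd_le {G : CoordMetric} {x : E4} (hG : (G x).PosDef) (u : E4 → ℝ) (i : Fin 4) :
    |pd i u x| ≤ Real.sqrt (G x i i) * gradNorm G u x := by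
  have h1 := sq_le_mul_sum_inv hG (fun j => pd j u x) i
  rw [gradNorm, ginner_grad_self hG, ← Real.sqrt_mul' _ (sum_inv_nonneg hG _),
    ← Real.sqrt_sq_eq_abs]
  exact Real.sqrt_le_sqrt h1

lemma abs_hess_le {G : CoordMetric} {x : E4} (hG : (G x).PosDef) (u : E4 → ℝ) (i j : Fin 4) :
    |hess G u i j x| ≤ Real.sqrt (G x i i * G x j j) * hessNorm G u x := by
  obtain ⟨h0, h1⟩ := sq_le_mul_sum_inv_inv hG (fun i j => hess G u i j x) i j
  rw [hessNorm, ← Real.sqrt_mul' _ h0, ← Real.sqrt_sq_eq_abs]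
  exact Real.sqrt_le_sqrt h1

end Norms

/-! ### Uniform estimates -/

open Asymptotics

/-- The data on which the constants in the estimates must not depend: a point, a function and the
affine field `y ↦ lam y + a`. -/
structure EstDatum where
  x : E4
  u : E4 → ℝ
  lam : ℝ
  a : E4

/-- The data whose point lies in `K` and whose function is `C⁴` there. Uniform estimates are
formulated as `f =O[𝓟 (admissible K)] g`. -/
def admissible (K : Set E4) : Set EstDatum := {d | d.x ∈ K ∧ ContDiffAt ℝ 4 d.u d.x}

namespace EstDatum

/-- The size `|lam| |x| + |a|` of the affine field. -/
def om (d : EstDatum) : ℝ := |d.lam| * ‖d.x‖ + ‖d.a‖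

/-- The factor `|∇u| + |∇²u| |∇u| + |∇u|³ + |x| (|∇²u|² + |∇u|⁴)` of the error term. -/
def err (G : CoordMetric) (d : EstDatum) : ℝ :=
  gradNorm G d.u d.x + hessNorm G d.u d.x * gradNorm G d.u d.x + gradNorm G d.u d.x ^ 3
    + ‖d.x‖ * (hessNorm G d.u d.x ^ 2 + gradNorm G d.u d.x ^ 4)

/-- The size `|∇²u| + |x| |∇u|` of the second coordinate derivatives. -/
def sec (G : CoordMetric) (d : EstDatum) : ℝ :=
  hessNorm G d.u d.x + ‖d.x‖ * gradNorm G d.u d.x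

end EstDatum

lemma gradNorm_nonneg (G : CoordMetric) (u : E4 → ℝ) (x : E4) : 0 ≤ gradNorm G u x :=
  Real.sqrt_nonneg _

lemma hessNorm_nonneg (G : CoordMetric) (u : E4 → ℝ) (x : E4) : 0 ≤ hessNorm G u x :=
  Real.sqrt_nonneg _

section Scales

variable {K : Set E4} {G : CoordMetric}

lemma isBigO_admissible_of_le {f g : EstDatum → ℝ} (c : ℝ)
    (h : ∀ d ∈ admissible K, |f d| ≤ c * |g d|) : f =O[𝓟 (admissible K)] g :=
  isBigO_principal.2 ⟨c, h⟩

lemma isBigO_admissible_congr {f f' g : EstDatum → ℝ} (hf : f' =O[𝓟 (admissible K)] g)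
    (h : ∀ d ∈ admissible K, f d = f' d) : f =O[𝓟 (admissible K)] g :=
  hf.congr' (eventually_principal.2 fun d hd => (h d hd).symm) EventuallyEq.rfl

lemma isBigO_norm_one (hK : IsCompact K) :
    (fun d : EstDatum => ‖d.x‖) =O[𝓟 (admissible K)] fun _ => (1 : ℝ) := by
  obtain ⟨R, hR⟩ := hK.isBounded.exists_norm_le
  exact isBigO_admissible_of_le R fun d hd => by simpa using hR d.x hd.1

lemma isBigO_coeff_one (hK : IsCompact K) {f : E4 → ℝ} (hf : ContinuousOn f K) :
    (fun d : EstDatum => f d.x) =O[𝓟 (admissible K)] fun _ => (1 : ℝ) := by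
  obtain ⟨R, hR⟩ := hK.exists_bound_of_continuousOn hf
  exact isBigO_admissible_of_le R fun d hd => by simpa using hR d.x hd.1

/-- A coefficient that vanishes at the origin is of the order of `|x|`. -/
lemma isBigO_coeff_norm (hK : IsCompact K) {f : E4 → ℝ} (hf : ContinuousOn f K)
    (hd : DifferentiableAt ℝ f 0) (h0 : f 0 = 0) :
    (fun d : EstDatum => f d.x) =O[𝓟 (admissible K)] fun d => ‖d.x‖ := by
  obtain ⟨R, hR⟩ := hK.exists_bound_of_continuousOn hf
  obtain ⟨c, hc⟩ := hd.hasFDerivAt.isBigO_sub.bound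
  obtain ⟨ε, hε, hball⟩ := Metric.eventually_nhds_iff_ball.1 hc
  refine isBigO_admissible_of_le (max c (R / ε)) fun d hd => ?_
  rw [abs_of_nonneg (norm_nonneg d.x)]
  by_cases hx : d.x ∈ Metric.ball 0 ε
  · have := hball d.x hx
    simp only [h0, sub_zero] at this
    exact this.trans (mul_le_mul_of_nonneg_right (le_max_left _ _) (norm_nonneg _))
  · have h1 : ε ≤ ‖d.x‖ := by simpa using hx
    have h2 : |f d.x| ≤ R := hR d.x hd.1
    have hR0 : 0 ≤ R := (abs_nonneg _).trans h2
    calc |f d.x| ≤ R / ε * ε := by rwa [div_mul_cancel₀ _ hε.ne']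
      _ ≤ R / ε * ‖d.x‖ := mul_le_mul_of_nonneg_left h1 (div_nonneg hR0 hε.le)
      _ ≤ _ := mul_le_mul_of_nonneg_right (le_max_right _ _) (norm_nonneg _)

lemma om_nonneg (d : EstDatum) : 0 ≤ d.om := by unfold EstDatum.om; positivity

lemma isBigO_affField (k : Fin 4) :
    (fun d : EstDatum => affField d.lam d.a d.x k) =O[𝓟 (admissible K)] EstDatum.om := by
  refine isBigO_admissible_of_le 1 fun d _ => ?_
  rw [one_mul, abs_of_nonneg (om_nonneg d)]
  have h1 : |d.x k| ≤ ‖d.x‖ := PiLp.norm_apply_le d.x k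
  have h2 : |d.a k| ≤ ‖d.a‖ := PiLp.norm_apply_le d.a k
  calc |affField d.lam d.a d.x k| = |d.lam * d.x k + d.a k| := by simp [affField]
    _ ≤ |d.lam| * |d.x k| + |d.a k| := by rw [← abs_mul]; exact abs_add_le _ _
    _ ≤ d.om := add_le_add (mul_le_mul_of_nonneg_left h1 (abs_nonneg _)) h2

lemma isBigO_lam_mul_norm :
    (fun d : EstDatum => d.lam * ‖d.x‖) =O[𝓟 (admissible K)] EstDatum.om := by
  refine isBigO_admissible_of_le 1 fun d _ => ?_
  rw [one_mul, abs_of_nonneg (om_nonneg d), abs_mul, abs_norm]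
  exact le_add_of_nonneg_right (norm_nonneg _)

/-! ### Products of the scales and the error term -/

lemma isBigO_err_of_le {f : EstDatum → ℝ} (h : ∀ d, |f d| ≤ d.err G) :
    f =O[𝓟 (admissible K)] EstDatum.err G :=
  isBigO_admissible_of_le 1 fun d _ => by
    rw [one_mul]; exact (h d).trans (le_abs_self _)

lemma isBigO_err_grad : (fun d : EstDatum => gradNorm G d.u d.x)
    =O[𝓟 (admissible K)] EstDatum.err G := by
  refine isBigO_err_of_le fun d => ?_
  have hp := gradNorm_nonneg G d.u d.x
  have hq := hessNorm_nonneg G d.u d.x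
  rw [abs_of_nonneg (by positivity), EstDatum.err]
  have : 0 ≤ hessNorm G d.u d.x * gradNorm G d.u d.x + gradNorm G d.u d.x ^ 3
    + ‖d.x‖ * (hessNorm G d.u d.x ^ 2 + gradNorm G d.u d.x ^ 4) := by positivity
  linarith

lemma isBigO_err_hess_grad : (fun d : EstDatum => hessNorm G d.u d.x * gradNorm G d.u d.x)
    =O[𝓟 (admissible K)] EstDatum.err G := by
  refine isBigO_err_of_le fun d => ?_
  have hp := gradNorm_nonneg G d.u d.x
  have hq := hessNorm_nonneg G d.u d.x
  rw [abs_of_nonneg (by positivity), EstDatum.err]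
  have : 0 ≤ gradNorm G d.u d.x + gradNorm G d.u d.x ^ 3
    + ‖d.x‖ * (hessNorm G d.u d.x ^ 2 + gradNorm G d.u d.x ^ 4) := by positivity
  linarith

lemma isBigO_err_grad_cube : (fun d : EstDatum => gradNorm G d.u d.x ^ 3)
    =O[𝓟 (admissible K)] EstDatum.err G := by
  refine isBigO_err_of_le fun d => ?_
  have hp := gradNorm_nonneg G d.u d.x
  have hq := hessNorm_nonneg G d.u d.x
  rw [abs_of_nonneg (by positivity), EstDatum.err]
  have : 0 ≤ gradNorm G d.u d.x + hessNorm G d.u d.x * gradNorm G d.u d.x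
    + ‖d.x‖ * (hessNorm G d.u d.x ^ 2 + gradNorm G d.u d.x ^ 4) := by positivity
  linarith

lemma isBigO_err_quartic :
    (fun d : EstDatum => ‖d.x‖ * (hessNorm G d.u d.x ^ 2 + gradNorm G d.u d.x ^ 4))
    =O[𝓟 (admissible K)] EstDatum.err G := by
  refine isBigO_err_of_le fun d => ?_
  have hp := gradNorm_nonneg G d.u d.x
  have hq := hessNorm_nonneg G d.u d.x
  rw [abs_of_nonneg (by positivity), EstDatum.err]
  have : 0 ≤ gradNorm G d.u d.x + hessNorm G d.u d.x * gradNorm G d.u d.x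
    + gradNorm G d.u d.x ^ 3 := by positivity
  linarith

lemma isBigO_err_hess_sq : (fun d : EstDatum => ‖d.x‖ * hessNorm G d.u d.x ^ 2)
    =O[𝓟 (admissible K)] EstDatum.err G := by
  refine IsBigO.trans (isBigO_admissible_of_le 1 fun d _ => ?_) isBigO_err_quartic
  rw [one_mul, abs_of_nonneg (by positivity), abs_of_nonneg (by positivity)]
  exact mul_le_mul_of_nonneg_left (le_add_of_nonneg_right (by positivity)) (norm_nonneg _)

lemma isBigO_err_grad_four : (fun d : EstDatum => ‖d.x‖ * gradNorm G d.u d.x ^ 4)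
    =O[𝓟 (admissible K)] EstDatum.err G := by
  refine IsBigO.trans (isBigO_admissible_of_le 1 fun d _ => ?_) isBigO_err_quartic
  rw [one_mul, abs_of_nonneg (by positivity), abs_of_nonneg (by positivity)]
  exact mul_le_mul_of_nonneg_left (le_add_of_nonneg_left (by positivity)) (norm_nonneg _)

lemma isBigO_err_grad_sq : (fun d : EstDatum => gradNorm G d.u d.x ^ 2)
    =O[𝓟 (admissible K)] EstDatum.err G := by
  refine IsBigO.trans (isBigO_admissible_of_le 1 fun d _ => ?_)
    (isBigO_err_grad.add isBigO_err_grad_cube)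
  have hp := gradNorm_nonneg G d.u d.x
  rw [one_mul, abs_of_nonneg (by positivity), abs_of_nonneg (by positivity)]
  nlinarith [mul_nonneg hp (sq_nonneg (gradNorm G d.u d.x - 1))]

lemma isBigO_bounded_mul {b f g : EstDatum → ℝ}
    (hb : b =O[𝓟 (admissible K)] fun _ => (1 : ℝ)) (hf : f =O[𝓟 (admissible K)] g) :
    (fun d => b d * f d) =O[𝓟 (admissible K)] g := by
  simpa using hb.mul hf

lemma isBigO_err_sec_grad (hK : IsCompact K) :
    (fun d : EstDatum => d.sec G * gradNorm G d.u d.x) =O[𝓟 (admissible K)] EstDatum.err G := by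
  refine isBigO_admissible_congr ((isBigO_err_hess_grad (G := G)).add
    (isBigO_bounded_mul (isBigO_norm_one hK) isBigO_err_grad_sq)) fun d _ => ?_
  rw [EstDatum.sec]; ring

lemma isBigO_err_sec_sq (hK : IsCompact K) :
    (fun d : EstDatum => ‖d.x‖ * d.sec G ^ 2) =O[𝓟 (admissible K)] EstDatum.err G := by
  have hr := isBigO_norm_one hK
  refine isBigO_admissible_congr (((isBigO_err_hess_sq (G := G)).add
    ((isBigO_bounded_mul hr (isBigO_bounded_mul hr isBigO_err_hess_grad)).const_mul_left 2)).add
    (isBigO_bounded_mul hr (isBigO_bounded_mul hr (isBigO_bounded_mul hr isBigO_err_grad_sq))))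
    fun d _ => ?_
  rw [EstDatum.sec]; ring

lemma isBigO_err_sec_grad_sq (hK : IsCompact K) :
    (fun d : EstDatum => ‖d.x‖ * (d.sec G * gradNorm G d.u d.x ^ 2))
      =O[𝓟 (admissible K)] EstDatum.err G := by
  have hr := isBigO_norm_one hK
  have h1 : (fun d : EstDatum => ‖d.x‖ * (hessNorm G d.u d.x * gradNorm G d.u d.x ^ 2))
      =O[𝓟 (admissible K)] EstDatum.err G := by
    refine IsBigO.trans (isBigO_admissible_of_le 1 fun d _ => ?_) isBigO_err_quartic
    have hq := hessNorm_nonneg G d.u d.x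
    rw [one_mul, abs_of_nonneg (by positivity), abs_of_nonneg (by positivity)]
    refine mul_le_mul_of_nonneg_left ?_ (norm_nonneg _)
    nlinarith [sq_nonneg (hessNorm G d.u d.x - gradNorm G d.u d.x ^ 2),
      sq_nonneg (hessNorm G d.u d.x), sq_nonneg (gradNorm G d.u d.x ^ 2)]
  refine isBigO_admissible_congr (h1.add
    (isBigO_bounded_mul hr (isBigO_bounded_mul hr (isBigO_err_grad_cube (G := G))))) fun d _ => ?_
  rw [EstDatum.sec]; ring

lemma isBigO_norm_grad_sec :
    (fun d : EstDatum => ‖d.x‖ * gradNorm G d.u d.x) =O[𝓟 (admissible K)] EstDatum.sec G := by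
  refine isBigO_admissible_of_le 1 fun d _ => ?_
  have hp := gradNorm_nonneg G d.u d.x
  have hq := hessNorm_nonneg G d.u d.x
  rw [one_mul, abs_of_nonneg (by positivity), abs_of_nonneg (by unfold EstDatum.sec; positivity)]
  exact le_add_of_nonneg_left hq

end Scales

/-! ### Normal coordinates -/

/-- A metric on `V` in coordinates whose Christoffel symbols vanish at the origin. -/
structure IsNormalOn (G : CoordMetric) (V : Set E4) : Prop extends IsRiemannianOn G V where
  zero_mem : 0 ∈ V
  christoffel_zero : ∀ k i j, christoffel G k i j 0 = 0

lemma isBigO_one_of_contDiffAt {V K : Set E4} (hK : IsCompact K) (hKV : K ⊆ V) {f : E4 → ℝ}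
    (hf : ∀ x ∈ V, ContDiffAt ℝ ∞ f x) :
    (fun d : EstDatum => f d.x) =O[𝓟 (admissible K)] fun _ => (1 : ℝ) :=
  isBigO_coeff_one hK fun x hx => (hf x (hKV hx)).continuousAt.continuousWithinAt

lemma isBigO_pd_one_of_contDiffAt {V K : Set E4} (hK : IsCompact K) (hKV : K ⊆ V) {f : E4 → ℝ}
    (hf : ∀ x ∈ V, ContDiffAt ℝ ∞ f x) (k : Fin 4) :
    (fun d : EstDatum => pd k f d.x) =O[𝓟 (admissible K)] fun _ => (1 : ℝ) :=
  isBigO_one_of_contDiffAt hK hKV fun x hx => contDiffAt_pd (hf x hx) (by simp) k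

namespace IsNormalOn

variable {G : CoordMetric} {V : Set E4}

/-- The first derivatives of the metric vanish where the Christoffel symbols do, since
`∂_l g_{ij} = g_{im} Γ^m_{lj} + g_{jm} Γ^m_{li}`. -/
lemma pd_metric_zero (H : IsNormalOn G V) (l i j : Fin 4) : pd l (fun y => G y i j) 0 = 0 := by
  have hpos := H.posDef 0 H.zero_mem
  have key : ∀ i j m, pd i (fun y => G y j m) 0 + pd j (fun y => G y i m) 0
      - pd m (fun y => G y i j) 0 = 0 := by
    intro i j m
    have h1 : ∀ k, ∑ l, (G 0)⁻¹ k l * (pd i (fun y => G y j l) 0 + pd j (fun y => G y i l) 0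
        - pd l (fun y => G y i j) 0) = 0 := by
      intro k
      have := H.christoffel_zero k i j
      rw [christoffel] at this
      linarith
    have h2 : ∑ k, G 0 m k * ∑ l, (G 0)⁻¹ k l * (pd i (fun y => G y j l) 0
        + pd j (fun y => G y i l) 0 - pd l (fun y => G y i j) 0) = 0 := by simp [h1]
    simp only [Finset.mul_sum, ← mul_assoc] at h2
    rw [Finset.sum_comm] at h2
    simpa only [← Finset.sum_mul, sum_mul_inv hpos, ite_mul, one_mul, zero_mul,
      Finset.sum_ite_eq, Finset.mem_univ, if_true] using h2
  have h1 := key l i j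
  have h2 := key l j i
  have h3 := H.pd_comm H.zero_mem l j i
  have h4 := H.pd_comm H.zero_mem j l i
  have h5 := H.pd_comm H.zero_mem i l j
  linarith

lemma pd_inv_zero (H : IsNormalOn G V) (l i k : Fin 4) : pd l (fun y => (G y)⁻¹ i k) 0 = 0 := by
  have hpos := H.posDef 0 H.zero_mem
  have hG : ∀ i j, DifferentiableAt ℝ (fun y => G y i j) 0 := fun i j =>
    H.differentiableAt H.zero_mem i j
  have hA : ∀ i j, DifferentiableAt ℝ (fun y => (G y)⁻¹ i j) 0 := fun i j =>
    (H.contDiffAt_inv H.zero_mem i j).differentiableAt (by simp)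
  have h1 : ∀ m, ∑ j, G 0 m j * pd l (fun y => (G y)⁻¹ j k) 0 = 0 := by
    intro m
    have hev : (fun y => ∑ j, G y m j * (G y)⁻¹ j k) =ᶠ[𝓝 0] fun _ => if m = k then 1 else 0 := by
      filter_upwards [H.isOpen.mem_nhds H.zero_mem] with y hy using sum_mul_inv (H.posDef y hy) m k
    have h2 := pd_congr hev l
    rw [pd_sum fun j _ => (hG m j).fun_mul (hA j k)] at h2
    simp only [pd_mul (hG _ _) (hA _ _), H.pd_metric_zero, zero_mul, zero_add] at h2
    rw [h2]
    simp [pd]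
  have h2 : ∑ m, (G 0)⁻¹ i m * ∑ j, G 0 m j * pd l (fun y => (G y)⁻¹ j k) 0 = 0 := by simp [h1]
  have hinv : ∀ j, ∑ m, (G 0)⁻¹ i m * G 0 m j = if i = j then 1 else 0 := fun j => by
    rw [← Matrix.mul_apply, Matrix.nonsing_inv_mul _ hpos.det_pos.ne'.isUnit, Matrix.one_apply]
  simp only [Finset.mul_sum, ← mul_assoc] at h2
  rw [Finset.sum_comm] at h2
  simpa only [← Finset.sum_mul, hinv, ite_mul, one_mul, zero_mul,
    Finset.sum_ite_eq, Finset.mem_univ, if_true] using h2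

lemma lapDrift_zero (H : IsNormalOn G V) (j : Fin 4) : lapDrift G j 0 = 0 := by
  simp [lapDrift, christoffelTrace, H.pd_inv_zero, H.christoffel_zero]

/-! ### The size of the remainder -/

section Estimates

variable {K : Set E4} (H : IsNormalOn G V) (hK : IsCompact K) (hKV : K ⊆ V)
include H hK hKV

lemma isBigO_norm_of_contDiffAt {f : E4 → ℝ} (hf : ∀ x ∈ V, ContDiffAt ℝ ∞ f x) (h0 : f 0 = 0) :
    (fun d : EstDatum => f d.x) =O[𝓟 (admissible K)] fun d => ‖d.x‖ :=
  isBigO_coeff_norm hK (fun x hx => (hf x (hKV hx)).continuousAt.continuousWithinAt)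
    ((hf 0 H.zero_mem).differentiableAt (by simp)) h0

lemma isBigO_inv (i j : Fin 4) :
    (fun d : EstDatum => (G d.x)⁻¹ i j) =O[𝓟 (admissible K)] fun _ => (1 : ℝ) :=
  isBigO_one_of_contDiffAt hK hKV fun _ hx => H.contDiffAt_inv hx i j

lemma isBigO_pd_inv (k i j : Fin 4) :
    (fun d : EstDatum => pd k (fun y => (G y)⁻¹ i j) d.x)
      =O[𝓟 (admissible K)] fun d => ‖d.x‖ :=
  H.isBigO_norm_of_contDiffAt hK hKV
    (fun _ hx => contDiffAt_pd (H.contDiffAt_inv hx i j) (by simp) k) (H.pd_inv_zero k i j)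

lemma isBigO_christoffel (k i j : Fin 4) :
    (fun d : EstDatum => christoffel G k i j d.x) =O[𝓟 (admissible K)] fun d => ‖d.x‖ :=
  H.isBigO_norm_of_contDiffAt hK hKV
    (fun _ hx => H.contDiffAt_christoffel hx k i j) (H.christoffel_zero k i j)

lemma isBigO_christoffelTrace (j : Fin 4) :
    (fun d : EstDatum => christoffelTrace G j d.x) =O[𝓟 (admissible K)] fun d => ‖d.x‖ :=
  IsBigO.fun_sum fun i _ => H.isBigO_christoffel hK hKV i i j

lemma isBigO_lapDrift (j : Fin 4) :
    (fun d : EstDatum => lapDrift G j d.x) =O[𝓟 (admissible K)] fun d => ‖d.x‖ :=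
  H.isBigO_norm_of_contDiffAt hK hKV (fun _ hx => H.contDiffAt_lapDrift hx j) (H.lapDrift_zero j)

lemma isBigO_pd (i : Fin 4) :
    (fun d : EstDatum => pd i d.u d.x) =O[𝓟 (admissible K)] fun d => gradNorm G d.u d.x := by
  have h1 : (fun d : EstDatum => Real.sqrt (G d.x i i)) =O[𝓟 (admissible K)] fun _ => (1 : ℝ) :=
    isBigO_coeff_one hK fun x hx =>
      ((H.contDiffAt (hKV hx) i i).continuousAt.continuousWithinAt).sqrt
  refine IsBigO.trans (isBigO_admissible_of_le 1 fun d hd => ?_)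
    (isBigO_bounded_mul h1 (isBigO_refl _ _))
  rw [one_mul]
  exact (abs_pd_le (H.posDef d.x (hKV hd.1)) d.u i).trans (le_abs_self _)

lemma isBigO_hess (i j : Fin 4) :
    (fun d : EstDatum => hess G d.u i j d.x)
      =O[𝓟 (admissible K)] fun d => hessNorm G d.u d.x := by
  have h1 : (fun d : EstDatum => Real.sqrt (G d.x i i * G d.x j j))
      =O[𝓟 (admissible K)] fun _ => (1 : ℝ) :=
    isBigO_coeff_one (f := fun x => Real.sqrt (G x i i * G x j j)) hK fun x hx =>
      (((H.contDiffAt (hKV hx) i i).mul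
        (H.contDiffAt (hKV hx) j j)).continuousAt.continuousWithinAt).sqrt
  refine IsBigO.trans (isBigO_admissible_of_le 1 fun d hd => ?_)
    (isBigO_bounded_mul h1 (isBigO_refl _ _))
  rw [one_mul]
  exact (abs_hess_le (H.posDef d.x (hKV hd.1)) d.u i j).trans (le_abs_self _)

lemma isBigO_pd_pd (i j : Fin 4) :
    (fun d : EstDatum => pd i (pd j d.u) d.x) =O[𝓟 (admissible K)] EstDatum.sec G := by
  have h1 : (fun d : EstDatum => hess G d.u i j d.x) =O[𝓟 (admissible K)] EstDatum.sec G := by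
    refine (H.isBigO_hess hK hKV i j).trans (isBigO_admissible_of_le 1 fun d _ => ?_)
    have hp := gradNorm_nonneg G d.u d.x
    have hq := hessNorm_nonneg G d.u d.x
    rw [one_mul, abs_of_nonneg hq, abs_of_nonneg (by unfold EstDatum.sec; positivity)]
    exact le_add_of_nonneg_right (by positivity)
  have h2 : (fun d : EstDatum => ∑ k, christoffel G k i j d.x * pd k d.u d.x)
      =O[𝓟 (admissible K)] EstDatum.sec G :=
    (IsBigO.fun_sum fun k _ => (H.isBigO_christoffel hK hKV k i j).mul (H.isBigO_pd hK hKV k)).trans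
      isBigO_norm_grad_sec
  refine isBigO_admissible_congr (h1.add h2) fun d _ => ?_
  rw [hess]; ring

lemma isBigO_lap :
    (fun d : EstDatum => lap G d.u d.x) =O[𝓟 (admissible K)] EstDatum.sec G := by
  have h1 : (fun d : EstDatum => ∑ i, ∑ j, (G d.x)⁻¹ i j * pd i (pd j d.u) d.x)
      =O[𝓟 (admissible K)] EstDatum.sec G :=
    IsBigO.fun_sum fun i _ => IsBigO.fun_sum fun j _ =>
      isBigO_bounded_mul (H.isBigO_inv hK hKV i j) (H.isBigO_pd_pd hK hKV i j)
  have h2 : (fun d : EstDatum => ∑ j, lapDrift G j d.x * pd j d.u d.x)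
      =O[𝓟 (admissible K)] EstDatum.sec G :=
    (IsBigO.fun_sum fun k _ => (H.isBigO_lapDrift hK hKV k).mul (H.isBigO_pd hK hKV k)).trans
      isBigO_norm_grad_sec
  exact isBigO_admissible_congr (h1.add h2) fun d hd =>
    H.lap_eq (hKV hd.1) (hd.2.of_le (by norm_num))

lemma isBigO_pd_gradNorm_sq (k : Fin 4) :
    (fun d : EstDatum => pd k (fun y => gradNorm G d.u y ^ 2) d.x)
      =O[𝓟 (admissible K)] fun d => d.sec G * gradNorm G d.u d.x := by
  have h1 : (fun d : EstDatum => ∑ i, ∑ j,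
      pd k (fun y => (G y)⁻¹ i j) d.x * pd i d.u d.x * pd j d.u d.x)
      =O[𝓟 (admissible K)] fun d => d.sec G * gradNorm G d.u d.x :=
    IsBigO.fun_sum fun i _ => IsBigO.fun_sum fun j _ =>
      ((((H.isBigO_pd_inv hK hKV k i j).mul (H.isBigO_pd hK hKV i)).trans
        isBigO_norm_grad_sec)).mul (H.isBigO_pd hK hKV j)
  have h2 : (fun d : EstDatum => ∑ i, ∑ j,
      (G d.x)⁻¹ i j * (pd k (pd j d.u) d.x * pd i d.u d.x))
      =O[𝓟 (admissible K)] fun d => d.sec G * gradNorm G d.u d.x :=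
    IsBigO.fun_sum fun i _ => IsBigO.fun_sum fun j _ =>
      isBigO_bounded_mul (H.isBigO_inv hK hKV i j)
        ((H.isBigO_pd_pd hK hKV k j).mul (H.isBigO_pd hK hKV i))
  refine isBigO_admissible_congr (h1.add (h2.const_mul_left 2)) fun d hd => ?_
  rw [H.pd_gradNorm_sq (hKV hd.1) (hd.2.of_le (by norm_num))]
  congr 2
  exact Finset.sum_congr rfl fun i _ => Finset.sum_congr rfl fun j _ => by ring

lemma isBigO_affDeriv :
    (fun d : EstDatum => affDeriv d.lam d.a d.u d.x)
      =O[𝓟 (admissible K)] fun d => d.om * gradNorm G d.u d.x := by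
  have h1 : (fun d : EstDatum => ∑ k, affField d.lam d.a d.x k * pd k d.u d.x)
      =O[𝓟 (admissible K)] fun d => d.om * gradNorm G d.u d.x :=
    IsBigO.fun_sum fun k _ => (isBigO_affField k).mul (H.isBigO_pd hK hKV k)
  refine isBigO_admissible_congr h1 fun d _ => ?_
  rw [affDeriv_eq]
  exact Finset.sum_congr rfl fun k _ => mul_comm _ _

lemma isBigO_divDefect :
    (fun d : EstDatum => ∑ j, christoffelTrace G j d.x * affField d.lam d.a d.x j)
      =O[𝓟 (admissible K)] fun d => d.om * ‖d.x‖ := by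
  refine IsBigO.fun_sum fun k _ => ?_
  simpa only [mul_comm] using (H.isBigO_christoffelTrace hK hKV k).mul (isBigO_affField k)

/-- The derivatives of `lapDrift` need not vanish at the origin; they account for the term `|∇u|`
without a factor `|x|`. -/
lemma isBigO_lapDefect :
    (fun d : EstDatum => lapDefect G d.lam d.a d.u d.x)
      =O[𝓟 (admissible K)] fun d => d.om * (‖d.x‖ * d.sec G + gradNorm G d.u d.x) := by
  have hA : (fun d : EstDatum => ∑ j, lapDrift G j d.x * pd j d.u d.x)
      =O[𝓟 (admissible K)] fun d => ‖d.x‖ * gradNorm G d.u d.x :=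
    IsBigO.fun_sum fun k _ => (H.isBigO_lapDrift hK hKV k).mul (H.isBigO_pd hK hKV k)
  have hsec : ∀ d : EstDatum, 0 ≤ d.sec G := fun d => by
    have hp := gradNorm_nonneg G d.u d.x
    have hq := hessNorm_nonneg G d.u d.x
    unfold EstDatum.sec; positivity
  have hp' : (fun d : EstDatum => gradNorm G d.u d.x)
      =O[𝓟 (admissible K)] fun d => ‖d.x‖ * d.sec G + gradNorm G d.u d.x := by
    refine isBigO_admissible_of_le 1 fun d _ => ?_
    have hp := gradNorm_nonneg G d.u d.x
    have := hsec d
    rw [one_mul, abs_of_nonneg hp, abs_of_nonneg (by positivity)]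
    exact le_add_of_nonneg_left (by positivity)
  have hs' : (fun d : EstDatum => ‖d.x‖ * d.sec G)
      =O[𝓟 (admissible K)] fun d => ‖d.x‖ * d.sec G + gradNorm G d.u d.x := by
    refine isBigO_admissible_of_le 1 fun d _ => ?_
    have hp := gradNorm_nonneg G d.u d.x
    have := hsec d
    rw [one_mul, abs_of_nonneg (by positivity), abs_of_nonneg (by positivity)]
    exact le_add_of_nonneg_right hp
  have h1 : (fun d : EstDatum => d.lam * ∑ j, lapDrift G j d.x * pd j d.u d.x)
      =O[𝓟 (admissible K)] fun d => d.om * (‖d.x‖ * d.sec G + gradNorm G d.u d.x) := by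
    have e1 := (isBigO_refl (fun d : EstDatum => d.lam) (𝓟 (admissible K))).mul hA
    have e2 := (isBigO_lam_mul_norm (K := K)).mul hp'
    exact e1.trans (isBigO_admissible_congr e2 fun d _ => by ring)
  have h2 : (fun d : EstDatum => ∑ k, affField d.lam d.a d.x k *
      (∑ i, ∑ j, pd k (fun y => (G y)⁻¹ i j) d.x * pd i (pd j d.u) d.x
      + ∑ j, pd k (lapDrift G j) d.x * pd j d.u d.x))
      =O[𝓟 (admissible K)] fun d => d.om * (‖d.x‖ * d.sec G + gradNorm G d.u d.x) := by
    refine IsBigO.fun_sum fun k _ => (isBigO_affField k).mul (IsBigO.add ?_ ?_)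
    · exact (IsBigO.fun_sum fun i _ => IsBigO.fun_sum fun j _ =>
        (H.isBigO_pd_inv hK hKV k i j).mul (H.isBigO_pd_pd hK hKV i j)).trans hs'
    · exact (IsBigO.fun_sum fun j _ => isBigO_bounded_mul
        (isBigO_pd_one_of_contDiffAt hK hKV (fun _ hx => H.contDiffAt_lapDrift hx j) k)
        (H.isBigO_pd hK hKV j)).trans hp'
  exact h1.neg_left.sub h2

lemma isBigO_gradDefect :
    (fun d : EstDatum => gradDefect G d.lam d.a d.u d.x)
      =O[𝓟 (admissible K)] fun d => d.om * (‖d.x‖ * gradNorm G d.u d.x ^ 2) := by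
  have h1 : (fun d : EstDatum => ∑ k, affField d.lam d.a d.x k *
      ∑ i, ∑ j, pd k (fun y => (G y)⁻¹ i j) d.x * pd i d.u d.x * pd j d.u d.x)
      =O[𝓟 (admissible K)] fun d => d.om * (‖d.x‖ * gradNorm G d.u d.x ^ 2) := by
    refine IsBigO.fun_sum fun k _ => (isBigO_affField k).mul
      (IsBigO.fun_sum fun i _ => IsBigO.fun_sum fun j _ => ?_)
    have := ((H.isBigO_pd_inv hK hKV k i j).mul (H.isBigO_pd hK hKV i)).mul (H.isBigO_pd hK hKV j)
    simpa only [sq, mul_assoc] using this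
  exact (h1.const_mul_left (1 / 2)).neg_left

lemma isBigO_hessDefectCoeff (j k : Fin 4) :
    (fun d : EstDatum => hessDefectCoeff G d.lam d.a j k d.x)
      =O[𝓟 (admissible K)] fun d => d.om * ‖d.x‖ := by
  refine IsBigO.fun_sum fun l _ => isBigO_bounded_mul (H.isBigO_inv hK hKV j l)
    (IsBigO.fun_sum fun i _ => ?_)
  simpa only [mul_comm] using (H.isBigO_christoffel hK hKV k i l).mul (isBigO_affField i)

lemma isBigO_pd_hessDefectCoeff (m j k : Fin 4) :
    (fun d : EstDatum => pd m (hessDefectCoeff G d.lam d.a j k) d.x)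
      =O[𝓟 (admissible K)] EstDatum.om := by
  have hr := isBigO_norm_one (K := K) hK
  have h1 : (fun d : EstDatum => ∑ l, (pd m (fun y => (G y)⁻¹ j l) d.x
        * ∑ i, christoffel G k i l d.x * affField d.lam d.a d.x i
      + (G d.x)⁻¹ j l * ∑ i, (pd m (christoffel G k i l) d.x * affField d.lam d.a d.x i
        + christoffel G k i l d.x * if m = i then d.lam else 0)))
      =O[𝓟 (admissible K)] EstDatum.om := by
    refine IsBigO.fun_sum fun l _ => IsBigO.add ?_ ?_
    · refine isBigO_bounded_mul ((H.isBigO_pd_inv hK hKV m j l).trans hr)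
        (IsBigO.fun_sum fun i _ => isBigO_bounded_mul
          ((H.isBigO_christoffel hK hKV k i l).trans hr) (isBigO_affField i))
    · refine isBigO_bounded_mul (H.isBigO_inv hK hKV j l)
        (IsBigO.fun_sum fun i _ => IsBigO.add ?_ ?_)
      · exact isBigO_bounded_mul (isBigO_pd_one_of_contDiffAt hK hKV
          (fun _ hx => H.contDiffAt_christoffel hx k i l) m) (isBigO_affField i)
      · by_cases hmi : m = i
        · simp only [hmi, if_true]
          refine ((H.isBigO_christoffel hK hKV k i l).mul
            (isBigO_refl (fun d : EstDatum => d.lam) _)).trans ?_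
          simpa only [mul_comm] using isBigO_lam_mul_norm (K := K)
        · simp only [hmi, if_false, mul_zero]
          exact isBigO_zero _ _
  refine isBigO_admissible_congr h1 fun d hd => ?_
  have hx := hKV hd.1
  have hA : ∀ i j, DifferentiableAt ℝ (fun y => (G y)⁻¹ i j) d.x := fun i j =>
    (H.contDiffAt_inv hx i j).differentiableAt (by simp)
  have hΓ : ∀ k i j, DifferentiableAt ℝ (christoffel G k i j) d.x := fun k i j =>
    (H.contDiffAt_christoffel hx k i j).differentiableAt (by simp)
  have hX := differentiableAt_affField d.lam d.a d.x
  have hsum : ∀ l, DifferentiableAt ℝ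
      (fun y => ∑ i, christoffel G k i l y * affField d.lam d.a y i) d.x := fun l =>
    DifferentiableAt.fun_sum fun i _ => (hΓ k i l).fun_mul (hX i)
  unfold hessDefectCoeff
  rw [pd_sum fun l _ => (hA j l).fun_mul (hsum l)]
  refine Finset.sum_congr rfl fun l _ => ?_
  rw [pd_mul (hA j l) (hsum l), pd_sum fun i _ => (hΓ k i l).fun_mul (hX i)]
  simp only [pd_mul (hΓ _ _ _) (hX _), pd_affField]

lemma isBigO_hessDefect (j : Fin 4) :
    (fun d : EstDatum => hessDefect G d.lam d.a d.u d.x j)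
      =O[𝓟 (admissible K)] fun d => d.om * (‖d.x‖ * gradNorm G d.u d.x) := by
  have : (fun d : EstDatum => ∑ k, hessDefectCoeff G d.lam d.a j k d.x * pd k d.u d.x)
      =O[𝓟 (admissible K)] fun d => d.om * (‖d.x‖ * gradNorm G d.u d.x) := by
    refine IsBigO.fun_sum fun k _ => ?_
    simpa only [mul_assoc] using
      (H.isBigO_hessDefectCoeff hK hKV j k).mul (H.isBigO_pd hK hKV k)
  exact this

lemma isBigO_divg_hessDefect :
    (fun d : EstDatum => divg G (hessDefect G d.lam d.a d.u) d.x)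
      =O[𝓟 (admissible K)] fun d => d.om * (‖d.x‖ * d.sec G)
        + d.om * gradNorm G d.u d.x := by
  have hsec : ∀ d : EstDatum, 0 ≤ d.sec G := fun d => by
    have hp := gradNorm_nonneg G d.u d.x
    have hq := hessNorm_nonneg G d.u d.x
    unfold EstDatum.sec; positivity
  have hp' : (fun d : EstDatum => d.om * gradNorm G d.u d.x) =O[𝓟 (admissible K)]
      fun d => d.om * (‖d.x‖ * d.sec G) + d.om * gradNorm G d.u d.x := by
    refine isBigO_admissible_of_le 1 fun d _ => ?_
    have hp := gradNorm_nonneg G d.u d.x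
    have := hsec d
    have := om_nonneg d
    rw [one_mul, abs_of_nonneg (by positivity), abs_of_nonneg (by positivity)]
    exact le_add_of_nonneg_left (by positivity)
  have hs' : (fun d : EstDatum => d.om * (‖d.x‖ * d.sec G)) =O[𝓟 (admissible K)]
      fun d => d.om * (‖d.x‖ * d.sec G) + d.om * gradNorm G d.u d.x := by
    refine isBigO_admissible_of_le 1 fun d _ => ?_
    have hp := gradNorm_nonneg G d.u d.x
    have := hsec d
    have := om_nonneg d
    rw [one_mul, abs_of_nonneg (by positivity), abs_of_nonneg (by positivity)]
    exact le_add_of_nonneg_right (by positivity)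
  have hr := isBigO_norm_one (K := K) hK
  have h1 : (fun d : EstDatum => ∑ i, ∑ k,
      (pd i (hessDefectCoeff G d.lam d.a i k) d.x * pd k d.u d.x
        + hessDefectCoeff G d.lam d.a i k d.x * pd i (pd k d.u) d.x)
      + ∑ j, christoffelTrace G j d.x
        * ∑ k, hessDefectCoeff G d.lam d.a j k d.x * pd k d.u d.x)
      =O[𝓟 (admissible K)] fun d => d.om * (‖d.x‖ * d.sec G) + d.om * gradNorm G d.u d.x := by
    refine IsBigO.add (IsBigO.fun_sum fun i _ => IsBigO.fun_sum fun k _ => IsBigO.add ?_ ?_)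
      (IsBigO.fun_sum fun j _ => isBigO_bounded_mul
        ((H.isBigO_christoffelTrace hK hKV j).trans hr) (IsBigO.fun_sum fun k _ => ?_))
    · exact ((H.isBigO_pd_hessDefectCoeff hK hKV i i k).mul (H.isBigO_pd hK hKV k)).trans hp'
    · refine IsBigO.trans ?_ hs'
      simpa only [mul_assoc] using
        (H.isBigO_hessDefectCoeff hK hKV i k).mul (H.isBigO_pd_pd hK hKV i k)
    · refine IsBigO.trans (((H.isBigO_hessDefectCoeff hK hKV j k).trans ?_).mul
        (H.isBigO_pd hK hKV k)) hp'
      simpa using (isBigO_refl EstDatum.om (𝓟 (admissible K))).mul hr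
  refine isBigO_admissible_congr h1 fun d hd => ?_
  have hx := hKV hd.1
  exact divg_linear
    (fun i k => (H.contDiffAt_hessDefectCoeff hx i k).differentiableAt (by simp))
    (fun k => (contDiffAt_pd (m := 1) (hd.2.of_le (n := 4) (m := 2) (by norm_num))
      (by norm_num) k).differentiableAt one_ne_zero)
    (Eventually.of_forall fun y i => rfl)

/-- Divergences of fields linear in the gradient, with smooth coefficients; these are the curvature
terms of the operator. -/
lemma isBigO_divg_linear {c : Fin 4 → Fin 4 → E4 → ℝ}
    (hc : ∀ i k, ∀ x ∈ V, ContDiffAt ℝ ∞ (c i k) x)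
    {L : EstDatum → E4 → E4} (hL : ∀ d y i, L d y i = ∑ k, c i k y * pd k d.u y) :
    (fun d : EstDatum => divg G (L d) d.x)
      =O[𝓟 (admissible K)] fun d => d.sec G + gradNorm G d.u d.x := by
  have hsec : ∀ d : EstDatum, 0 ≤ d.sec G := fun d => by
    have hp := gradNorm_nonneg G d.u d.x
    have hq := hessNorm_nonneg G d.u d.x
    unfold EstDatum.sec; positivity
  have hp' : (fun d : EstDatum => gradNorm G d.u d.x) =O[𝓟 (admissible K)]
      fun d => d.sec G + gradNorm G d.u d.x := by
    refine isBigO_admissible_of_le 1 fun d _ => ?_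
    have hp := gradNorm_nonneg G d.u d.x
    have := hsec d
    rw [one_mul, abs_of_nonneg hp, abs_of_nonneg (by positivity)]
    linarith
  have hs' : EstDatum.sec G =O[𝓟 (admissible K)] fun d => d.sec G + gradNorm G d.u d.x := by
    refine isBigO_admissible_of_le 1 fun d _ => ?_
    have hp := gradNorm_nonneg G d.u d.x
    have := hsec d
    rw [one_mul, abs_of_nonneg this, abs_of_nonneg (by positivity)]
    linarith
  have hr := isBigO_norm_one (K := K) hK
  have h1 : (fun d : EstDatum => ∑ i, ∑ k, (pd i (c i k) d.x * pd k d.u d.x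
        + c i k d.x * pd i (pd k d.u) d.x)
      + ∑ j, christoffelTrace G j d.x * ∑ k, c j k d.x * pd k d.u d.x)
      =O[𝓟 (admissible K)] fun d => d.sec G + gradNorm G d.u d.x := by
    refine IsBigO.add (IsBigO.fun_sum fun i _ => IsBigO.fun_sum fun k _ => IsBigO.add ?_ ?_)
      (IsBigO.fun_sum fun j _ => isBigO_bounded_mul
        ((H.isBigO_christoffelTrace hK hKV j).trans hr) (IsBigO.fun_sum fun k _ => ?_))
    · exact (isBigO_bounded_mul (isBigO_pd_one_of_contDiffAt hK hKV (hc i k) i)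
        (H.isBigO_pd hK hKV k)).trans hp'
    · exact (isBigO_bounded_mul (isBigO_one_of_contDiffAt hK hKV (hc i k))
        (H.isBigO_pd_pd hK hKV i k)).trans hs'
    · exact (isBigO_bounded_mul (isBigO_one_of_contDiffAt hK hKV (hc j k))
        (H.isBigO_pd hK hKV k)).trans hp'
  refine isBigO_admissible_congr h1 fun d hd => ?_
  exact divg_linear (fun i k => (hc i k _ (hKV hd.1)).differentiableAt (by simp))
    (fun k => (contDiffAt_pd (m := 1) (hd.2.of_le (n := 4) (m := 2) (by norm_num))
      (by norm_num) k).differentiableAt one_ne_zero)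
    (Eventually.of_forall fun y i => hL d y i)

lemma isBigO_divg_scalarCurv_grad :
    (fun d : EstDatum => divg G (fun y => scalarCurv G y • grad G d.u y) d.x)
      =O[𝓟 (admissible K)] fun d => d.sec G + gradNorm G d.u d.x := by
  refine H.isBigO_divg_linear hK hKV (c := fun i k y => scalarCurv G y * (G y)⁻¹ i k)
    (fun i k x hx => (H.contDiffAt_scalarCurv hx).mul (H.contDiffAt_inv hx i k)) fun d y i => ?_
  simp only [PiLp.smul_apply, smul_eq_mul, grad, Finset.mul_sum, mul_assoc]

lemma isBigO_divg_paneitz_field :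
    (fun d : EstDatum => divg G (fun y => ((2 / 3 : ℝ) * scalarCurv G y) • grad G d.u y
        - (2 : ℝ) • ricGrad G d.u y) d.x)
      =O[𝓟 (admissible K)] fun d => d.sec G + gradNorm G d.u d.x := by
  refine H.isBigO_divg_linear hK hKV (c := fun i k y => (2 / 3 : ℝ) * scalarCurv G y * (G y)⁻¹ i k
      - 2 * ∑ j, ∑ l, (G y)⁻¹ i j * ricci G j l y * (G y)⁻¹ l k)
    (fun i k x hx => ?_) fun d y i => ?_
  · refine ((contDiffAt_const.mul (H.contDiffAt_scalarCurv hx)).mul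
      (H.contDiffAt_inv hx i k)).sub (contDiffAt_const.mul (ContDiffAt.sum fun j _ =>
        ContDiffAt.sum fun l _ => ?_))
    exact ((H.contDiffAt_inv hx i j).mul (H.contDiffAt_ricci hx j l)).mul (H.contDiffAt_inv hx l k)
  · simp only [PiLp.sub_apply, PiLp.smul_apply, smul_eq_mul, grad, ricGrad, sub_mul,
      Finset.sum_sub_distrib]
    congr 1
    · simp only [Finset.mul_sum, mul_assoc]
    · simp only [Finset.mul_sum, Finset.sum_mul]
      conv_rhs => rw [Finset.sum_comm]
      refine Finset.sum_congr rfl fun j _ => ?_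
      conv_rhs => rw [Finset.sum_comm]
      exact Finset.sum_congr rfl fun l _ => Finset.sum_congr rfl fun k _ => by ring

/-- The remainder in the Pohozaev identity is controlled by the error term. -/
theorem isBigO_pohozaevDefect (γ₂ γ₃ : ℝ) :
    (fun d : EstDatum => pohozaevDefect G γ₂ γ₃ d.lam d.a d.u d.x)
      =O[𝓟 (admissible K)] fun d => d.om * d.err G := by
  set l := 𝓟 (admissible K)
  have hom := isBigO_refl EstDatum.om l
  have hF := H.isBigO_lap hK hKV
  have hS := isBigO_refl (fun d : EstDatum => gradNorm G d.u d.x ^ 2) l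
  have hδ := H.isBigO_divDefect hK hKV
  have hL := H.isBigO_lapDefect hK hKV
  have hD := H.isBigO_gradDefect hK hKV
  have b7 := isBigO_err_sec_grad (G := G) hK
  have b8 := isBigO_err_sec_sq (G := G) hK
  have b9 := isBigO_err_sec_grad_sq (G := G) hK
  have b6 := isBigO_err_grad_four (G := G) (K := K)
  have b4 := isBigO_err_grad_cube (G := G) (K := K)
  have b3 := isBigO_err_grad_sq (G := G) (K := K)
  -- each product in `pohozaevDefect` is of the order of one of the scales `b3`, ..., `b9`
  have t1 : (fun d : EstDatum => lap G d.u d.x ^ 2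
      * ∑ j, christoffelTrace G j d.x * affField d.lam d.a d.x j)
      =O[l] fun d => d.om * d.err G :=
    ((hF.pow 2).mul hδ).trans (isBigO_admissible_congr (hom.mul b8) fun d _ => by ring)
  have t2 : (fun d : EstDatum => lap G d.u d.x * lapDefect G d.lam d.a d.u d.x)
      =O[l] fun d => d.om * d.err G :=
    (hF.mul hL).trans (isBigO_admissible_congr (hom.mul (b8.add b7)) fun d _ => by ring)
  have t3 : (fun d : EstDatum => gradNorm G d.u d.x ^ 2 * gradDefect G d.lam d.a d.u d.x)
      =O[l] fun d => d.om * d.err G :=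
    (hS.mul hD).trans (isBigO_admissible_congr (hom.mul b6) fun d _ => by ring)
  have t4 : (fun d : EstDatum => (gradNorm G d.u d.x ^ 2) ^ 2
      * ∑ j, christoffelTrace G j d.x * affField d.lam d.a d.x j)
      =O[l] fun d => d.om * d.err G :=
    ((hS.pow 2).mul hδ).trans (isBigO_admissible_congr (hom.mul b6) fun d _ => by ring)
  have t5 : (fun d : EstDatum => gradNorm G d.u d.x ^ 2 * lap G d.u d.x
      * ∑ j, christoffelTrace G j d.x * affField d.lam d.a d.x j)
      =O[l] fun d => d.om * d.err G :=
    ((hS.mul hF).mul hδ).trans (isBigO_admissible_congr (hom.mul b9) fun d _ => by ring)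
  have t6 : (fun d : EstDatum => gradNorm G d.u d.x ^ 2 * lapDefect G d.lam d.a d.u d.x)
      =O[l] fun d => d.om * d.err G :=
    (hS.mul hL).trans (isBigO_admissible_congr (hom.mul (b9.add b4)) fun d _ => by ring)
  have t7 : (fun d : EstDatum => lap G d.u d.x * gradDefect G d.lam d.a d.u d.x)
      =O[l] fun d => d.om * d.err G :=
    (hF.mul hD).trans (isBigO_admissible_congr (hom.mul b9) fun d _ => by ring)
  have t8 : (fun d : EstDatum => gradNorm G d.u d.x ^ 2
      * divg G (hessDefect G d.lam d.a d.u) d.x) =O[l] fun d => d.om * d.err G :=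
    (hS.mul (H.isBigO_divg_hessDefect hK hKV)).trans
      (isBigO_admissible_congr (hom.mul (b9.add b4)) fun d _ => by ring)
  have t9 : (fun d : EstDatum => fderiv ℝ (fun y => gradNorm G d.u y ^ 2) d.x
      (hessDefect G d.lam d.a d.u d.x)) =O[l] fun d => d.om * d.err G := by
    have : (fun d : EstDatum => ∑ k, pd k (fun y => gradNorm G d.u y ^ 2) d.x
        * hessDefect G d.lam d.a d.u d.x k) =O[l] fun d => d.om * d.err G :=
      IsBigO.fun_sum fun k _ => ((H.isBigO_pd_gradNorm_sq hK hKV k).mul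
        (H.isBigO_hessDefect hK hKV k)).trans
          (isBigO_admissible_congr (hom.mul b9) fun d _ => by ring)
    exact isBigO_admissible_congr this fun d _ => fderiv_eq_sum_pd _ _ _
  have t10 : ∀ f : EstDatum → ℝ, f =O[l] (fun d => d.sec G + gradNorm G d.u d.x) →
      (fun d : EstDatum => affDeriv d.lam d.a d.u d.x * f d) =O[l] fun d => d.om * d.err G :=
    fun f hf => ((H.isBigO_affDeriv hK hKV).mul hf).trans
      (isBigO_admissible_congr (hom.mul (b7.add b3)) fun d _ => by ring)
  have t11 := t10 _ (H.isBigO_divg_paneitz_field hK hKV)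
  have t12 := t10 _ (H.isBigO_divg_scalarCurv_grad hK hKV)
  have total := (((((t1.const_mul_left (1 / 2)).sub t2).const_mul_left (γ₂ / 2 + 6 * γ₃)).sub
    ((t3.sub (t4.const_mul_left (1 / 4))).const_mul_left (12 * γ₃))).add
    ((((t5.sub t6).sub (t7.const_mul_left 2)).add (t8.add t9)).const_mul_left (6 * γ₃))).add
    ((t11.const_mul_left (γ₂ / 2)).sub (t12.const_mul_left (2 * γ₃)))
  refine isBigO_admissible_congr total fun d _ => ?_
  simp only [pohozaevDefect]
  ring

end Estimates

end IsNormalOn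

/-! ### The metric in a geodesic chart -/

section Chart

variable {M : Type*} [TopologicalSpace M] [ChartedSpace E4 M] [IsManifold 𝓘(ℝ, E4) ∞ M]
  {φ : OpenPartialHomeomorph M E4}

lemma contMDiffOn_coordVec (hφ : φ ∈ IsManifold.maximalAtlas 𝓘(ℝ, E4) ∞ M) (i : Fin 4) :
    ContMDiffOn 𝓘(ℝ, E4) (𝓘(ℝ, E4).prod 𝓘(ℝ, E4)) ∞
      (fun x : E4 => Bundle.TotalSpace.mk' E4 (E := fun q : M => TangentSpace 𝓘(ℝ, E4) q)
        (φ.symm x) (coordVec φ x i)) φ.target := by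
  have h1 : ContMDiffOn 𝓘(ℝ, E4) 𝓘(ℝ, E4) ∞ φ.symm φ.target :=
    contMDiffOn_symm_of_mem_maximalAtlas hφ
  have h2 := h1.contMDiffOn_tangentMapWithin (m := ∞) (by simp)
    φ.open_target.uniqueMDiffOn
  have h3 : ContMDiff 𝓘(ℝ, E4) (𝓘(ℝ, E4).prod 𝓘(ℝ, E4)) ∞
      (fun x : E4 => (⟨x, ev i⟩ : TangentBundle 𝓘(ℝ, E4) E4)) := by
    intro x
    refine (Bundle.contMDiffAt_section (E := TangentSpace 𝓘(ℝ, E4))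
      (s := fun _ : E4 => ev i) x).2 ?_
    simp only [trivializationAt_model_space_apply]
    exact contMDiffAt_const
  refine (h2.comp h3.contMDiffOn fun x hx => hx).congr fun x hx => ?_
  simp only [Function.comp_apply, tangentMapWithin, coordVec,
    mfderivWithin_of_isOpen φ.open_target hx]

lemma contDiffOn_metricMatrix (g : SmoothMetric M)
    (hφ : φ ∈ IsManifold.maximalAtlas 𝓘(ℝ, E4) ∞ M) (i j : Fin 4) :
    ContDiffOn ℝ ∞ (fun x => metricMatrix g φ x i j) φ.target := by
  rw [← contMDiffOn_iff_contDiffOn]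
  have h1 : ContMDiffOn 𝓘(ℝ, E4) 𝓘(ℝ, E4) ∞ φ.symm φ.target :=
    contMDiffOn_symm_of_mem_maximalAtlas hφ
  have h2 := g.contMDiff.comp_contMDiffOn h1
  have h3 := h2.clm_bundle_apply₂ (F₁ := E4) (F₂ := E4) (F₃ := ℝ) (E₃ := Bundle.Trivial M ℝ)
    (contMDiffOn_coordVec hφ i) (contMDiffOn_coordVec hφ j)
  intro x hx
  have h4 := h3 x hx
  simp only [Bundle.contMDiffWithinAt_totalSpace] at h4
  exact h4.2

omit [IsManifold 𝓘(ℝ, E4) ∞ M] in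
lemma sum_smul_coordVec (x v : E4) :
    (mfderiv 𝓘(ℝ, E4) 𝓘(ℝ, E4) φ.symm x v : TangentSpace 𝓘(ℝ, E4) (φ.symm x))
      = ∑ i, v i • coordVec φ x i := by
  have hv : v = ∑ i, v i • (EuclideanSpace.single i (1 : ℝ) : E4) := by
    ext k; simp [Pi.single_apply]
  conv_lhs => rw [hv]
  exact (map_sum _ _ _).trans (Finset.sum_congr rfl fun i _ => map_smul _ _ _)

omit [IsManifold 𝓘(ℝ, E4) ∞ M] in
lemma mfderiv_symm_injective (hφ : φ ∈ IsManifold.maximalAtlas 𝓘(ℝ, E4) ∞ M) {x : E4}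
    (hx : x ∈ φ.target) : Function.Injective (mfderiv 𝓘(ℝ, E4) 𝓘(ℝ, E4) φ.symm x) := by
  have h1 : MDifferentiableAt 𝓘(ℝ, E4) 𝓘(ℝ, E4) φ.symm x :=
    (contMDiffAt_symm_of_mem_maximalAtlas hφ hx).mdifferentiableAt (by simp)
  have h2 : MDifferentiableAt 𝓘(ℝ, E4) 𝓘(ℝ, E4) φ (φ.symm x) :=
    (contMDiffAt_of_mem_maximalAtlas hφ (φ.map_target hx)).mdifferentiableAt (by simp)
  have h3 := mfderiv_comp x h2 h1
  have h4 : mfderiv 𝓘(ℝ, E4) 𝓘(ℝ, E4) (φ ∘ φ.symm) x = ContinuousLinearMap.id ℝ _ := by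
    have : φ ∘ φ.symm =ᶠ[𝓝 x] id := by
      filter_upwards [φ.open_target.mem_nhds hx] with y hy using φ.right_inv hy
    rw [this.mfderiv_eq, mfderiv_id]
  rw [h4] at h3
  intro v w hvw
  have := congrArg (mfderiv 𝓘(ℝ, E4) 𝓘(ℝ, E4) φ (φ.symm x)) hvw
  have e : ∀ v, v = mfderiv 𝓘(ℝ, E4) 𝓘(ℝ, E4) φ (φ.symm x)
      (mfderiv 𝓘(ℝ, E4) 𝓘(ℝ, E4) φ.symm x v) := fun v => DFunLike.congr_fun h3 v
  rw [e v, e w, this]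

lemma isRiemannianOn_metricMatrix (g : SmoothMetric M)
    (hφ : φ ∈ IsManifold.maximalAtlas 𝓘(ℝ, E4) ∞ M) :
    IsRiemannianOn (metricMatrix g φ) φ.target where
  isOpen := φ.open_target
  contDiffOn := contDiffOn_metricMatrix g hφ
  posDef x hx := by
    refine Matrix.PosDef.of_dotProduct_mulVec_pos ?_ fun v hv => ?_
    · ext i j
      simpa [metricMatrix] using g.symm _ _ _
    · have h0 : (mfderiv 𝓘(ℝ, E4) 𝓘(ℝ, E4) φ.symm x (WithLp.toLp 2 v)) ≠ 0 := by
        intro h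
        apply hv
        have h' := mfderiv_symm_injective hφ hx (h.trans (map_zero _).symm)
        have : (WithLp.toLp 2 v : E4) = 0 := h'
        simpa using this
      have hsymm := g.symm (φ.symm x)
      have h1 := g.pos _ _ h0
      rw [sum_smul_coordVec] at h1
      simpa [metricMatrix, Matrix.mulVec, dotProduct, Finset.mul_sum, mul_comm, mul_left_comm,
        map_sum, _root_.sum_apply, hsymm] using h1

lemma christoffel_comm {G : CoordMetric} {V : Set E4} (H : IsRiemannianOn G V) {x : E4}
    (hx : x ∈ V) (k i j : Fin 4) : christoffel G k i j x = christoffel G k j i x := by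
  unfold christoffel
  congr 1
  refine Finset.sum_congr rfl fun l _ => ?_
  rw [H.pd_comm hx l i j]
  ring

/-- The geodesic equation of the rays through the origin gives `Γ^k_{ij}(0) xⁱ xʲ = 0`, whence
`Γ^k_{ij}(0) = 0` by polarization. -/
lemma IsGeodesicChart.isNormalOn {g : SmoothMetric M} {p : M} (hφ : IsGeodesicChart g p φ) :
    IsNormalOn (metricMatrix g φ) φ.target := by
  have H := isRiemannianOn_metricMatrix g hφ.mem_atlas
  have h0 : (0 : E4) ∈ φ.target := hφ.map_center ▸ φ.map_source hφ.mem_source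
  refine { toIsRiemannianOn := H, zero_mem := h0, christoffel_zero := fun k i j => ?_ }
  set G := metricMatrix g φ
  have hd : ∀ x : E4, deriv (fun t : ℝ => t • x) = fun _ => x := fun x => by
    funext t
    simpa using ((hasDerivAt_id t).smul_const x).deriv
  have h1 : ∀ x ∈ φ.target, ∑ i, ∑ j, christoffel G k i j 0 * x i * x j = 0 := fun x hx => by
    have := hφ.rays x hx 0 (by simp) k
    simpa [hd] using this
  have h2 : ∀ x : E4, ∑ i, ∑ j, christoffel G k i j 0 * x i * x j = 0 := fun x => by
    have hc : ContinuousAt (fun t : ℝ => t • x) 0 := by fun_prop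
    have hmem : ∀ᶠ t : ℝ in 𝓝 0, t • x ∈ φ.target :=
      hc (by simpa using φ.open_target.mem_nhds h0)
    obtain ⟨t, ht, ht0⟩ := ((hmem.filter_mono nhdsWithin_le_nhds).and
      (self_mem_nhdsWithin (s := {0}ᶜ))).exists
    have h3 := h1 _ ht
    have h4 : ∑ i, ∑ j, christoffel G k i j 0 * (t • x) i * (t • x) j
        = t ^ 2 * ∑ i, ∑ j, christoffel G k i j 0 * x i * x j := by
      simp only [Finset.mul_sum, PiLp.smul_apply, smul_eq_mul]
      exact Finset.sum_congr rfl fun i _ => Finset.sum_congr rfl fun j _ => by ring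
    rw [h4] at h3
    exact (mul_eq_zero.1 h3).resolve_left (pow_ne_zero 2 ht0)
  have hi : ∀ i, christoffel G k i i 0 = 0 := fun i => by simpa using h2 (ev i)
  have hij := h2 (ev i + ev j)
  simp [mul_add, Finset.sum_add_distrib, hi, christoffel_comm H h0 k j i] at hij
  linarith

end Chart

/-! ### Integration of the Pohozaev identity -/

lemma bdryInt_congr {G : CoordMetric} {D : Set E4} {f h : E4 → ℝ}
    (hfh : ∀ x ∈ frontier D, f x = h x) : bdryInt G D f = bdryInt G D h :=
  integral_congr_ae ((ae_surfaceMeasure_mem_frontier G D).mono hfh)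

lemma volInt_const_mul (G : CoordMetric) (D : Set E4) (c : ℝ) (f : E4 → ℝ) :
    volInt G D (fun x => c * f x) = c * volInt G D f := by
  simp only [volInt, mul_assoc]
  exact integral_const_mul c _

lemma affField_radial (x : E4) : affField 1 0 x = x := by simp [affField]

lemma affField_const (a x : E4) : affField 0 a x = a := by simp [affField]

lemma affDeriv_radial (u : E4 → ℝ) : affDeriv 1 0 u = fun y => fderiv ℝ u y y := by
  funext y; simp [affDeriv, affField_radial]

lemma affDeriv_const (a : E4) (u : E4 → ℝ) : affDeriv 0 a u = fun y => fderiv ℝ u y a := by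
  funext y; simp [affDeriv, affField_const]

namespace IsRiemannianOn

variable {G : CoordMetric} {V D : Set E4}

lemma continuousOn_gradNorm (H : IsRiemannianOn G V) {s : Set E4} (hs : s ⊆ V) {u : E4 → ℝ}
    (hu : ∀ x ∈ s, ContDiffAt ℝ 4 u x) : ContinuousOn (gradNorm G u) s := by
  have h1 : ContinuousOn (fun x => Real.sqrt (gradNorm G u x ^ 2)) s := fun x hx =>
    (H.contDiffAt_gradNorm_sq_three (hs hx) (hu x hx)).continuousAt.continuousWithinAt.sqrt
  simpa only [Real.sqrt_sq (gradNorm_nonneg _ _ _)] using h1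

lemma continuousOn_hessNorm (H : IsRiemannianOn G V) {s : Set E4} (hs : s ⊆ V) {u : E4 → ℝ}
    (hu : ∀ x ∈ s, ContDiffAt ℝ 4 u x) : ContinuousOn (hessNorm G u) s := by
  have hinv : ∀ i j, ContinuousOn (fun x => (G x)⁻¹ i j) s := fun i j x hx =>
    (H.contDiffAt_inv (hs hx) i j).continuousAt.continuousWithinAt
  have hh : ∀ i j, ContinuousOn (hess G u i j) s := by
    intro i j
    refine ContinuousOn.sub (fun x hx => ?_) (continuousOn_finsetSum _ fun k _ =>
      ContinuousOn.mul (fun x hx => ?_) fun x hx => ?_)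
    · have h1 : ContDiffAt ℝ 2 (pd j u) x := contDiffAt_pd (hu x hx) (by norm_num) j
      exact (contDiffAt_pd (m := 1) h1 (by norm_num) i).continuousAt.continuousWithinAt
    · exact (H.contDiffAt_christoffel (hs hx) k i j).continuousAt.continuousWithinAt
    · exact (contDiffAt_pd (m := 2) (hu x hx) (by norm_num) k).continuousAt.continuousWithinAt
  unfold hessNorm
  exact (continuousOn_finsetSum _ fun i _ => continuousOn_finsetSum _ fun j _ =>
    continuousOn_finsetSum _ fun k _ => continuousOn_finsetSum _ fun l _ =>
      (((hinv i k).mul (hinv j l)).mul (hh i j)).mul (hh k l)).sqrt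

lemma continuousOn_divg (H : IsRiemannianOn G V) {s : Set E4} (hs : s ⊆ V) {X : E4 → E4}
    (hX : ∀ x ∈ s, ContDiffAt ℝ 1 X x) : ContinuousOn (divg G X) s := by
  have h : divg G X = fun x => ∑ i, pd i (fun y => X y i) x
      + ∑ j, christoffelTrace G j x * X x j := funext fun x => divg_eq G X x
  have hXi : ∀ i, ∀ x ∈ s, ContDiffAt ℝ 1 (fun y => X y i) x := fun i x hx =>
    (contDiffAt_euclidean.1 (hX x hx)) i
  rw [h]
  refine ContinuousOn.add (continuousOn_finsetSum _ fun i _ x hx => ?_)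
    (continuousOn_finsetSum _ fun j _ => ContinuousOn.mul (fun x hx => ?_) fun x hx => ?_)
  · exact (contDiffAt_pd (m := 0) (hXi i x hx) (by norm_num) i).continuousAt.continuousWithinAt
  · exact (H.contDiffAt_christoffelTrace (hs hx) j).continuousAt.continuousWithinAt
  · exact (hXi j x hx).continuousAt.continuousWithinAt

section VolInt

variable (H : IsRiemannianOn G V) (hDc : IsCompact (closure D)) (hDV : closure D ⊆ V)
  {f h : E4 → ℝ}
include H hDc hDV

lemma integrableOn_of_continuousOn (hf : ContinuousOn f (closure D)) :
    IntegrableOn (fun x => f x * Real.sqrt (G x).det) D :=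
  ((hf.mul fun _ hx => ((H.contDiffAt_sqrt_det
    (hDV hx)).continuousAt.continuousWithinAt)).integrableOn_compact hDc).mono_set subset_closure

lemma volInt_add (hf : ContinuousOn f (closure D)) (hh : ContinuousOn h (closure D)) :
    volInt G D (fun x => f x + h x) = volInt G D f + volInt G D h := by
  simp only [volInt, add_mul]
  exact integral_add (H.integrableOn_of_continuousOn hDc hDV hf)
    (H.integrableOn_of_continuousOn hDc hDV hh)

lemma volInt_mono (hD : IsOpen D) (hf : ContinuousOn f (closure D))
    (hh : ContinuousOn h (closure D)) (hfh : ∀ x ∈ D, f x ≤ h x) :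
    volInt G D f ≤ volInt G D h :=
  setIntegral_mono_on (H.integrableOn_of_continuousOn hDc hDV hf)
    (H.integrableOn_of_continuousOn hDc hDV hh) hD.measurableSet
    fun x hx => mul_le_mul_of_nonneg_right (hfh x hx) (Real.sqrt_nonneg _)

lemma abs_volInt_le (hD : IsOpen D) (hh : ContinuousOn h (closure D))
    (hfh : ∀ x ∈ D, |f x| ≤ h x) : |volInt G D f| ≤ volInt G D h := by
  unfold volInt
  rw [← Real.norm_eq_abs]
  refine norm_integral_le_of_norm_le (H.integrableOn_of_continuousOn hDc hDV hh) ?_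
  filter_upwards [ae_restrict_mem hD.measurableSet] with x hx
  rw [norm_mul, Real.norm_of_nonneg (Real.sqrt_nonneg _)]
  exact mul_le_mul_of_nonneg_right (hfh x hx) (Real.sqrt_nonneg _)

end VolInt

end IsRiemannianOn

/-- The boundary functional of the affine field `y ↦ lam y + a`, which comprises `bdryRadial` and
`bdryConst`. -/
def bdryAffine (G : CoordMetric) (γ₂ γ₃ lam : ℝ) (a : E4) (D : Set E4) (u : E4 → ℝ) : ℝ :=
  (γ₂ / 2 + 6 * γ₃) * bdryInt G D (fun x =>
      affDeriv lam a u x * fderiv ℝ (lap G u) x (outerNormal G D x)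
      - lap G u x * fderiv ℝ (affDeriv lam a u) x (outerNormal G D x)
      + 1 / 2 * lap G u x ^ 2 * ginner G x (affField lam a x) (outerNormal G D x))
  - 12 * γ₃ * bdryInt G D (fun x =>
      gradNorm G u x ^ 2 * fderiv ℝ u x (outerNormal G D x) * affDeriv lam a u x
      - 1 / 4 * gradNorm G u x ^ 4 * ginner G x (affField lam a x) (outerNormal G D x))
  + 6 * γ₃ * bdryInt G D (fun x =>
      affDeriv lam a u x * (fderiv ℝ (fun y => gradNorm G u y ^ 2) x (outerNormal G D x)
        - 2 * lap G u x * fderiv ℝ u x (outerNormal G D x))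
      + gradNorm G u x ^ 2 * (ginner G x (affField lam a x) (outerNormal G D x) * lap G u x
        - lam * fderiv ℝ u x (outerNormal G D x)
        - hessForm G u x (affField lam a x) (outerNormal G D x)))

lemma bdryAffine_radial (G : CoordMetric) (γ₂ γ₃ : ℝ) (D : Set E4) (u : E4 → ℝ) :
    bdryAffine G γ₂ γ₃ 1 0 D u = bdryRadial G γ₂ γ₃ D u := by
  simp only [bdryAffine, bdryRadial, affDeriv_radial, affField_radial, one_mul]

lemma bdryAffine_const (G : CoordMetric) (γ₂ γ₃ : ℝ) (D : Set E4) (a : E4) (u : E4 → ℝ) :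
    bdryAffine G γ₂ γ₃ 0 a D u = bdryConst G γ₂ γ₃ D a u := by
  simp only [bdryAffine, bdryConst, affDeriv_const, affField_const, zero_mul, sub_zero]

namespace IsRiemannianOn

variable {G : CoordMetric} {V D : Set E4} {u : E4 → ℝ}

lemma bdryAffine_eq (H : IsRiemannianOn G V) (hD : IsOpen D) (hDc : IsCompact (closure D))
    (hDb : HasC1Boundary D) (hDV : closure D ⊆ V) (hu : ∀ x ∈ closure D, ContDiffAt ℝ 4 u x)
    (γ₂ γ₃ lam : ℝ) (a : E4) :
    bdryAffine G γ₂ γ₃ lam a D u = (γ₂ / 2 + 6 * γ₃) * volInt G D (divg G (biharmField G lam a u))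
      - 12 * γ₃ * volInt G D (divg G (quarticField G lam a u))
      + 6 * γ₃ * volInt G D (divg G (cubicField G lam a u)) := by
  rw [H.volInt_divg_eq_bdryInt hD hDc hDb hDV fun x hx =>
      H.contDiffAt_biharmField (hDV hx) (hu x hx),
    H.volInt_divg_eq_bdryInt hD hDc hDb hDV fun x hx =>
      H.contDiffAt_quarticField (hDV hx) (hu x hx),
    H.volInt_divg_eq_bdryInt hD hDc hDb hDV fun x hx =>
      H.contDiffAt_cubicField (hDV hx) (hu x hx),
    bdryAffine]
  have hfr : ∀ x ∈ frontier D, x ∈ closure D := fun x hx => frontier_subset_closure hx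
  congr 1
  · congr 1
    · exact congrArg _ (bdryInt_congr fun x hx =>
        (ginner_biharmField (H.posDef x (hDV (hfr x hx))) _).symm)
    · exact congrArg _ (bdryInt_congr fun x hx =>
        (ginner_quarticField (H.posDef x (hDV (hfr x hx))) _).symm)
  · exact congrArg _ (bdryInt_congr fun x hx =>
      (H.ginner_cubicField (hDV (hfr x hx)) ((hu x (hfr x hx)).of_le (by norm_num)) _).symm)

/-- The divergence of `e^{4u} X`, which contains the product of `Xu` with the right hand side of the
equation. -/
lemma divg_exp_smul_affField (G : CoordMetric) {x : E4} (hu : DifferentiableAt ℝ u x) (lam : ℝ)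
    (a : E4) :
    divg G (fun y => Real.exp (4 * u y) • affField lam a y) x
      = Real.exp (4 * u x) * (4 * lam + ∑ j, christoffelTrace G j x * affField lam a x j)
        + 4 * Real.exp (4 * u x) * affDeriv lam a u x := by
  have h4 : DifferentiableAt ℝ (fun y => 4 * u y) x := hu.const_mul 4
  rw [divg_smul h4.exp ((contDiff_affField lam a (n := 1)).differentiable one_ne_zero x),
    divg_affField, fderiv_exp h4, fderiv_const_mul hu]
  simp only [_root_.smul_apply, smul_eq_mul, affDeriv]
  ring

end IsRiemannianOn

namespace IsNormalOn

variable {G : CoordMetric} {V K : Set E4}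

/-- The estimate for the boundary functional of an affine field, with a constant that does not
depend on the field. -/
theorem exists_bound (H : IsNormalOn G V) (hK : IsCompact K) (hKV : K ⊆ V) (γ₂ γ₃ Λ : ℝ) :
    ∃ C : ℝ, 0 ≤ C ∧ ∀ (D : Set E4) (u w : E4 → ℝ) (μ : ℝ), IsOpen D → closure D ⊆ K →
      HasC1Boundary D → (∀ x ∈ closure D, ContDiffAt ℝ 4 u x) → (∀ x ∈ D, |w x| ≤ Λ) →
      (∀ x ∈ D, logDetOp G γ₂ γ₃ u x + w x = μ * Real.exp (4 * u x)) →
      ∀ (lam : ℝ) (a : E4),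
        |bdryAffine G γ₂ γ₃ lam a D u + lam * (μ * volInt G D (fun x => Real.exp (4 * u x)))
            - μ / 4 * bdryInt G D (fun x =>
                Real.exp (4 * u x) * ginner G x (affField lam a x) (outerNormal G D x))|
          ≤ C * volInt G D (fun x => EstDatum.om ⟨x, u, lam, a⟩
              * (|μ| * (Real.exp (4 * u x) * ‖x‖) + EstDatum.err G ⟨x, u, lam, a⟩)) := by
  obtain ⟨c₁, hc₁⟩ := Asymptotics.isBigO_principal.1 (H.isBigO_pohozaevDefect hK hKV γ₂ γ₃)
  obtain ⟨c₂, hc₂⟩ := Asymptotics.isBigO_principal.1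
    ((H.isBigO_affDeriv hK hKV).trans ((Asymptotics.isBigO_refl EstDatum.om _).mul
      (isBigO_err_grad (G := G))))
  obtain ⟨c₃, hc₃⟩ := Asymptotics.isBigO_principal.1 (H.isBigO_divDefect hK hKV)
  refine ⟨|c₁| + |Λ| * |c₂| + |c₃|, by positivity, ?_⟩
  intro D u w μ hD hDK hDb hu hw heq lam a
  have HR := H.toIsRiemannianOn
  have hDV : closure D ⊆ V := hDK.trans hKV
  have hDc : IsCompact (closure D) := hK.of_isClosed_subset isClosed_closure hDK
  set E : E4 → ℝ := fun x => Real.exp (4 * u x)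
  set Z : E4 → E4 := fun y => Real.exp (4 * u y) • affField lam a y
  have hEc : ∀ x ∈ closure D, ContDiffAt ℝ 1 E x := fun x hx =>
    (contDiffAt_const.mul ((hu x hx).of_le (by norm_num))).exp
  have hZ : ∀ x ∈ closure D, ContDiffAt ℝ 1 Z x := fun x hx =>
    (hEc x hx).smul (contDiff_affField lam a).contDiffAt
  have hEcont : ContinuousOn E (closure D) := fun x hx =>
    (hEc x hx).continuousAt.continuousWithinAt
  have hb1 := HR.continuousOn_divg hDV fun x hx =>
    HR.contDiffAt_biharmField (lam := lam) (a := a) (hDV hx) (hu x hx)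
  have hb2 := HR.continuousOn_divg hDV fun x hx =>
    HR.contDiffAt_quarticField (lam := lam) (a := a) (hDV hx) (hu x hx)
  have hb3 := HR.continuousOn_divg hDV fun x hx =>
    HR.contDiffAt_cubicField (lam := lam) (a := a) (hDV hx) (hu x hx)
  have hb4 := HR.continuousOn_divg hDV hZ
  have hflux : bdryInt G D (fun x =>
      E x * ginner G x (affField lam a x) (outerNormal G D x)) = volInt G D (divg G Z) := by
    rw [HR.volInt_divg_eq_bdryInt hD hDc hDb hDV hZ]
    exact bdryInt_congr fun x _ => (ginner_smul_left _ _ _ _ _).symm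
  have hsum : bdryAffine G γ₂ γ₃ lam a D u + lam * (μ * volInt G D E)
      - μ / 4 * volInt G D (divg G Z)
      = volInt G D (fun x => (((γ₂ / 2 + 6 * γ₃) * divg G (biharmField G lam a u) x
          + -(12 * γ₃) * divg G (quarticField G lam a u) x)
          + 6 * γ₃ * divg G (cubicField G lam a u) x)
          + (lam * μ * E x + -(μ / 4) * divg G Z x)) := by
    rw [HR.volInt_add hDc hDV
        (((hb1.const_mul _).fun_add (hb2.const_mul _)).fun_add (hb3.const_mul _))
        ((hEcont.const_mul _).fun_add (hb4.const_mul _)),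
      HR.volInt_add hDc hDV ((hb1.const_mul _).fun_add (hb2.const_mul _)) (hb3.const_mul _),
      HR.volInt_add hDc hDV (hb1.const_mul _) (hb2.const_mul _),
      HR.volInt_add hDc hDV (hEcont.const_mul _) (hb4.const_mul _)]
    simp only [volInt_const_mul]
    rw [HR.bdryAffine_eq hD hDc hDb hDV hu]
    ring
  rw [hflux, hsum, ← volInt_const_mul]
  have hp := HR.continuousOn_gradNorm hDV hu
  have hq := HR.continuousOn_hessNorm hDV hu
  refine HR.abs_volInt_le hDc hDV hD ?_ fun x hx => ?_
  · have hucont : ContinuousOn u (closure D) := fun x hx =>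
      (hu x hx).continuousAt.continuousWithinAt
    unfold EstDatum.om EstDatum.err
    dsimp only
    fun_prop
  have hxc := subset_closure hx
  have hd : (⟨x, u, lam, a⟩ : EstDatum) ∈ admissible K := ⟨hDK hxc, hu x hxc⟩
  have h1 := hc₁ _ hd
  have h2 := hc₂ _ hd
  have h3 := hc₃ _ hd
  have hid := HR.pohozaev_identity (lam := lam) (a := a) (hDV hxc) (hu x hxc) γ₂ γ₃
  have hdiv := IsRiemannianOn.divg_exp_smul_affField G (lam := lam) (a := a)
    ((hu x hxc).differentiableAt (by norm_num))
  have heqx : logDetOp G γ₂ γ₃ u x = μ * E x - w x := by have := heq x hx; simp only [E]; linarith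
  set d : EstDatum := ⟨x, u, lam, a⟩
  have hom := om_nonneg d
  have hE : 0 < E x := Real.exp_pos _
  have herr : 0 ≤ d.err G := by
    have := gradNorm_nonneg G d.u d.x
    have := hessNorm_nonneg G d.u d.x
    unfold EstDatum.err; positivity
  -- the equation turns `Xu` times the operator into `μ e^{4u} Xu - w Xu`, and the divergence of
  -- `e^{4u} X` removes the first of these terms
  have hval : (((γ₂ / 2 + 6 * γ₃) * divg G (biharmField G lam a u) x
          + -(12 * γ₃) * divg G (quarticField G lam a u) x)
          + 6 * γ₃ * divg G (cubicField G lam a u) x)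
          + (lam * μ * E x + -(μ / 4) * divg G Z x)
      = pohozaevDefect G γ₂ γ₃ lam a u x - w x * affDeriv lam a u x
        - μ * E x / 4 * ∑ j, christoffelTrace G j x * affField lam a x j := by
    rw [hdiv]
    rw [heqx] at hid
    linear_combination hid
  rw [hval]
  rw [Real.norm_eq_abs, Real.norm_of_nonneg (by positivity)] at h1 h2 h3
  have h1' : |pohozaevDefect G γ₂ γ₃ lam a u x| ≤ |c₁| * (d.om * d.err G) :=
    h1.trans (mul_le_mul_of_nonneg_right (le_abs_self _) (by positivity))
  have h2' : |w x * affDeriv lam a u x| ≤ |Λ| * (|c₂| * (d.om * d.err G)) := by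
    rw [abs_mul]
    exact mul_le_mul ((hw x hx).trans (le_abs_self _))
      (h2.trans (mul_le_mul_of_nonneg_right (le_abs_self _) (by positivity)))
      (abs_nonneg _) (abs_nonneg _)
  have h3' : |μ * E x / 4 * ∑ j, christoffelTrace G j x * affField lam a x j|
      ≤ |μ| * E x * (|c₃| * (d.om * ‖x‖)) := by
    rw [abs_mul, abs_div, abs_mul, abs_of_pos hE, abs_of_pos (by norm_num : (0 : ℝ) < 4)]
    refine mul_le_mul ?_
      (h3.trans (mul_le_mul_of_nonneg_right (le_abs_self _) (by positivity)))
      (abs_nonneg _) (by positivity)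
    have : 0 ≤ |μ| * E x := by positivity
    linarith
  refine (abs_sub _ _).trans ((add_le_add ((abs_sub _ _).trans (add_le_add h1' h2')) h3').trans ?_)
  have r1 : 0 ≤ |Λ| * |c₂| * (d.om * (|μ| * (E x * ‖x‖))) := by positivity
  have r2 : 0 ≤ |c₁| * (d.om * (|μ| * (E x * ‖x‖))) := by positivity
  have r3 : 0 ≤ |c₃| * (d.om * d.err G) := by positivity
  linarith

end IsNormalOn

/-! ### The error integrals -/

namespace IsRiemannianOn

variable {G : CoordMetric} {V D : Set E4} {u : E4 → ℝ}

lemma volInt_le_of_le_add (H : IsRiemannianOn G V) (hD : IsOpen D) (hDc : IsCompact (closure D))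
    (hDV : closure D ⊆ V) {f f₁ f₂ f₃ f₄ : E4 → ℝ} (c : ℝ) (hf : ContinuousOn f (closure D))
    (h₁ : ContinuousOn f₁ (closure D)) (h₂ : ContinuousOn f₂ (closure D))
    (h₃ : ContinuousOn f₃ (closure D)) (h₄ : ContinuousOn f₄ (closure D))
    (h : ∀ x, f x ≤ c * f₁ x + f₂ x + f₃ x + f₄ x) :
    volInt G D f ≤ c * volInt G D f₁ + volInt G D f₂ + volInt G D f₃ + volInt G D f₄ := by
  have h1 := h₁.const_mul c
  rw [← volInt_const_mul, ← H.volInt_add hDc hDV h1 h₂, ← H.volInt_add hDc hDV (h1.fun_add h₂) h₃,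
    ← H.volInt_add hDc hDV ((h1.fun_add h₂).fun_add h₃) h₄]
  exact H.volInt_mono hDc hDV hD hf (((h1.fun_add h₂).fun_add h₃).fun_add h₄) fun x _ => h x

lemma volInt_error_radial_le (H : IsRiemannianOn G V) (hD : IsOpen D)
    (hDc : IsCompact (closure D)) (hDV : closure D ⊆ V)
    (hu : ∀ x ∈ closure D, ContDiffAt ℝ 4 u x) (μ : ℝ) :
    volInt G D (fun x => EstDatum.om ⟨x, u, 1, 0⟩
        * (|μ| * (Real.exp (4 * u x) * ‖x‖) + EstDatum.err G ⟨x, u, 1, 0⟩))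
      ≤ |μ| * volInt G D (fun x => Real.exp (4 * u x) * ‖x‖ ^ 2)
        + volInt G D (fun x => gradNorm G u x * (‖x‖ + gradNorm G u x))
        + volInt G D (fun x => ‖x‖ * (hessNorm G u x * gradNorm G u x + gradNorm G u x ^ 3))
        + volInt G D (fun x => ‖x‖ ^ 2 * (hessNorm G u x ^ 2 + gradNorm G u x ^ 4)) := by
  have hc : ContinuousOn u (closure D) := fun x hx => (hu x hx).continuousAt.continuousWithinAt
  have hp := H.continuousOn_gradNorm hDV hu
  have hq := H.continuousOn_hessNorm hDV hu
  unfold EstDatum.om EstDatum.err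
  dsimp only
  refine H.volInt_le_of_le_add hD hDc hDV _ (by fun_prop) (by fun_prop) (by fun_prop) (by fun_prop)
    (by fun_prop) fun x => ?_
  simp only [abs_one, one_mul, norm_zero, add_zero]
  linarith [sq_nonneg (gradNorm G u x)]

lemma volInt_error_const_le (H : IsRiemannianOn G V) (hD : IsOpen D)
    (hDc : IsCompact (closure D)) (hDV : closure D ⊆ V)
    (hu : ∀ x ∈ closure D, ContDiffAt ℝ 4 u x) (μ : ℝ) (a : E4) :
    volInt G D (fun x => EstDatum.om ⟨x, u, 0, a⟩
        * (|μ| * (Real.exp (4 * u x) * ‖x‖) + EstDatum.err G ⟨x, u, 0, a⟩))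
      ≤ |μ| * volInt G D (fun x => Real.exp (4 * u x) * (‖x‖ * ‖a‖))
        + volInt G D (fun x => ‖a‖ * gradNorm G u x * (1 + ‖x‖ * gradNorm G u x))
        + volInt G D (fun x => ‖a‖ * (hessNorm G u x * gradNorm G u x + gradNorm G u x ^ 3))
        + volInt G D (fun x => ‖x‖ * ‖a‖ * (hessNorm G u x ^ 2 + gradNorm G u x ^ 4)) := by
  have hc : ContinuousOn u (closure D) := fun x hx => (hu x hx).continuousAt.continuousWithinAt
  have hp := H.continuousOn_gradNorm hDV hu
  have hq := H.continuousOn_hessNorm hDV hu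
  unfold EstDatum.om EstDatum.err
  dsimp only
  refine H.volInt_le_of_le_add hD hDc hDV _ (by fun_prop) (by fun_prop) (by fun_prop) (by fun_prop)
    (by fun_prop) fun x => ?_
  simp only [abs_zero, zero_mul, zero_add]
  have : 0 ≤ ‖a‖ * ‖x‖ * gradNorm G u x ^ 2 := by positivity
  linarith

end IsRiemannianOn

/-! ### Passage to the chart -/

section Chart

variable {M : Type*} [TopologicalSpace M] {φ : OpenPartialHomeomorph M E4}

lemma closure_image_subset_image_closure [T2Space M] {Ω K : Set M} (hK : IsCompact K)
    (hKφ : K ⊆ φ.source) (hΩ : Ω ⊆ K) :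
    closure (φ '' Ω) ⊆ φ '' closure Ω := by
  have hcK : closure Ω ⊆ K := closure_minimal hΩ hK.isClosed
  have hc : IsCompact (φ '' closure Ω) :=
    (hK.of_isClosed_subset isClosed_closure hcK).image_of_continuousOn
      (φ.continuousOn.mono (hcK.trans hKφ))
  exact closure_minimal (image_mono subset_closure) hc.isClosed

lemma contDiffAt_comp_symm [ChartedSpace E4 M] [IsManifold 𝓘(ℝ, E4) ∞ M]
    (hφ : φ ∈ IsManifold.maximalAtlas 𝓘(ℝ, E4) ∞ M) {u : M → ℝ} {q : M} (hq : q ∈ φ.source)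
    (hu : ContMDiffAt 𝓘(ℝ, E4) 𝓘(ℝ, ℝ) 4 u q) : ContDiffAt ℝ 4 (u ∘ φ.symm) (φ q) := by
  rw [← contMDiffAt_iff_contDiffAt]
  have h1 : ContMDiffAt 𝓘(ℝ, E4) 𝓘(ℝ, E4) 4 φ.symm (φ q) :=
    (contMDiffAt_symm_of_mem_maximalAtlas hφ (φ.map_source hq)).of_le
      (WithTop.coe_le_coe.2 (le_top (a := (4 : ℕ∞))))
  refine ContMDiffAt.comp (φ q) ?_ h1
  rwa [φ.left_inv hq]

end Chart

end LogDet

end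

open LogDet
theorem proposition7p2
    {M : Type*} [TopologicalSpace M] [T2Space M] [ChartedSpace E4 M]
    [IsManifold 𝓘(ℝ, E4) ∞ M]
    (g : SmoothMetric M) (p : M)
    (φ : OpenPartialHomeomorph M E4) (hφ : IsGeodesicChart g p φ)
    (K : Set M) (hK : IsCompact K) (hKφ : K ⊆ φ.source)
    (γ₂ γ₃ Λ : ℝ) :
    ∃ C : ℝ, 0 ≤ C ∧
      ∀ (Ω : Set M) (u Ut : M → ℝ) (μ : ℝ),
        IsOpen Ω → Ω ⊆ K → HasC1Boundary (φ '' Ω) →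
        (∀ q ∈ closure Ω, ContMDiffAt 𝓘(ℝ, E4) 𝓘(ℝ, ℝ) 4 u q) →
        (∀ q ∈ Ω, |Ut q| ≤ Λ) →
        (∀ q ∈ Ω, logDetOp (metricMatrix g φ) γ₂ γ₃ (u ∘ φ.symm) (φ q) + Ut q
          = μ * Real.exp (4 * u q)) →
        let G : CoordMetric := metricMatrix g φ
        let D : Set E4 := φ '' Ω
        let v : E4 → ℝ := u ∘ φ.symm
        |bdryRadial G γ₂ γ₃ D v
            - (- μ * volInt G D (fun x => Real.exp (4 * v x))
              + μ / 4 * bdryInt G D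
                  (fun x => Real.exp (4 * v x) * ginner G x x (outerNormal G D x)))|
          ≤ C * (|μ| * volInt G D (fun x => Real.exp (4 * v x) * ‖x‖ ^ 2)
              + volInt G D (fun x => gradNorm G v x * (‖x‖ + gradNorm G v x))
              + volInt G D (fun x =>
                  ‖x‖ * (hessNorm G v x * gradNorm G v x + gradNorm G v x ^ 3))
              + volInt G D (fun x =>
                  ‖x‖ ^ 2 * (hessNorm G v x ^ 2 + gradNorm G v x ^ 4)))
        ∧ ∀ a : E4,
          |bdryConst G γ₂ γ₃ D a v
              - μ / 4 * bdryInt G D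
                  (fun x => Real.exp (4 * v x) * ginner G x a (outerNormal G D x))|
            ≤ C * (|μ| * volInt G D (fun x => Real.exp (4 * v x) * (‖x‖ * ‖a‖))
                + volInt G D (fun x => ‖a‖ * gradNorm G v x * (1 + ‖x‖ * gradNorm G v x))
                + volInt G D (fun x =>
                    ‖a‖ * (hessNorm G v x * gradNorm G v x + gradNorm G v x ^ 3))
                + volInt G D (fun x =>
                    ‖x‖ * ‖a‖ * (hessNorm G v x ^ 2 + gradNorm G v x ^ 4))) := by
  have H := hφ.isNormalOn
  have HR := H.toIsRiemannianOn
  have hK' : IsCompact (φ '' K) := hK.image_of_continuousOn (φ.continuousOn.mono hKφ)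
  have hKV : φ '' K ⊆ φ.target := by
    rintro _ ⟨q, hq, rfl⟩
    exact φ.map_source (hKφ hq)
  obtain ⟨C, hC, hbound⟩ := H.exists_bound hK' hKV γ₂ γ₃ Λ
  refine ⟨C, hC, ?_⟩
  intro Ω u Ut μ hΩ hΩK hΩb hu hUt heq G D v
  have hcK : closure Ω ⊆ K := closure_minimal hΩK hK.isClosed
  have hcl : closure D ⊆ φ '' closure Ω := closure_image_subset_image_closure hK hKφ hΩK
  have hDK : closure D ⊆ φ '' K := hcl.trans (image_mono hcK)
  have hDV : closure D ⊆ φ.target := hDK.trans hKV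
  have hDc : IsCompact (closure D) := hK'.of_isClosed_subset isClosed_closure hDK
  have hD : IsOpen D := φ.isOpen_image_of_subset_source hΩ (hΩK.trans hKφ)
  have hv : ∀ x ∈ closure D, ContDiffAt ℝ 4 v x := by
    intro x hx
    obtain ⟨q, hq, rfl⟩ := hcl hx
    exact contDiffAt_comp_symm hφ.mem_atlas (hKφ (hcK hq)) (hu q hq)
  have hw : ∀ x ∈ D, |(Ut ∘ φ.symm) x| ≤ Λ := by
    rintro _ ⟨q, hq, rfl⟩
    simpa [φ.left_inv (hKφ (hΩK hq))] using hUt q hq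
  have heqD : ∀ x ∈ D, logDetOp G γ₂ γ₃ v x + (Ut ∘ φ.symm) x = μ * Real.exp (4 * v x) := by
    rintro _ ⟨q, hq, rfl⟩
    simpa [v, φ.left_inv (hKφ (hΩK hq))] using heq q hq
  have hmain := hbound D v (Ut ∘ φ.symm) μ hD hDK hΩb hv hw heqD
  refine ⟨?_, fun a => ?_⟩
  · have h1 := hmain 1 0
    simp only [bdryAffine_radial, affField_radial, one_mul] at h1
    rw [show ∀ b s t : ℝ, b - (-μ * s + t) = b + μ * s - t from fun b s t => by ring]
    exact h1.trans (mul_le_mul_of_nonneg_left (HR.volInt_error_radial_le hD hDc hDV hv μ) hC)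
  · have h1 := hmain 0 a
    simp only [bdryAffine_const, affField_const, zero_mul, add_zero] at h1
    exact h1.trans (mul_le_mul_of_nonneg_left (HR.volInt_error_const_le hD hDc hDV hv μ a) hC)
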